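/- **Definitions.** An instance of GTDS consists of a rational discount factor $\lambda=\frac pq$ with integers $0<p<q$, a rational target $t=\frac cd$ with $c\in\mathbb Z$ and an integer $d\ge 1$, and weights $a_1<a_2<\dots<a_k$ in $\mathbb N$. A solution is an infinite word $w\in\{a_1,\dots,a_k\}^\omega$ with $\sum_{i=0}^\infty w(i)\lambda^i=t$. An instance of CGTDS has, in addition, an $\omega$-regular expression $e$ whose letters are natural numbers (weights), built by the grammar $e::=U^\omega\mid U\cdot e\mid e+e$ with $U$ a regular expression; a solution then also has to belong to the language of $e$. Here $U^\omega$ is the set of infinite concatenations of nonempty words of $U$. The length $|e|$ is the number of symbols of $e$ (letters, $\emptyset$, $\varepsilon$, $+$, ${}^*$, ${}^\omega$), where concatenation is juxtaposition and is not counted, nor are parentheses; e.g. $|a^\omega|=2$. A word is eventually periodic if it is $uv^\omega$ for finite words $u,v$ with $v$ nonempty. Instances are given as strings over a finite alphabet, with all numbers in binary. **Theorem.** 1. The problem whether a given CGTDS instance has an eventually-periodic solution is decidable in PSPACE, and so is the problem whether a given GTDS instance has an eventually-periodic solution. 2. If a CGTDS instance has an eventually-periodic solution, then it has a solution of the form $uv^\omega$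 ($v$ nonempty) with $$|u|+|v|\;\le\;2\cdot|e|\cdot\max\Bigl(1,\;d\cdot\frac{\lambda a_k}{1-\lambda}\Bigr),$$ that is, $|u|+|v|\le 2\cdot d\cdot|e|\cdot\frac{\lambda a_k}{1-\lambda}$ whenever $d\cdot\frac{\lambda a_k}{1-\lambda}\ge 1$, and $|u|+|v|\le 2|e|$ otherwise. If a GTDS instance has an eventually-periodic solution, then it has a solution $uv^\omega$ ($v$ nonempty) that satisfies the same bound with $|e|$ replaced by $2$ (the length of the trivial constraint $\Sigma^\omega$, where $\Sigma$ counts as one symbol). -/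

import Mathlib

/-! ### Infinite words and ω-regular expressions

An infinite word over `α` is a `Stream' α`; `u ++ₛ w` is the infinite word `u w`, and
`Stream'.cycle v hv` is `v^ω` for a nonempty finite word `v`. -/

/-- `w` is eventually periodic: `w = u v^ω` for finite words `u` and `v` with `v` nonempty. -/
def IsEventuallyPeriodic {α : Type*} (w : Stream' α) : Prop :=
  ∃ (u v : List α) (hv : v ≠ []), w = u ++ₛ Stream'.cycle v hv

/-- `U^ω`: the infinite words that can be cut into infinitely many nonempty factors in `U`. -/
def omegaPower {α : Type*} (U : Language α) : Set (Stream' α) :=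
  {w | ∃ s : ℕ → ℕ, StrictMono s ∧ s 0 = 0 ∧ ∀ i, (w.drop (s i)).take (s (i + 1) - s i) ∈ U}

/-- ω-regular expressions: `U^ω`, `U · e` and `e + e'`, with `U` a regular expression. -/
inductive OmegaRegularExpression (α : Type*) where
  | omega : RegularExpression α → OmegaRegularExpression α
  | concat : RegularExpression α → OmegaRegularExpression α → OmegaRegularExpression α
  | union : OmegaRegularExpression α → OmegaRegularExpression α → OmegaRegularExpression α

/-- The ω-language of an ω-regular expression. -/
def OmegaRegularExpression.language {α : Type*} : OmegaRegularExpression α → Set (Stream' α)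
  | omega U => omegaPower U.matches'
  | concat U e => {w | ∃ u ∈ U.matches', ∃ w' ∈ e.language, w = u ++ₛ w'}
  | union e e' => e.language ∪ e'.language

/-- The length of a regular expression: the number of its symbols. Concatenation is written as
juxtaposition and does not count; parentheses do not count either. -/
def RegularExpression.length {α : Type*} : RegularExpression α → ℕ
  | zero => 1
  | epsilon => 1
  | char _ => 1
  | plus P Q => P.length + Q.length + 1
  | comp P Q => P.length + Q.length
  | star P => P.length + 1

/-- The length of an ω-regular expression: the number of its symbols, counted in the same way.
For instance, `a^ω` has length `2`. -/
def OmegaRegularExpression.length {α : Type*} : OmegaRegularExpression α → ℕ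
  | omega U => U.length + 1
  | concat U e => U.length + e.length
  | union e e' => e.length + e'.length + 1

/-! ### The target discounted-sum problems -/

/-- An instance of the generalized target discounted-sum problem with natural-number weights:
a discount factor `0 < p / q < 1`, a target `c / d` and weights `a₁ < ⋯ < a_k`. -/
structure GTDS where
  p : ℕ
  q : ℕ
  c : ℤ
  d : ℕ
  weights : List ℕ
  p_pos : 0 < p
  p_lt_q : p < q
  d_pos : 0 < d
  weights_sorted : weights.SortedLT

namespace GTDS

/-- The discount factor `lam = p / q`. -/
def lam (P : GTDS) : ℚ := P.p / P.q

/-- The target value `c / d`. -/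
def target (P : GTDS) : ℚ := P.c / P.d

/-- The largest weight `a_k`, the last one in the increasing list of weights (and `0` if there are
no weights, in which case there are no solutions). -/
def maxWeight (P : GTDS) : ℕ := P.weights.getLastD 0

/-- `w ∈ {a₁, …, a_k}^ω` is a solution if `∑ i, w(i) * lam ^ i` is equal to the target. -/
def IsSolution (P : GTDS) (w : Stream' ℕ) : Prop :=
  (∀ i, w.get i ∈ P.weights) ∧
    HasSum (fun i : ℕ => (w.get i : ℝ) * (P.lam : ℝ) ^ i) (P.target : ℝ)

def HasEventuallyPeriodicSolution (P : GTDS) : Prop :=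
  ∃ w : Stream' ℕ, IsEventuallyPeriodic w ∧ P.IsSolution w

end GTDS

/-- An instance of the constrained generalized target discounted-sum problem: the letters of the
ω-regular constraint are the weights themselves. (Letters that are not among the weights are
harmless, as solutions only use weights.) -/
structure CGTDS extends GTDS where
  constraint : OmegaRegularExpression ℕ

namespace CGTDS

/-- Solutions also have to belong to the language of the constraint. -/
def IsSolution (P : CGTDS) (w : Stream' ℕ) : Prop :=
  P.toGTDS.IsSolution w ∧ w ∈ P.constraint.language

def HasEventuallyPeriodicSolution (P : CGTDS) : Prop :=
  ∃ w : Stream' ℕ, IsEventuallyPeriodic w ∧ P.IsSolution w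

end CGTDS

/-! ### Instances as strings

Numbers are written in binary, expressions in prefix notation. -/

/-- The finite alphabet in which instances are written. -/
inductive InstanceSymbol where
  | bit (b : Bool)
  | sep
  | neg
  | zero
  | epsilon
  | char
  | plus
  | comp
  | star
  | omega
  | concat
  | union
  deriving DecidableEq, Fintype

/-- A natural number: its binary digits, least significant first, and a separator. -/
def encodeNatural (n : ℕ) : List InstanceSymbol :=
  n.bits.map InstanceSymbol.bit ++ [InstanceSymbol.sep]

/-- An integer: a sign, if it is negative, and its absolute value. -/
def encodeInteger (c : ℤ) : List InstanceSymbol :=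
  (if c < 0 then [InstanceSymbol.neg] else []) ++ encodeNatural c.natAbs

def RegularExpression.encode : RegularExpression ℕ → List InstanceSymbol
  | zero => [InstanceSymbol.zero]
  | epsilon => [InstanceSymbol.epsilon]
  | char a => InstanceSymbol.char :: encodeNatural a
  | plus P Q => InstanceSymbol.plus :: (P.encode ++ Q.encode)
  | comp P Q => InstanceSymbol.comp :: (P.encode ++ Q.encode)
  | star P => InstanceSymbol.star :: P.encode

def OmegaRegularExpression.encode : OmegaRegularExpression ℕ → List InstanceSymbol
  | omega U => InstanceSymbol.omega :: U.encode
  | concat U e => InstanceSymbol.concat :: (U.encode ++ e.encode)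
  | union e e' => InstanceSymbol.union :: (e.encode ++ e'.encode)

def GTDS.encode (P : GTDS) : List InstanceSymbol :=
  encodeNatural P.p ++ encodeNatural P.q ++ encodeInteger P.c ++ encodeNatural P.d ++
    P.weights.flatMap encodeNatural

def CGTDS.encode (P : CGTDS) : List InstanceSymbol :=
  P.toGTDS.encode ++ P.constraint.encode

/-! ### Polynomial space -/

/-- The space that a configuration of a (deterministic, multi-stack) Turing machine occupies: the
total number of symbols on its stacks. -/
def Turing.FinTM2.space (M : Turing.FinTM2) (c : M.Cfg) : ℕ :=
  letI := M.kFin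
  ∑ k : M.K, (c.stk k).length

/-- The problem `Q`, whose instances `x : α` are given as strings `encode x` over the finite
alphabet `Γ`, is decidable in PSPACE: there are a deterministic Turing machine `M` and a
polynomial `s` such that, on every input `encode x` of length `n`, all configurations of the
computation of `M` occupy space at most `s(n)`, and `M` halts, accepting (with the symbol `yes`
on top of its output stack) if and only if `Q x` holds. -/
def DecidableInPSPACE {α Γ : Type} [Finite Γ] (encode : α → List Γ) (Q : α → Prop) : Prop :=
  ∃ (M : Turing.FinTM2) (inp : Γ ↪ M.Γ M.k₀) (yes : M.Γ M.k₁) (s : Polynomial ℕ),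
    (∀ k, Finite (M.Γ k)) ∧
    ∀ x : α,
      (∀ c, StateTransition.Reaches M.step (Turing.initList M ((encode x).map inp)) c →
        M.space c ≤ s.eval (encode x).length) ∧
      ∃ c, StateTransition.Reaches M.step (Turing.initList M ((encode x).map inp)) c ∧
        c.l = none ∧ ((c.stk M.k₁).head? = some yes ↔ Q x)

/-!
# Eventually periodic solutions of target discounted-sum problems

**Remaining targets.** Let `w` be an eventually periodic solution, and let `t i` be the discounted
sum of the rest of `w` from the position `i` on, so that `t i = w i + lam * t (i + 1)`. Write
`lam = p / q` in lowest terms. Since `t` is eventually periodic, some number that is coprime to `p`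
turns all `t i` into integers. On the other hand, `d * t 0 = c` is an integer, and if `d * t i` is
an integer, then so is `p * d * t (i + 1)`, which is even a multiple of `q`. Hence every
`d * t (i + 1)` is an integer multiple of `q` (`GTDS.exists_integer_run`). These numbers are
nonnegative and bounded by a geometric series, so there are at most
`d * a_k / (q - p) + 1 ≤ 2 * max 1 (d * lam * a_k / (1 - lam))` of them (`GTDS.exists_targets`).
Conversely, an infinite walk through a finite set of remaining targets is a solution, because the
rest, multiplied by `lam ^ n`, tends to zero (`GTDS.isSolution_of_run`). The eventually periodic
solutions thus correspond to lassos in a finite graph.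

**Short lassos.** A regular expression `U` has at most `|U|` partial derivatives
(`RegularExpression.exists_residuals`). In the product of the graph with the partial derivatives one
cuts loops out of the finite walks that read the concatenated regular expressions
(`Walk.exists_short`), and shortens the lasso that reads the final `U^ω`, where the loop has to keep
an edge that begins a new factor in `U` (`Walk.exists_short_lasso`). The sizes add up to at most the
number of vertices times the length of the ω-regular expression
(`OmegaRegularExpression.Accepts.exists_short`). Without a constraint the same argument applies to
the graph whose labels have all been identified, with the expression `a^ω` of length `2`.

**Polynomial space.** The graph has exponentially many vertices, but each one is a number with
polynomially many digits. Whether there is a lasso of the form that the constraint prescribes is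
decided by a game with polynomially many moves. One player defends claims such as "from `x` to `y`
there is a walk that reads a word of the regular expression at the position `i`" by naming
intermediate vertices, and the opponent chooses which part of the claim to doubt. Iterations are
split in halves as in Savitch's theorem, so that exponentially long chains are settled in
polynomially many moves (`DiscountedSum.Derives`, `DiscountedSum.derives_of_accepts`,
`DiscountedSum.accepts_of_derives`).

Such games are evaluated in polynomial space by depth-first search (`PolySpace.gameLost`). The
functions computable in polynomial space, `PolySpace`, are those computed by programs of counter
machines whose numbers have polynomially many digits; they are closed under composition, under
iteration, and under the operations needed to read an instance. A counter machine is simulated by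
a stack machine that keeps each number as a stack of digits in bijective numeration
(`CounterProgram.Runs.boundedReach`, `decidableInPSPACE_of_runs`).
-/

open Turing

/-! ### Counter machines -/

/-- Structured programs of a counter machine, whose registers are numbered by `ℕ` and hold natural
numbers: `dec r` is truncated at `0`, and `loop r P` repeats `P` while register `r` is nonzero. -/
inductive CounterProgram
  | skip
  | inc (r : ℕ)
  | dec (r : ℕ)
  | seq (P Q : CounterProgram)
  | loop (r : ℕ) (P : CounterProgram)

namespace CounterProgram

/-- `Runs L P s s'`: started in the store `s`, the program `P` terminates in the store `s'`, and all
numbers that it writes have at most `L` binary digits. -/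
inductive Runs (L : ℕ) : CounterProgram → (ℕ → ℕ) → (ℕ → ℕ) → Prop
  | skip (s) : Runs L skip s s
  | inc (r s) : (s r + 1).size ≤ L → Runs L (inc r) s (Function.update s r (s r + 1))
  | dec (r s) : Runs L (dec r) s (Function.update s r (s r - 1))
  | seq {P Q s s' s''} : Runs L P s s' → Runs L Q s' s'' → Runs L (seq P Q) s s''
  | loop_done {r P s} : s r = 0 → Runs L (loop r P) s s
  | loop_step {r P s s' s''} : s r ≠ 0 → Runs L P s s' → Runs L (loop r P) s' s'' →
      Runs L (loop r P) s s''

theorem Runs.mono {L L' : ℕ} (h : L ≤ L') {P s s'} (hr : Runs L P s s') : Runs L' P s s' := by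
  induction hr with
  | skip s => exact .skip s
  | inc r s hs => exact .inc r s (hs.trans h)
  | dec r s => exact .dec r s
  | seq _ _ h1 h2 => exact .seq h1 h2
  | loop_done h => exact .loop_done h
  | loop_step h _ _ h1 h2 => exact .loop_step h h1 h2

theorem Runs.size_le {L : ℕ} {P s s'} (hr : Runs L P s s') (hs : ∀ r, (s r).size ≤ L) :
    ∀ r, (s' r).size ≤ L := by
  induction hr with
  | skip s => exact hs
  | inc r s h =>
    intro i
    by_cases hi : i = r
    · subst hi; simpa using h
    · simpa [hi] using hs i
  | dec r s =>
    intro i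
    by_cases hi : i = r
    · subst hi; simpa using (Nat.size_le_size (Nat.sub_le _ 1)).trans (hs i)
    · simpa [hi] using hs i
  | seq _ _ h1 h2 => exact h2 (h1 hs)
  | loop_done h => exact hs
  | loop_step h _ _ h1 h2 => exact h2 (h1 hs)

/-- A strict upper bound for the registers that occur in a program. -/
def registerBound : CounterProgram → ℕ
  | skip => 1
  | inc r => r + 1
  | dec r => r + 1
  | seq P Q => max P.registerBound Q.registerBound
  | loop r P => max (r + 1) P.registerBound

theorem registerBound_pos (P : CounterProgram) : 0 < P.registerBound := by
  induction P with
  | skip | inc | dec => simp [registerBound]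
  | seq P Q hP hQ => exact lt_max_of_lt_left hP
  | loop r P hP => exact lt_max_of_lt_left r.succ_pos

/-- The continuations through which the execution of `P` with remaining program `k` passes before
it arrives at `k`. -/
def continuations : CounterProgram → List CounterProgram → Set (List CounterProgram)
  | skip, k => {skip :: k}
  | inc r, k => {inc r :: k}
  | dec r, k => {dec r :: k}
  | seq P Q, k => insert (seq P Q :: k) (continuations P (Q :: k) ∪ continuations Q k)
  | loop r P, k => insert (loop r P :: k) (continuations P (loop r P :: k))

theorem cons_mem_continuations (P : CounterProgram) (k) : P :: k ∈ continuations P k := by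
  cases P <;> simp [continuations]

theorem finite_continuations (P : CounterProgram) (k) : (continuations P k).Finite := by
  induction P generalizing k with
  | skip | inc | dec => exact Set.finite_singleton _
  | seq P Q hP hQ => exact ((hP _).union (hQ _)).insert _
  | loop r P hP => exact (hP _).insert _

/-! ### Bijective numeration -/

/-- The value of a word over the digits `0, …, 12` in bijective numeration to base `13`, least
significant digit first; the digit `d` counts as `d + 1`, so that every number has exactly one
representation. -/
def ofDigits : List (Fin 13) → ℕ
  | [] => 0
  | d :: l => d + 1 + 13 * ofDigits l

theorem length_le_size_ofDigits (l : List (Fin 13)) : l.length ≤ (ofDigits l).size := by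
  induction l with
  | nil => simp
  | cons d l ih =>
    have h : Nat.bit true (ofDigits l) ≤ ofDigits (d :: l) := by
      rw [Nat.bit_val]; simp only [ofDigits, Bool.toNat_true]; omega
    refine le_trans ?_ (Nat.size_le_size h)
    rw [Nat.size_bit (by simp [Nat.bit_val])]
    simpa using ih

theorem ofDigits_lt (l : List (Fin 13)) : ofDigits l < 2 ^ (4 * l.length) := by
  induction l with
  | nil => simp [ofDigits]
  | cons d l ih =>
    have : 2 ^ (4 * (d :: l).length) = 16 * 2 ^ (4 * l.length) := by
      rw [List.length_cons, mul_add, pow_add]; ring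
    rw [this, ofDigits]
    omega

/-- Adding one in bijective numeration. -/
def incDigits : List (Fin 13) → List (Fin 13)
  | [] => [0]
  | d :: l => if d = 12 then 0 :: incDigits l else (d + 1) :: l

/-- Truncated subtraction of one in bijective numeration. -/
def decDigits : List (Fin 13) → List (Fin 13)
  | [] => []
  | d :: l => if d = 0 then (if l = [] then [] else 12 :: decDigits l) else (d - 1) :: l

theorem ofDigits_incDigits (l : List (Fin 13)) : ofDigits (incDigits l) = ofDigits l + 1 := by
  induction l with
  | nil => rfl
  | cons d l ih =>
    by_cases h : d = 12
    · subst h; simp only [incDigits, if_true, ofDigits, ih]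
      simp; ring
    · have : ((d + 1 : Fin 13) : ℕ) = d + 1 := by revert h; revert d; decide
      simp only [incDigits, if_neg h, ofDigits, this]; ring

theorem ofDigits_decDigits (l : List (Fin 13)) : ofDigits (decDigits l) = ofDigits l - 1 := by
  induction l with
  | nil => rfl
  | cons d l ih =>
    by_cases h : d = 0
    · subst h
      by_cases hl : l = []
      · subst hl; rfl
      · obtain ⟨e, l', rfl⟩ := List.exists_cons_of_ne_nil hl
        have h12 : ((12 : Fin 13) : ℕ) = 12 := rfl
        have h0 : ((0 : Fin 13) : ℕ) = 0 := rfl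
        have hpos : 0 < ofDigits (e :: l') := by simp [ofDigits]
        rw [decDigits, if_pos rfl, if_neg hl, ofDigits, ih, ofDigits.eq_2 0, h12, h0]
        omega
    · have : ((d - 1 : Fin 13) : ℕ) + 1 = d := by revert h; revert d; decide
      simp only [decDigits, if_neg h, ofDigits]; omega

/-! ### Counter programs on stack machines -/

open Turing.TM2.Stmt

/-- The register `r` as the index of one of `W` stacks. -/
def reg (W : ℕ) [NeZero W] (r : ℕ) : Fin W := Fin.ofNat W r

variable (W : ℕ) [NeZero W] (S : Set (List CounterProgram)) (start : S)

open Classical in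
/-- The label of a continuation. The Boolean is the phase within an instruction: `true` while the
digits that were set aside on the auxiliary stack are being restored. -/
noncomputable def label (c : List CounterProgram) (b : Bool) : S × Bool :=
  (if h : c ∈ S then ⟨c, h⟩ else start, b)

/-- Restores the digits on the auxiliary stack to register `r`; then continues with `k`. -/
noncomputable def restore (r : ℕ) (c k : List CounterProgram) :
    TM2.Stmt (fun _ : Option (Fin W) => Fin 13) (S × Bool) (Option (Fin 13)) :=
  pop none (fun _ o => o) <| branch (fun v => v.isSome)
    (push (some (reg W r)) (fun v => v.getD 0) <| load (fun _ => none) <|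
      goto fun _ => label S start c true)
    (load (fun _ => none) <| goto fun _ => label S start k false)

/-- The code at the label `(c, b)`. -/
noncomputable def code : List CounterProgram → Bool →
    TM2.Stmt (fun _ : Option (Fin W) => Fin 13) (S × Bool) (Option (Fin 13))
  | [], _ => halt
  | skip :: k, _ => goto fun _ => label S start k false
  | seq P Q :: k, _ => goto fun _ => label S start (P :: Q :: k) false
  | loop r P :: k, _ => peek (some (reg W r)) (fun _ o => o) <| branch (fun v => v.isSome)
      (load (fun _ => none) <| goto fun _ => label S start (P :: loop r P :: k) false)
      (load (fun _ => none) <| goto fun _ => label S start k false)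
  | inc r :: k, true => restore W S start r (inc r :: k) k
  | dec r :: k, true => restore W S start r (dec r :: k) k
  | inc r :: k, false => pop (some (reg W r)) (fun _ o => o) <|
      branch (fun v => decide (v = some 12))
        (push none (fun _ => 0) <| load (fun _ => none) <|
          goto fun _ => label S start (inc r :: k) false)
        (push (some (reg W r)) (fun v => v.elim 0 (· + 1)) <| load (fun _ => none) <|
          goto fun _ => label S start (inc r :: k) true)
  | dec r :: k, false => pop (some (reg W r)) (fun _ o => o) <|
      branch (fun v => decide (v = some 0))
        (peek (some (reg W r)) (fun _ o => o) <| branch (fun v => v.isSome)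
          (push none (fun _ => 12) <| load (fun _ => none) <|
            goto fun _ => label S start (dec r :: k) false)
          (load (fun _ => none) <| goto fun _ => label S start (dec r :: k) true))
        (branch (fun v => v.isSome)
          (push (some (reg W r)) (fun v => v.getD 0 - 1) <| load (fun _ => none) <|
            goto fun _ => label S start (dec r :: k) true)
          (load (fun _ => none) <| goto fun _ => label S start (dec r :: k) true))

/-- The stack machine that executes counter programs. Every register is a stack of digits, and the
stack `none` is auxiliary. -/
noncomputable def machine [Fintype S] : FinTM2 where
  K := Option (Fin W)
  k₀ := some (reg W 0)
  k₁ := some (reg W 0)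
  Γ _ := Fin 13
  Λ := S × Bool
  main := (start, false)
  σ := Option (Fin 13)
  initialState := none
  m l := code W S start l.1 l.2

/-- A configuration of `machine`. -/
abbrev Config := TM2.Cfg (fun _ : Option (Fin W) => Fin 13) (S × Bool) (Option (Fin 13))

/-- Reachability by steps into configurations whose stacks have height at most `L + 1`. -/
def BoundedReach (L : ℕ) : Config W S → Config W S → Prop :=
  Relation.ReflTransGen fun a b =>
    b ∈ TM2.step (fun l : S × Bool => code W S start l.1 l.2) a ∧ ∀ k, (b.stk k).length ≤ L + 1

/-- The configuration at the continuation `c` with the stacks `T`. -/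
noncomputable def config (c : List CounterProgram) (b : Bool) (T : Option (Fin W) → List (Fin 13)) :
    Config W S :=
  ⟨some (label S start c b), none, T⟩

variable {W S start}

theorem label_of_mem {c : List CounterProgram} (h : c ∈ S) (b : Bool) :
    label S start c b = (⟨c, h⟩, b) := by
  simp [label, h]

theorem update_none_update {n : ℕ} (T : Option (Fin n) → List (Fin 13)) (x : Fin n)
    (l l' : List (Fin 13)) :
    Function.update (Function.update (Function.update T (some x) l) none []) (some x) l' =
      Function.update (Function.update T none []) (some x) l' := by
  ext1 j
  rcases j with _ | j
  · simp
  · by_cases hj : j = x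
    · subst hj; simp
    · simp [hj]

theorem BoundedReach.head {L : ℕ} {c b T b'} (hc : c ∈ S)
    (hb : ∀ k, ((TM2.stepAux (code W S start c b) none T).stk k).length ≤ L + 1)
    (h : BoundedReach W S start L (TM2.stepAux (code W S start c b) none T) b') :
    BoundedReach W S start L (config W S start c b T) b' := by
  refine Relation.ReflTransGen.head ⟨?_, hb⟩ h
  simp [config, label_of_mem hc, TM2.step]

/-- The digits `a` on the auxiliary stack, the last one to have been set aside on top, return to the
register. -/
theorem BoundedReach.restore {L r c k} (hc : c ∈ S)
    (hcode : code W S start c true = restore W S start r c k)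
    {T : Option (Fin W) → List (Fin 13)} {a l} (ha : T none = a)
    (hl : T (some (reg W r)) = l)
    (hlen : a.length + l.length ≤ L + 1) (hT : ∀ k, (T k).length ≤ L + 1) :
    BoundedReach W S start L (config W S start c true T) (config W S start k false
      (Function.update (Function.update T none []) (some (reg W r)) (a.reverseAux l))) := by
  induction a generalizing T l with
  | nil =>
    have hT' : Function.update (Function.update T none []) (some (reg W r)) l = T := by
      rw [← ha, Function.update_eq_self, ← hl, Function.update_eq_self]
    have e : TM2.stepAux (code W S start c true) none T = config W S start k false T := by
      rw [hcode]
      have hT'' : Function.update T none [] = T := by rw [← ha, Function.update_eq_self]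
      simp [CounterProgram.restore, ha, config, hT'']
    refine .head hc ?_ ?_
    · rw [e]; exact hT
    · rw [e, List.reverseAux, hT']; exact .refl
  | cons d a ih =>
    have e : TM2.stepAux (code W S start c true) none T = config W S start c true
        (Function.update (Function.update T none a) (some (reg W r)) (d :: l)) := by
      rw [hcode]
      simp [CounterProgram.restore, ha, hl, config]
    have hb : ∀ k, (Function.update (Function.update T none a)
        (some (reg W r)) (d :: l) k).length ≤ L + 1 := by
      intro k
      simp only [List.length_cons] at hlen
      rcases k with _ | k
      · simp; omega
      · by_cases hk : k = reg W r
        · subst hk; simp; omega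
        · simpa [Function.update_of_ne, hk] using hT (some k)
    refine .head hc ?_ ?_
    · rw [e]; exact hb
    · rw [e]
      have := ih (T := Function.update (Function.update T none a) (some (reg W r)) (d :: l))
        (l := d :: l) (by simp) (by simp) (by simp at hlen ⊢; omega) hb
      rw [List.reverseAux]
      convert this using 2
      ext1 j
      rcases j with _ | j
      · simp
      · by_cases hj : j = reg W r
        · subst hj; simp
        · simp [hj]

/-- Adding one to a register; `a` holds the digits that the carry has passed. -/
theorem BoundedReach.inc {L r k} (hc : CounterProgram.inc r :: k ∈ S)
    {T : Option (Fin W) → List (Fin 13)} {a l} (ha : T none = a)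
    (hl : T (some (reg W r)) = l)
    (hlen : a.length + l.length ≤ L) (hT : ∀ k, (T k).length ≤ L + 1) :
    BoundedReach W S start L (config W S start (CounterProgram.inc r :: k) false T)
      (config W S start k false (Function.update (Function.update T none [])
        (some (reg W r)) (a.reverseAux (incDigits l)))) := by
  induction l generalizing T a with
  | nil =>
    have e : TM2.stepAux (code W S start (CounterProgram.inc r :: k) false) none T =
        config W S start (CounterProgram.inc r :: k) true
          (Function.update T (some (reg W r)) [0]) := by
      simp [code, hl, config]
    have hb : ∀ k, (Function.update T (some (reg W r)) [0] k).length ≤ L + 1 := by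
      intro k
      by_cases hk : k = some (reg W r)
      · subst hk; simp
      · simpa [hk] using hT k
    refine .head hc ?_ ?_
    · rw [e]; exact hb
    · rw [e]
      have := BoundedReach.restore (start := start) hc rfl (L := L) (a := a) (l := [0])
        (T := Function.update T (some (reg W r)) [0]) (by simpa using ha) (by simp)
        (by simp at hlen ⊢; omega) hb
      convert this using 2
      rw [update_none_update]
      rfl
  | cons d l ih =>
    by_cases hd : d = 12
    · subst hd
      have e : TM2.stepAux (code W S start (CounterProgram.inc r :: k) false) none T =
          config W S start (CounterProgram.inc r :: k) false
            (Function.update (Function.update T (some (reg W r)) l) none (0 :: a)) := by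
        simp [code, hl, config, ha]
      have hb : ∀ k, (Function.update (Function.update T (some (reg W r)) l)
          none (0 :: a) k).length ≤ L + 1 := by
        intro k
        simp only [List.length_cons] at hlen
        rcases k with _ | k
        · simp; omega
        · by_cases hk : k = reg W r
          · subst hk; simp; omega
          · simpa [hk] using hT (some k)
      refine .head hc ?_ ?_
      · rw [e]; exact hb
      · rw [e]
        have := ih (T := Function.update (Function.update T (some (reg W r)) l) none (0 :: a))
          (a := 0 :: a) (by simp) (by simp) (by simp at hlen ⊢; omega) hb
        rw [incDigits, if_pos rfl]
        convert this using 2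
        ext1 j
        rcases j with _ | j
        · simp
        · by_cases hj : j = reg W r
          · subst hj; simp
          · simp [hj]
    · have e : TM2.stepAux (code W S start (CounterProgram.inc r :: k) false) none T =
          config W S start (CounterProgram.inc r :: k) true
            (Function.update T (some (reg W r)) ((d + 1) :: l)) := by
        simp [code, hl, config, hd]
      have hb : ∀ k, (Function.update T (some (reg W r)) ((d + 1) :: l) k).length ≤ L + 1 := by
        intro k
        by_cases hk : k = some (reg W r)
        · subst hk; simp at hlen ⊢; omega
        · simpa [hk] using hT k
      refine .head hc ?_ ?_
      · rw [e]; exact hb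
      · rw [e]
        have := BoundedReach.restore (start := start) hc rfl (L := L) (a := a) (l := (d + 1) :: l)
          (T := Function.update T (some (reg W r)) ((d + 1) :: l)) (by simpa using ha)
          (by simp) (by simp at hlen ⊢; omega) hb
        rw [incDigits, if_neg hd]
        convert this using 2
        rw [update_none_update]

/-- Subtracting one from a register; `a` holds the digits that the borrow has passed. -/
theorem BoundedReach.dec {L r k} (hc : CounterProgram.dec r :: k ∈ S)
    {T : Option (Fin W) → List (Fin 13)} {a l} (ha : T none = a)
    (hl : T (some (reg W r)) = l)
    (hlen : a.length + l.length ≤ L) (hT : ∀ k, (T k).length ≤ L + 1) :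
    BoundedReach W S start L (config W S start (CounterProgram.dec r :: k) false T)
      (config W S start k false (Function.update (Function.update T none [])
        (some (reg W r)) (a.reverseAux (decDigits l)))) := by
  -- the last step of the subtraction, which leaves the stack `l'`
  have final : ∀ {T : Option (Fin W) → List (Fin 13)} {a l l' : List (Fin 13)},
      T none = a → T (some (reg W r)) = l → a.length + l.length ≤ L →
      (∀ k, (T k).length ≤ L + 1) → l'.length ≤ l.length →
      TM2.stepAux (code W S start (CounterProgram.dec r :: k) false) none T =
        config W S start (CounterProgram.dec r :: k) true
          (Function.update T (some (reg W r)) l') →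
      BoundedReach W S start L (config W S start (CounterProgram.dec r :: k) false T)
        (config W S start k false (Function.update (Function.update T none [])
          (some (reg W r)) (a.reverseAux l'))) := by
    intro T a l l' ha hl hlen hT hl' e
    have hb : ∀ k, (Function.update T (some (reg W r)) l' k).length ≤ L + 1 := by
      intro k
      by_cases hk : k = some (reg W r)
      · subst hk; simp; omega
      · simpa [hk] using hT k
    refine .head hc ?_ ?_
    · rw [e]; exact hb
    · rw [e]
      have := BoundedReach.restore (start := start) hc rfl (L := L) (a := a) (l := l')
        (T := Function.update T (some (reg W r)) l') (by simpa using ha)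
        (by simp) (by omega) hb
      convert this using 2
      rw [update_none_update]
  induction l generalizing T a with
  | nil =>
    refine final ha hl hlen hT le_rfl ?_
    simp [code, hl, config, decDigits]
  | cons d l ih =>
    by_cases hd : d = 0
    · subst hd
      by_cases hnil : l = []
      · subst hnil
        refine final ha hl hlen hT (by simp [decDigits]) ?_
        simp [code, hl, config, decDigits]
      · obtain ⟨e0, l0, hl0⟩ := List.exists_cons_of_ne_nil hnil
        have e : TM2.stepAux (code W S start (CounterProgram.dec r :: k) false) none T =
            config W S start (CounterProgram.dec r :: k) false
              (Function.update (Function.update T (some (reg W r)) l) none (12 :: a)) := by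
          simp [code, hl, config, ha, hl0]
        have hb : ∀ k, (Function.update (Function.update T (some (reg W r)) l)
            none (12 :: a) k).length ≤ L + 1 := by
          intro k
          simp only [List.length_cons] at hlen
          rcases k with _ | k
          · simp; omega
          · by_cases hk : k = reg W r
            · subst hk; simp; omega
            · simpa [hk] using hT (some k)
        refine .head hc ?_ ?_
        · rw [e]; exact hb
        · rw [e]
          have := ih
            (T := Function.update (Function.update T (some (reg W r)) l) none (12 :: a))
            (a := 12 :: a) (by simp) (by simp) (by simp at hlen ⊢; omega) hb
          rw [decDigits, if_pos rfl, if_neg hnil]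
          convert this using 2
          ext1 j
          rcases j with _ | j
          · simp
          · by_cases hj : j = reg W r
            · subst hj; simp
            · simp [hj]
    · rw [decDigits, if_neg hd]
      refine final ha hl hlen hT (by simp) ?_
      simp [code, hl, config, hd]

/-- The stacks `T` represent the store `s`. -/
def Represents (W : ℕ) [NeZero W] (T : Option (Fin W) → List (Fin 13)) (s : ℕ → ℕ) : Prop :=
  T none = [] ∧ ∀ r < W, ofDigits (T (some (reg W r))) = s r

theorem Represents.update {T : Option (Fin W) → List (Fin 13)} {s r n l}
    (h : Represents W T s) (hr : r < W) (hl : ofDigits l = n) :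
    Represents W (Function.update (Function.update T none []) (some (reg W r)) l)
      (Function.update s r n) := by
  refine ⟨by simp, fun i hi => ?_⟩
  by_cases hir : i = r
  · subst hir; simpa using hl
  · have : reg W i ≠ reg W r := by
      intro h'
      have := congrArg Fin.val h'
      simp [reg, Nat.mod_eq_of_lt hi, Nat.mod_eq_of_lt hr] at this
      exact hir this
    simpa [hir, this] using h.2 i hi

theorem Represents.length_le {L : ℕ} {T : Option (Fin W) → List (Fin 13)} {s}
    (h : Represents W T s) (hs : ∀ r, (s r).size ≤ L) (k) : (T k).length ≤ L := by
  rcases k with _ | k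
  · simp [h.1]
  · have := h.2 k k.2
    have hk : reg W (k : ℕ) = k := by ext; simp [reg]
    rw [hk] at this
    exact (length_le_size_ofDigits _).trans (this ▸ hs k)

/-- The stack machine simulates the counter program. -/
theorem Runs.boundedReach {L P s s'} (hr : Runs L P s s') {k} (hk : k ∈ S)
    (hS : continuations P k ⊆ S) (hW : P.registerBound ≤ W) (hs : ∀ r, (s r).size ≤ L)
    {T : Option (Fin W) → List (Fin 13)} (hT : Represents W T s) :
    ∃ T', Represents W T' s' ∧
      BoundedReach W S start L (config W S start (P :: k) false T)
        (config W S start k false T') := by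
  have hP := hS (cons_mem_continuations P k)
  induction hr generalizing k T with
  | skip s =>
    refine ⟨T, hT, .head hP ?_ ?_⟩
    · exact fun j => (hT.length_le hs j).trans (Nat.le_succ L)
    · exact .refl
  | inc r s h =>
    have hrW : r < W := hW
    have := BoundedReach.inc (start := start) hP (L := L) hT.1 rfl
      (by simpa using hT.length_le hs _) fun j => (hT.length_le hs j).trans (Nat.le_succ L)
    exact ⟨_, hT.update hrW (by rw [List.reverseAux, ofDigits_incDigits, hT.2 r hrW]), this⟩
  | dec r s =>
    have hrW : r < W := hW
    have := BoundedReach.dec (start := start) hP (L := L) hT.1 rfl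
      (by simpa using hT.length_le hs _) fun j => (hT.length_le hs j).trans (Nat.le_succ L)
    exact ⟨_, hT.update hrW (by rw [List.reverseAux, ofDigits_decDigits, hT.2 r hrW]), this⟩
  | @seq P Q s s' s'' h1 h2 ih1 ih2 =>
    simp only [continuations, Set.insert_subset_iff, Set.union_subset_iff] at hS
    simp only [registerBound, max_le_iff] at hW
    have hQ := hS.2.2 (cons_mem_continuations Q k)
    obtain ⟨T1, hT1, r1⟩ := ih1 hQ hS.2.1 hW.1 hs hT (hS.2.1 (cons_mem_continuations P _))
    obtain ⟨T2, hT2, r2⟩ := ih2 hk hS.2.2 hW.2 (h1.size_le hs) hT1 hQ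
    refine ⟨T2, hT2, .head hP ?_ (r1.trans r2)⟩
    exact fun j => (hT.length_le hs j).trans (Nat.le_succ L)
  | @loop_done r P s h =>
    simp only [registerBound, max_le_iff] at hW
    have h0 : T (some (reg W r)) = [] := by
      have := hT.2 r hW.1
      rw [h] at this
      cases hc : T (some (reg W r)) with
      | nil => rfl
      | cons d l => rw [hc, ofDigits] at this; omega
    have e : TM2.stepAux (code W S start (CounterProgram.loop r P :: k) false) none T =
        config W S start k false T := by
      simp [code, h0, config]
    refine ⟨T, hT, .head hP ?_ ?_⟩
    · rw [e]; exact fun j => (hT.length_le hs j).trans (Nat.le_succ L)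
    · rw [e]; exact .refl
  | @loop_step r P s s' s'' h h1 h2 ih1 ih2 =>
    have hS' := hS
    have hW' := hW
    simp only [continuations, Set.insert_subset_iff] at hS'
    simp only [registerBound, max_le_iff] at hW'
    have h0 : (T (some (reg W r))).head?.isSome := by
      have := hT.2 r hW'.1
      cases hc : T (some (reg W r)) with
      | nil => rw [hc, ofDigits] at this; omega
      | cons d l => rfl
    have e : TM2.stepAux (code W S start (CounterProgram.loop r P :: k) false) none T =
        config W S start (P :: CounterProgram.loop r P :: k) false T := by
      simp only [code, TM2.stepAux, h0, cond_true]; rfl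
    obtain ⟨T1, hT1, r1⟩ := ih1 hP hS'.2 hW'.2 hs hT (hS'.2 (cons_mem_continuations P _))
    obtain ⟨T2, hT2, r2⟩ := ih2 hk hS hW (h1.size_le hs) hT1 hP
    refine ⟨T2, hT2, .head hP ?_ ?_⟩
    · rw [e]; exact fun j => (hT.length_le hs j).trans (Nat.le_succ L)
    · rw [e]; exact r1.trans r2

/-- A deterministic computation that halts after steps into configurations with stacks of bounded
height reaches only such configurations. -/
theorem BoundedReach.length_le {L : ℕ} {a b c : Config W S} (h : BoundedReach W S start L a b)
    (hb : TM2.step (fun l : S × Bool => code W S start l.1 l.2) b = none)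
    (ha : ∀ k, (a.stk k).length ≤ L + 1)
    (hc : StateTransition.Reaches (TM2.step fun l : S × Bool => code W S start l.1 l.2) a c) :
    ∀ k, (c.stk k).length ≤ L + 1 := by
  induction h using Relation.ReflTransGen.head_induction_on with
  | refl =>
    rcases Relation.ReflTransGen.cases_head hc with rfl | ⟨d, hd, _⟩
    · exact ha
    · simp [hb] at hd
  | head h1 _ ih =>
    rcases Relation.ReflTransGen.cases_head hc with rfl | ⟨d, hd, hdc⟩
    · exact ha
    · cases Option.mem_unique h1.1 hd
      exact ih h1.2 hdc

end CounterProgram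

/-! ### Problems decided by counter programs -/

namespace InstanceSymbol

/-- The symbols of the instances as digits. -/
def digit : InstanceSymbol → Fin 13
  | bit false => 0
  | bit true => 1
  | sep => 2
  | neg => 3
  | zero => 4
  | epsilon => 5
  | char => 6
  | plus => 7
  | comp => 8
  | star => 9
  | omega => 10
  | concat => 11
  | union => 12

theorem digit_injective : Function.Injective digit := by
  intro a b; revert a b; decide

end InstanceSymbol

/-- A word over the alphabet of the instances as a number. -/
def wordNumber (l : List InstanceSymbol) : ℕ :=
  CounterProgram.ofDigits (l.map InstanceSymbol.digit)

theorem size_wordNumber_le (l : List InstanceSymbol) : (wordNumber l).size ≤ 4 * l.length := by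
  have := CounterProgram.ofDigits_lt (l.map InstanceSymbol.digit)
  rw [List.length_map] at this
  exact Nat.size_le.2 this

open CounterProgram in
/-- A problem is in PSPACE if a counter program decides it whose numbers have polynomially many
binary digits; the input string, read in bijective numeration, is the number in register `0`. -/
theorem decidableInPSPACE_of_runs {α : Type} {encode : α → List InstanceSymbol} {Q : α → Prop}
    (P : CounterProgram) (p : Polynomial ℕ)
    (h : ∀ x, ∃ s', Runs (p.eval (encode x).length) P
      (fun r => if r = 0 then wordNumber (encode x) else 0) s' ∧
        (Q x → s' 0 = 1) ∧ (¬ Q x → s' 0 = 0)) :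
    DecidableInPSPACE encode Q := by
  have : NeZero P.registerBound := ⟨P.registerBound_pos.ne'⟩
  let S : Set (List CounterProgram) := insert [] (continuations P [])
  have hfin : Finite S := ((finite_continuations P []).insert []).to_subtype
  have : Fintype S := Fintype.ofFinite S
  have hP : [P] ∈ S := Or.inr (cons_mem_continuations P [])
  let start : S := ⟨[P], hP⟩
  refine ⟨machine P.registerBound S start, ⟨InstanceSymbol.digit, InstanceSymbol.digit_injective⟩,
    (0 : Fin 13), Polynomial.C (P.registerBound + 1) * (p + 4 * Polynomial.X + 1),
    fun _ => inferInstanceAs (Finite (Fin 13)), fun x => ?_⟩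
  obtain ⟨s', hrun, hyes, hno⟩ := h x
  set L := p.eval (encode x).length + 4 * (encode x).length with hL
  let T : Option (Fin P.registerBound) → List (Fin 13) := fun k =>
    if k = some (reg P.registerBound 0) then (encode x).map InstanceSymbol.digit else []
  have hT : Represents P.registerBound T fun r => if r = 0 then wordNumber (encode x) else 0 := by
    refine ⟨by simp [T], fun r hr => ?_⟩
    by_cases h0 : r = 0
    · simp [T, h0, wordNumber]
    · have : reg P.registerBound r ≠ reg P.registerBound 0 := by
        intro h'
        have := congrArg Fin.val h'
        simp [reg, Nat.mod_eq_of_lt hr] at this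
        exact h0 this
      simp [T, h0, this, ofDigits]
  have hs : ∀ r, (if r = 0 then wordNumber (encode x) else 0).size ≤ L := by
    intro r
    split_ifs
    · exact (size_wordNumber_le _).trans (Nat.le_add_left _ _)
    · simp
  obtain ⟨T', hT', hreach⟩ := (hrun.mono (Nat.le_add_right _ _)).boundedReach (S := S)
    (start := start) (k := []) (Or.inl rfl) (Set.subset_insert _ _) le_rfl hs hT
  have hinit : (Turing.initList (machine P.registerBound S start)
      ((encode x).map InstanceSymbol.digit)) = config P.registerBound S start [P] false T := by
    simp only [Turing.initList, config, label_of_mem hP]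
    congr 1
  have hlen : ∀ k, ((config P.registerBound S start [P] false T).stk k).length ≤ L + 1 :=
    fun k => (hT.length_le hs k).trans (Nat.le_succ L)
  -- the configuration after the machine has arrived at the empty continuation
  let final : Config P.registerBound S := ⟨none, none, T'⟩
  have hhalt : final ∈ TM2.step (fun l : S × Bool => code P.registerBound S start l.1 l.2)
      (config P.registerBound S start [] false T') := by
    simp [config, label_of_mem (show [] ∈ S from Or.inl rfl), code, final]
  have hfinal : BoundedReach P.registerBound S start L
      (config P.registerBound S start [P] false T) final :=
    hreach.tail ⟨hhalt, fun k =>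
      (hT'.length_le ((hrun.mono (Nat.le_add_right _ _)).size_le hs) k).trans (Nat.le_succ L)⟩
  constructor
  · intro c hc
    erw [hinit] at hc
    have := hfinal.length_le rfl hlen hc
    calc (machine P.registerBound S start).space c
        = ∑ k : Option (Fin P.registerBound), (c.stk k).length := rfl
      _ ≤ ∑ _k : Option (Fin P.registerBound), (L + 1) := Finset.sum_le_sum fun k _ => this k
      _ = _ := by simp [hL]
  · refine ⟨final, ?_, rfl, ?_⟩
    · erw [hinit]
      exact Relation.ReflTransGen.mono (fun _ _ h => h.1) _ _ hfinal
    · have h0 := hT'.2 0 P.registerBound_pos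
      change (T' (some (reg P.registerBound 0))).head? = some 0 ↔ Q x
      by_cases hQ : Q x
      · rw [hyes hQ] at h0
        cases hc : T' (some (reg P.registerBound 0)) with
        | nil => simp [hc, ofDigits] at h0
        | cons d l =>
          have : d = 0 := by rw [hc, ofDigits] at h0; ext; simp; omega
          simp [this, hQ]
      · rw [hno hQ] at h0
        cases hc : T' (some (reg P.registerBound 0)) with
        | nil => simp [hQ]
        | cons d l => rw [hc, ofDigits] at h0; omega

/-! ### Functions computable in polynomial space -/

theorem Polynomial.eval_mono_nat (p : Polynomial ℕ) {a b : ℕ} (h : a ≤ b) :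
    p.eval a ≤ p.eval b := by
  rw [Polynomial.eval_eq_sum_range, Polynomial.eval_eq_sum_range]
  gcongr

/-- Types whose elements are stored in a fixed number of registers. -/
class RegisterData (α : Type) where
  width : ℕ
  registers : α → List ℕ
  length_registers (x : α) : (registers x).length = width

open RegisterData

instance : RegisterData ℕ := ⟨1, fun n => [n], fun _ => rfl⟩

instance : RegisterData Bool := ⟨1, fun b => [b.toNat], fun _ => rfl⟩

/-- A word over the alphabet of the instances is stored as a single number. -/
instance : RegisterData (List InstanceSymbol) := ⟨1, fun l => [wordNumber l], fun _ => rfl⟩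

instance {α β : Type} [RegisterData α] [RegisterData β] : RegisterData (α × β) where
  width := width α + width β
  registers x := registers x.1 ++ registers x.2
  length_registers x := by simp [length_registers]

/-- The total number of binary digits in the registers. -/
def registerSize {α : Type} [RegisterData α] (x : α) : ℕ := ((registers x).map Nat.size).sum

section registerSize
variable {α β : Type} [RegisterData α] [RegisterData β]

@[simp] theorem registerSize_nat (n : ℕ) : registerSize n = n.size := by
  simp [registerSize, registers]

@[simp] theorem registerSize_prod (x : α × β) :
    registerSize x = registerSize x.1 + registerSize x.2 := by
  simp [registerSize, registers]

theorem registerSize_bool (b : Bool) : registerSize b ≤ 1 := by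
  cases b <;> simp [registerSize, registers]

@[simp] theorem registerSize_word (l : List InstanceSymbol) :
    registerSize l = (wordNumber l).size := by
  simp [registerSize, registers]

theorem registerSize_le {L : ℕ} {x : α} (h : ∀ n ∈ registers x, n.size ≤ L) :
    registerSize x ≤ width α * L := by
  rw [registerSize, ← length_registers x, ← smul_eq_mul, ← List.length_map Nat.size]
  exact List.sum_le_card_nsmul _ _ (by simpa using h)

theorem size_le_registerSize {x : α} {n : ℕ} (h : n ∈ registers x) : n.size ≤ registerSize x :=
  List.single_le_sum (by simp) _ (List.mem_map_of_mem h)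

end registerSize

namespace CounterProgram

/-- The store that holds `l` in the registers from `m` on, and agrees with `s` below `m`. -/
def frame (s : ℕ → ℕ) (m : ℕ) (l : List ℕ) : ℕ → ℕ :=
  fun r => if r < m then s r else l.getD (r - m) 0

theorem frame_append (s m l l') :
    frame s m (l ++ l') = frame (frame s m l) (m + l.length) l' := by
  funext r
  unfold frame
  by_cases h1 : r < m
  · simp [h1, show r < m + l.length by omega]
  · by_cases h2 : r < m + l.length
    · rw [if_neg h1, if_pos h2, if_neg h1, List.getD_append _ _ _ _ (by omega)]
    · rw [if_neg h1, if_neg h2, List.getD_append_right _ _ _ _ (by omega)]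
      congr 1; omega

theorem frame_apply (s m l i) : frame s m l (m + i) = l.getD i 0 := by
  simp [frame]

theorem update_frame (s m l i v) (h : i < l.length) :
    Function.update (frame s m l) (m + i) v = frame s m (l.set i v) := by
  funext r
  by_cases hr : r = m + i
  · subst hr; simp [frame, h]
  · rw [Function.update_of_ne hr]
    unfold frame
    split_ifs with h1
    · rfl
    · rw [List.getD_eq_getElem?_getD, List.getD_eq_getElem?_getD, List.getElem?_set_ne (by omega)]

theorem frame_append_zero (s m l) : frame s m (l ++ [0]) = frame s m l := by
  funext r
  unfold frame
  split_ifs with h1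
  · rfl
  · simp only [List.getD_eq_getElem?_getD, List.getElem?_append]
    split_ifs with h2
    · rfl
    · rw [List.getElem?_eq_none (by omega : l.length ≤ r - m)]
      rcases h : r - m - l.length with _ | n <;> simp

theorem update_frame_length (s m l v) :
    Function.update (frame s m l) (m + l.length) v = frame s m (l ++ [v]) := by
  rw [← frame_append_zero, update_frame _ _ _ _ _ (by simp)]
  simp

/-- All registers hold numbers with at most `L` binary digits. -/
def Bounded (L : ℕ) (s : ℕ → ℕ) : Prop := ∀ r, (s r).size ≤ L

theorem Bounded.mono {L L' s} (h : L ≤ L') (hs : Bounded L s) : Bounded L' s :=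
  fun r => (hs r).trans h

theorem bounded_frame_iff {L s m l} :
    Bounded L (frame s m l) ↔ (∀ r < m, (s r).size ≤ L) ∧ ∀ n ∈ l, n.size ≤ L := by
  constructor
  · intro h
    refine ⟨fun r hr => by simpa [frame, hr] using h r, fun n hn => ?_⟩
    obtain ⟨i, hi, rfl⟩ := List.getElem_of_mem hn
    have := h (m + i)
    rwa [frame_apply, List.getD_eq_getElem _ _ hi] at this
  · intro h r
    unfold frame
    split_ifs with hr
    · exact h.1 r hr
    · by_cases hl : r - m < l.length
      · rw [List.getD_eq_getElem _ _ hl]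
        exact h.2 _ (List.getElem_mem hl)
      · rw [List.getD_eq_default _ _ (by omega)]
        simp

/-- Increments the registers `ts`. -/
def incs : List ℕ → CounterProgram
  | [] => skip
  | t :: ts => seq (inc t) (incs ts)

theorem runs_incs {L : ℕ} {ts : List ℕ} (hts : ts.Nodup) {s : ℕ → ℕ}
    (h : ∀ t ∈ ts, (s t + 1).size ≤ L) :
    Runs L (incs ts) s fun i => if i ∈ ts then s i + 1 else s i := by
  induction ts generalizing s with
  | nil => simpa [incs] using Runs.skip s
  | cons t ts ih =>
    obtain ⟨ht, hts⟩ := List.nodup_cons.1 hts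
    have := ih hts (s := Function.update s t (s t + 1)) fun u hu => by
      rw [Function.update_of_ne (by rintro rfl; exact ht hu)]
      exact h u (by simp [hu])
    refine .seq (.inc _ _ (h t (by simp))) ?_
    convert this using 1
    funext i
    by_cases hi : i = t
    · subst hi; simp [ht]
    · simp [hi]

/-- Adds register `r` to each of the registers `ts`, and empties it. -/
def transfer (r : ℕ) (ts : List ℕ) : CounterProgram := loop r (seq (dec r) (incs ts))

theorem runs_transfer {L r : ℕ} {ts : List ℕ} (hts : ts.Nodup) (hr : r ∉ ts) {s : ℕ → ℕ}
    (h : ∀ t ∈ ts, (s t + s r).size ≤ L) :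
    Runs L (transfer r ts) s fun i => if i = r then 0 else if i ∈ ts then s i + s r else s i := by
  obtain ⟨n, hn⟩ : ∃ n, s r = n := ⟨_, rfl⟩
  induction n generalizing s with
  | zero =>
    refine Eq.subst (motive := Runs L (transfer r ts) s) ?_ (Runs.loop_done hn)
    funext i
    simp only [hn, add_zero, ite_self]
    split_ifs with hi
    · rw [hi, hn]
    · rfl
  | succ n ih =>
    set s1 := Function.update s r (s r - 1) with hs1
    have h1 : ∀ t ∈ ts, s1 t = s t := fun t ht =>
      Function.update_of_ne (by rintro rfl; exact hr ht) _ _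
    have hstep : Runs L (incs ts) s1 fun i => if i ∈ ts then s1 i + 1 else s1 i :=
      runs_incs hts fun t ht => by
        rw [h1 t ht]
        exact (Nat.size_le_size (by omega)).trans (h t ht)
    refine .loop_step (by omega) (.seq (.dec r s) hstep) ?_
    have := ih (s := fun i => if i ∈ ts then s1 i + 1 else s1 i) (fun t ht => by
      simp only [ht, hr, if_true, if_false, h1 t ht]
      refine (Nat.size_le_size ?_).trans (h t ht)
      simp [hs1]; omega) (by simp [hr, hs1]; omega)
    refine Eq.subst (motive := Runs L (transfer r ts) _) ?_ this
    funext i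
    by_cases hi : i = r
    · simp [hi]
    · by_cases hit : i ∈ ts
      · simp only [hi, hit, hr, if_true, if_false, h1 i hit]
        simp [hs1]; omega
      · simp [hi, hit, hs1]

/-- Copies register `a` to the empty register `b`, with the help of the empty register `t`. -/
def copy (a b t : ℕ) : CounterProgram := seq (transfer a [b, t]) (transfer t [a])

theorem runs_copy {L a b t : ℕ} (hab : a ≠ b) (hat : a ≠ t) (hbt : b ≠ t) {s : ℕ → ℕ}
    (hs : Bounded L s) (hb : s b = 0) (ht : s t = 0) :
    Runs L (copy a b t) s (Function.update s b (s a)) := by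
  have h1 := runs_transfer (L := L) (r := a) (ts := [b, t]) (by simp [hbt]) (by simp [hab, hat])
    (s := s) (by simpa [hb, ht] using hs a)
  refine .seq h1 ?_
  have h2 := runs_transfer (L := L) (r := t) (ts := [a]) (by simp) (by simp [hat.symm])
    (s := fun i => if i = a then 0 else if i ∈ [b, t] then s i + s a else s i)
    (by simpa [hat.symm, ht] using hs a)
  convert h2 using 1
  funext i
  by_cases hi : i = b
  · subst hi; simp [hbt, hab.symm, hb]
  · by_cases hi2 : i = t
    · subst hi2; simp [hi, ht]
    · by_cases hi3 : i = a
      · subst hi3; simp [hi, hi2, hat.symm, ht]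
      · simp [hi, hi2, hi3]

theorem exists_runs_copyBlock (m w w' : ℕ) : ∃ P, ∀ s l l' L, l.length = w → l'.length = w' →
    Bounded L (frame s m (l ++ l')) →
      Runs L P (frame s m (l ++ l')) (frame s m (l ++ l' ++ l)) := by
  suffices h : ∀ i ≤ w, ∃ P, ∀ s l l' L, l.length = w → l'.length = w' →
      Bounded L (frame s m (l ++ l')) →
        Runs L P (frame s m (l ++ l')) (frame s m (l ++ l' ++ l.take i)) by
    obtain ⟨P, hP⟩ := h w le_rfl
    refine ⟨P, fun s l l' L hl hl' hb => ?_⟩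
    simpa [← hl] using hP s l l' L hl hl' hb
  intro i hi
  induction i with
  | zero => exact ⟨skip, fun s l l' L _ _ _ => by simpa using Runs.skip _⟩
  | succ i ih =>
    obtain ⟨P, hP⟩ := ih (by omega)
    refine ⟨seq P (copy (m + i) (m + (w + w' + i)) (m + (w + w' + i + 1))),
      fun s l l' L hl hl' hb => .seq (hP s l l' L hl hl' hb) ?_⟩
    have hlen : (l ++ l' ++ l.take i).length = w + w' + i := by simp [hl, hl']; omega
    have := runs_copy (L := L) (a := m + i) (b := m + (w + w' + i)) (t := m + (w + w' + i + 1))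
      (by omega) (by omega) (by omega) (s := frame s m (l ++ l' ++ l.take i))
      ((hP s l l' L hl hl' hb).size_le hb)
      (by rw [frame_apply, List.getD_eq_default _ _ (by omega)])
      (by rw [frame_apply, List.getD_eq_default _ _ (by omega)])
    rw [← hlen, update_frame_length, frame_apply, List.append_assoc, List.append_assoc,
      List.getD_append _ _ _ _ (by omega), List.getD_eq_getElem _ _ (by omega)] at this
    rw [← List.append_assoc, ← List.append_assoc, hlen] at this
    rw [← List.take_append_getElem (by omega : i < l.length)]
    simpa using this

theorem exists_runs_tail (m n : ℕ) : ∃ P, ∀ s v l L, l.length = n →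
    Bounded L (frame s m (v :: l)) → Runs L P (frame s m (v :: l)) (frame s m l) := by
  suffices h : ∀ i ≤ n, ∃ P, ∀ s v l L, l.length = n → Bounded L (frame s m (v :: l)) →
      Runs L P (frame s m (v :: l)) (frame s m (l.take i ++ 0 :: l.drop i)) by
    obtain ⟨P, hP⟩ := h n le_rfl
    refine ⟨P, fun s v l L hl hb => ?_⟩
    simpa [← hl, frame_append_zero] using hP s v l L hl hb
  intro i hi
  induction i with
  | zero =>
    refine ⟨transfer m [], fun s v l L _ _ => ?_⟩
    convert runs_transfer (L := L) (r := m) (ts := []) (by simp) (by simp)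
      (s := frame s m (v :: l)) (by simp) using 1
    have := update_frame s m (v :: l) 0 0 (by simp)
    simp only [List.take_zero, List.nil_append, List.drop_zero]
    simp only [List.set_cons_zero] at this
    rw [← this]
    funext j
    by_cases hj : j = m
    · simp [hj]
    · simp [hj]
  | succ i ih =>
    obtain ⟨P, hP⟩ := ih (by omega)
    refine ⟨seq P (transfer (m + (i + 1)) [m + i]), fun s v l L hl hb =>
      .seq (hP s v l L hl hb) ?_⟩
    have hlt : (l.take i).length = i := by simp; omega
    have hb' := (hP s v l L hl hb).size_le hb
    have h0 : frame s m (l.take i ++ 0 :: l.drop i) (m + i) = 0 := by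
      rw [frame_apply, List.getD_append_right _ _ _ _ (by omega)]; simp [hlt]
    have h1 : frame s m (l.take i ++ 0 :: l.drop i) (m + (i + 1)) = l[i] := by
      rw [frame_apply, List.getD_append_right _ _ _ _ (by omega)]
      simp [hlt, List.getD_eq_getElem?_getD, List.getElem?_eq_getElem (by omega : i < l.length)]
    convert runs_transfer (L := L) (r := m + (i + 1)) (ts := [m + i]) (by simp) (by simp)
      (s := frame s m (l.take i ++ 0 :: l.drop i))
      (by simpa [h0] using hb' (m + (i + 1))) using 1
    have e : l.take (i + 1) ++ 0 :: l.drop (i + 1) =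
        ((l.take i ++ 0 :: l.drop i).set i l[i]).set (i + 1) 0 := by
      rw [List.drop_eq_getElem_cons (by omega : i < l.length),
        ← List.take_append_getElem (by omega : i < l.length)]
      rw [List.set_append_right _ _ (by omega), hlt, Nat.sub_self, List.set_cons_zero,
        List.set_append_right _ _ (by omega), hlt]
      simp only [List.append_assoc, List.singleton_append, Nat.add_sub_cancel_left,
        List.set_cons_succ, List.set_cons_zero]
    rw [e, ← update_frame _ _ _ _ _ (by simp; omega), ← update_frame _ _ _ _ _ (by simp; omega)]
    funext j
    by_cases hj : j = m + (i + 1)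
    · simp [hj]
    · by_cases hj2 : j = m + i
      · subst hj2; simp [h0, h1]
      · simp [hj, hj2]

theorem exists_runs_drop (m w n : ℕ) : ∃ P, ∀ s l l' L, l.length = w → l'.length = n →
    Bounded L (frame s m (l ++ l')) → Runs L P (frame s m (l ++ l')) (frame s m l') := by
  induction w with
  | zero =>
    exact ⟨skip, fun s l l' L hl _ _ => by simpa [List.length_eq_zero_iff.1 hl] using Runs.skip _⟩
  | succ w ih =>
    obtain ⟨P, hP⟩ := ih
    obtain ⟨Q, hQ⟩ := exists_runs_tail m (w + n)
    refine ⟨seq Q P, fun s l l' L hl hl' hb => ?_⟩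
    obtain ⟨v, l, rfl⟩ := List.exists_cons_of_length_eq_add_one hl
    have h1 := hQ s v (l ++ l') L (by simp_all) hb
    exact .seq h1 (hP s l l' L (by simpa using hl) hl' (h1.size_le hb))

theorem exists_runs_take (m w n : ℕ) : ∃ P, ∀ s l l' L, l.length = w → l'.length = n →
    Runs L P (frame s m (l ++ l')) (frame s m l) := by
  induction n with
  | zero =>
    exact ⟨skip, fun s l l' L _ hl => by simpa [List.length_eq_zero_iff.1 hl] using Runs.skip _⟩
  | succ n ih =>
    obtain ⟨P, hP⟩ := ih
    refine ⟨seq (transfer (m + (w + n)) []) P, fun s l l' L hl hl' => ?_⟩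
    obtain ⟨l', v, rfl⟩ := List.eq_nil_or_concat' l' |>.resolve_left (by rintro rfl; simp at hl')
    simp only [List.length_append, List.length_singleton, Nat.add_right_cancel_iff] at hl'
    refine .seq ?_ (hP s l l' L hl hl')
    convert runs_transfer (L := L) (r := m + (w + n)) (ts := []) (by simp) (by simp)
      (s := frame s m (l ++ (l' ++ [v]))) (by simp) using 1
    have hlen : (l ++ l').length = w + n := by simp [hl, hl']
    rw [← frame_append_zero, ← List.append_assoc, ← update_frame_length, ← update_frame_length,
      hlen]
    funext j
    by_cases hj : j = m + (w + n)
    · simp [hj]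
    · simp [hj]

theorem exists_runs_const (m w : ℕ) (l' : List ℕ) : ∃ P, ∀ s l L, l.length = w →
    (∀ n ∈ l', n.size ≤ L) → Runs L P (frame s m l) (frame s m (l ++ l')) := by
  induction l' using List.reverseRecOn with
  | nil => exact ⟨skip, fun s l L _ _ => by simpa using Runs.skip _⟩
  | append_singleton l' v ih =>
    obtain ⟨P, hP⟩ := ih
    suffices h : ∃ Q, ∀ s l L, l.length = w + l'.length → v.size ≤ L →
        Runs L Q (frame s m l) (frame s m (l ++ [v])) by
      obtain ⟨Q, hQ⟩ := h
      refine ⟨seq P Q, fun s l L hl h => .seq (hP s l L hl fun n hn => h n (by simp [hn])) ?_⟩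
      rw [← List.append_assoc]
      exact hQ s (l ++ l') L (by simp [hl]) (h v (by simp))
    clear hP
    induction v with
    | zero => exact ⟨skip, fun s l L _ _ => by simpa [frame_append_zero] using Runs.skip _⟩
    | succ v ihv =>
      obtain ⟨Q, hQ⟩ := ihv
      refine ⟨seq Q (inc (m + (w + l'.length))), fun s l L hl h =>
        .seq (hQ s l L hl ((Nat.size_le_size (Nat.le_succ v)).trans h)) ?_⟩
      have hv : frame s m (l ++ [v]) (m + (w + l'.length)) = v := by
        rw [← hl, frame_apply]; simp
      convert Runs.inc (L := L) (m + (w + l'.length)) (frame s m (l ++ [v])) (by rwa [hv]) using 1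
      rw [hv, ← update_frame_length, ← update_frame_length, ← hl, Function.update_idem]

end CounterProgram

open CounterProgram

/-- `f` is computed by counter programs, at any base address, with intermediate numbers whose length
is polynomial in the length of the numbers in the store. Registers below the base address are left
alone; all registers above the input are available, and empty. -/
@[fun_prop]
def PolySpace {α β : Type} [RegisterData α] [RegisterData β] (f : α → β) : Prop :=
  ∀ m : ℕ, ∃ (P : CounterProgram) (p : Polynomial ℕ), ∀ s x L,
    Bounded L (frame s m (registers x)) →
      Runs (p.eval L) P (frame s m (registers x)) (frame s m (registers (f x)))

namespace PolySpace

variable {α β γ : Type} [RegisterData α] [RegisterData β] [RegisterData γ]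

@[fun_prop]
theorem id : PolySpace (fun x : α => x) :=
  fun _ => ⟨.skip, 0, fun _ _ _ _ => .skip _⟩

@[fun_prop]
theorem comp {g : β → γ} {f : α → β} (hg : PolySpace g) (hf : PolySpace f) :
    PolySpace (fun x => g (f x)) := by
  intro m
  obtain ⟨P, p, hP⟩ := hf m
  obtain ⟨Q, q, hQ⟩ := hg m
  refine ⟨.seq P Q, p + q.comp (p + Polynomial.X), fun s x L hL => ?_⟩
  have h1 := hP s x L hL
  have h2 := hQ s (f x) (p.eval L + L)
    ((h1.mono (Nat.le_add_right _ _)).size_le (hL.mono (Nat.le_add_left _ _)))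
  exact .seq (h1.mono (by simp)) (h2.mono (by simp))

@[fun_prop]
theorem const (c : β) : PolySpace (fun _ : α => c) := by
  intro m
  obtain ⟨P, hP⟩ := exists_runs_drop m (width α) 0
  obtain ⟨Q, hQ⟩ := exists_runs_const m 0 (registers c)
  refine ⟨.seq P Q, Polynomial.X + Polynomial.C (registerSize c), fun s x L hL => ?_⟩
  have h1 := hP s (registers x) [] L (length_registers x) rfl (by simpa using hL)
  have h2 := hQ s [] (registerSize c) rfl fun n hn => size_le_registerSize hn
  simp only [List.append_nil] at h1
  exact .seq (h1.mono (by simp)) (h2.mono (by simp))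

theorem fst' : PolySpace (fun x : α × β => x.1) := by
  intro m
  obtain ⟨P, hP⟩ := exists_runs_take m (width α) (width β)
  exact ⟨P, Polynomial.X, fun s x L hL =>
    (hP s _ _ L (length_registers x.1) (length_registers x.2)).mono (by simp)⟩

theorem snd' : PolySpace (fun x : α × β => x.2) := by
  intro m
  obtain ⟨P, hP⟩ := exists_runs_drop m (width α) (width β)
  exact ⟨P, Polynomial.X, fun s x L hL =>
    (hP s _ _ L (length_registers x.1) (length_registers x.2) hL).mono (by simp)⟩

@[fun_prop]
theorem fst {f : α → β × γ} (hf : PolySpace f) : PolySpace (fun x => (f x).1) := fst'.comp hf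

@[fun_prop]
theorem snd {f : α → β × γ} (hf : PolySpace f) : PolySpace (fun x => (f x).2) := snd'.comp hf

@[fun_prop]
theorem prodMk {f : α → β} {g : α → γ} (hf : PolySpace f) (hg : PolySpace g) :
    PolySpace (fun x => (f x, g x)) := by
  intro m
  obtain ⟨C, hC⟩ := exists_runs_copyBlock m (width α) 0
  obtain ⟨P, p, hP⟩ := hf (m + width α)
  obtain ⟨D, hD⟩ := exists_runs_copyBlock m (width α) (width β)
  obtain ⟨Q, q, hQ⟩ := hg (m + width α + width β)
  obtain ⟨E, hE⟩ := exists_runs_drop m (width α) (width β + width γ)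
  let r : Polynomial ℕ := Polynomial.X + p
  refine ⟨.seq C (.seq P (.seq D (.seq Q E))), r + q.comp r, fun s x L hL => ?_⟩
  have hr : r.eval L = L + p.eval L := by simp [r]
  have hrq : (r + q.comp r).eval L = r.eval L + q.eval (r.eval L) := by simp
  have lx := length_registers x
  have h1 := hC s (registers x) [] L lx rfl (by simpa using hL)
  simp only [List.append_nil] at h1
  have b1 : Bounded L (frame s m (registers x ++ registers x)) := h1.size_le hL
  have h2 := hP (frame s m (registers x)) x L (by rwa [← lx, ← frame_append])
  rw [← lx, ← frame_append, ← frame_append] at h2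
  have b2 : Bounded (r.eval L) (frame s m (registers x ++ registers (f x))) :=
    (h2.mono (by omega)).size_le (b1.mono (by omega))
  have h3 := hD s (registers x) (registers (f x)) _ lx (length_registers _) b2
  have b3 : Bounded (r.eval L) (frame s m (registers x ++ registers (f x) ++ registers x)) :=
    h3.size_le b2
  have h4 := hQ (frame s m (registers x ++ registers (f x))) x (r.eval L) (by
    rwa [add_assoc, ← lx, ← length_registers (f x), ← List.length_append, ← frame_append])
  rw [add_assoc, ← lx, ← length_registers (f x), ← List.length_append, ← frame_append,
    ← frame_append] at h4
  have b4 : Bounded (r.eval L + q.eval (r.eval L))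
      (frame s m (registers x ++ registers (f x) ++ registers (g x))) :=
    (h4.mono (Nat.le_add_left _ _)).size_le (b3.mono (Nat.le_add_right _ _))
  rw [List.append_assoc _ _ (registers (g x))] at h4 b4
  have h5 := hE s (registers x) (registers (f x) ++ registers (g x)) _ lx
    (by simp [length_registers]) b4
  rw [hrq]
  exact .seq (h1.mono (by omega)) (.seq (h2.mono (by omega)) (.seq (h3.mono (by omega))
    (.seq (h4.mono (Nat.le_add_left _ _)) h5)))

@[fun_prop]
theorem succ : PolySpace Nat.succ := by
  intro m
  refine ⟨.inc m, Polynomial.X + 1, fun s x L hL => ?_⟩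
  have h0 : frame s m (registers x) m = x := by simpa [registers] using frame_apply s m [x] 0
  have hx : x.size ≤ L := by simpa [h0] using hL m
  convert Runs.inc m _ ?_ using 1
  · have := update_frame s m [x] 0 (x + 1) (by simp)
    rw [h0]
    simpa [registers] using this.symm
  · rw [h0]
    refine Nat.size_le.2 (lt_of_le_of_lt (Nat.succ_le_of_lt (Nat.size_le.1 hx)) ?_)
    simp [pow_succ]

@[fun_prop]
theorem pred : PolySpace Nat.pred := by
  intro m
  refine ⟨.dec m, 0, fun s x L hL => ?_⟩
  have h0 : frame s m (registers x) m = x := by simpa [registers] using frame_apply s m [x] 0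
  convert Runs.dec m _ using 1
  have := update_frame s m [x] 0 (x - 1) (by simp)
  rw [h0]
  simpa [registers] using this.symm

/-- A function whose values are stored in the same registers. -/
theorem of_registers_eq {δ : Type} [RegisterData δ] {f : α → β} {g : α → δ} (hf : PolySpace f)
    (h : ∀ x, registers (f x) = registers (g x)) : PolySpace g := by
  intro m
  obtain ⟨P, p, hP⟩ := hf m
  exact ⟨P, p, fun s x L hL => h x ▸ hP s x L hL⟩

/-- The iteration of `f`, from `init a` until the first component is zero, is computable in
polynomial space if all the intermediate values have polynomial length. -/
theorem loop {f : ℕ × β → ℕ × β} {init g : α → ℕ × β} (hf : PolySpace f) (hi : PolySpace init)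
    (q : Polynomial ℕ)
    (H : ∀ a, Relation.ReflTransGen (fun y z => y.1 ≠ 0 ∧ z = f y ∧
      registerSize z ≤ q.eval (registerSize a)) (init a) (g a) ∧ (g a).1 = 0) : PolySpace g := by
  intro m
  obtain ⟨I, i, hI⟩ := hi m
  obtain ⟨P, p, hP⟩ := hf m
  let r : Polynomial ℕ := Polynomial.X + i + q.comp (Polynomial.C (width α) * Polynomial.X)
  refine ⟨.seq I (.loop m P), r + p.comp r, fun s a L hL => ?_⟩
  have hr : r.eval L = L + i.eval L + q.eval (width α * L) := by simp [r]
  have hrp : (r + p.comp r).eval L = r.eval L + p.eval (r.eval L) := by simp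
  rw [hrp]
  have h1 := hI s a L hL
  refine .seq (h1.mono (by omega)) ?_
  obtain ⟨hreach, hzero⟩ := H a
  have hq : q.eval (registerSize a) ≤ r.eval L := by
    rw [hr]
    exact le_add_left (q.eval_mono_nat (registerSize_le (bounded_frame_iff.1 hL).2))
  have hb : Bounded (r.eval L) (frame s m (registers (init a))) :=
    (h1.mono (by omega)).size_le (hL.mono (by omega))
  have hfst : ∀ y : ℕ × β, frame s m (registers y) m = y.1 := fun y => by
    simpa [registers] using frame_apply s m (registers y) 0
  have hs := (bounded_frame_iff.1 hb).1
  clear h1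
  generalize init a = y at hreach hb
  induction hreach using Relation.ReflTransGen.head_induction_on with
  | refl => exact .loop_done (by rw [hfst, hzero])
  | @head y z hyz _ ih =>
    obtain ⟨hy, rfl, hsz⟩ := hyz
    have := hP s y _ hb
    refine .loop_step (by rwa [hfst]) (this.mono (by omega)) (ih ?_)
    exact bounded_frame_iff.2 ⟨hs, fun n hn => (size_le_registerSize hn).trans (hsz.trans hq)⟩

/-- The values of `f` have polynomial length, since they are left in the store at the end. -/
theorem exists_registerSize_le {f : α → β} (hf : PolySpace f) :
    ∃ p : Polynomial ℕ, ∀ x, registerSize (f x) ≤ p.eval (registerSize x) := by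
  obtain ⟨P, p, hP⟩ := hf 0
  refine ⟨Polynomial.C (width β) * (Polynomial.X + p), fun x => ?_⟩
  have hb : Bounded (registerSize x) (frame 0 0 (registers x)) :=
    bounded_frame_iff.2 ⟨by simp, fun n hn => size_le_registerSize hn⟩
  have := ((hP 0 x _ hb).mono (Nat.le_add_left _ (registerSize x))).size_le
    (hb.mono (Nat.le_add_right _ _))
  simpa using registerSize_le (bounded_frame_iff.1 this).2

/-- Iteration with a counter. -/
theorem iterate {n : α → ℕ} {x : α → β} {f : α × β → β} (hn : PolySpace n) (hx : PolySpace x)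
    (hf : PolySpace f) (q : Polynomial ℕ) (hq : ∀ a, ∀ k ≤ n a,
      registerSize ((fun y => f (a, y))^[k] (x a)) ≤ q.eval (registerSize a)) :
    PolySpace (fun a => (fun y => f (a, y))^[n a] (x a)) := by
  obtain ⟨pn, hpn⟩ := hn.exists_registerSize_le
  have : PolySpace (fun a => ((0 : ℕ), a, (fun y => f (a, y))^[n a] (x a))) := by
    refine loop (f := fun z => (z.1.pred, z.2.1, f z.2)) (init := fun a => (n a, a, x a))
      (by fun_prop) (by fun_prop) (pn + Polynomial.X + q) fun a => ⟨?_, rfl⟩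
    suffices h : ∀ k ≤ n a, Relation.ReflTransGen (fun y z : ℕ × α × β => y.1 ≠ 0 ∧
        z = (y.1.pred, y.2.1, f y.2) ∧
          registerSize z ≤ (pn + Polynomial.X + q).eval (registerSize a))
        (n a, a, x a) (n a - k, a, (fun y => f (a, y))^[k] (x a)) by
      simpa using h (n a) le_rfl
    intro k hk
    induction k with
    | zero => exact .refl
    | succ k ih =>
      refine (ih (by omega)).tail ⟨by simp; omega, ?_, ?_⟩
      · rw [Function.iterate_succ_apply']
        simp; omega
      · have h1 : (n a - (k + 1)).size ≤ pn.eval (registerSize a) :=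
          (Nat.size_le_size (Nat.sub_le _ _)).trans (by simpa using hpn a)
        have h2 := hq a (k + 1) hk
        simp only [registerSize_prod, registerSize_nat, Polynomial.eval_add, Polynomial.eval_X]
        omega
  exact (this.snd).snd

end PolySpace

/-! ### Arithmetic in polynomial space -/

theorem Nat.size_add_le (a b : ℕ) : (a + b).size ≤ a.size + b.size + 1 := by
  rw [Nat.size_le]
  calc a + b < 2 ^ a.size + 2 ^ b.size := add_lt_add (Nat.lt_size_self a) (Nat.lt_size_self b)
    _ ≤ 2 ^ (a.size + b.size) + 2 ^ (a.size + b.size) := by gcongr <;> omega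
    _ = _ := by ring

theorem Nat.size_mul_le (a b : ℕ) : (a * b).size ≤ a.size + b.size := by
  rw [Nat.size_le, pow_add]
  exact Nat.mul_lt_mul'' (Nat.lt_size_self a) (Nat.lt_size_self b)

/-- One step of counting up a quotient and a remainder modulo `m`. -/
def divModStep (m : ℕ) (y : ℕ × ℕ) : ℕ × ℕ :=
  bif Nat.beq (y.2 + 1) m then (y.1 + 1, 0) else (y.1, y.2 + 1)

theorem iterate_divModStep (m n : ℕ) : (divModStep m)^[n] (0, 0) = (n / m, n % m) := by
  induction n with
  | zero => simp
  | succ n ih =>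
    rw [Function.iterate_succ_apply', ih, divModStep]
    rcases Nat.eq_zero_or_pos m with rfl | hm
    · have : Nat.beq (n + 1) 0 = false := rfl
      simp [this]
    · have h1 := Nat.div_add_mod n m
      have h2 := Nat.mod_lt n hm
      by_cases h : n % m + 1 = m
      · rw [show Nat.beq (n % m + 1) m = true by simpa [Nat.beq_eq] using h]
        have : n + 1 = m * (n / m + 1) := by rw [mul_add]; omega
        rw [this]
        simp [hm]
      · rw [show Nat.beq (n % m + 1) m = false by
          rw [Bool.eq_false_iff]; simpa [Nat.beq_eq] using h]
        have : n + 1 = (n % m + 1) + m * (n / m) := by omega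
        have h3 : n % m + 1 < m := by omega
        have e1 : (n + 1) / m = n / m := by
          rw [this, Nat.add_mul_div_left _ _ hm, Nat.div_eq_of_lt h3, zero_add]
        have e2 : (n + 1) % m = n % m + 1 := by
          rw [this, Nat.add_mul_mod_self_left, Nat.mod_eq_of_lt h3]
        rw [e1, e2]; rfl

namespace PolySpace

variable {α β γ : Type} [RegisterData α] [RegisterData β] [RegisterData γ]

/-- Addition, like the other operations, is done by counting: that takes exponentially many steps,
but only the space matters. -/
@[fun_prop]
theorem add {f g : α → ℕ} (hf : PolySpace f) (hg : PolySpace g) :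
    PolySpace (fun x => f x + g x) := by
  have e : ∀ m n : ℕ, Nat.succ^[n] m = m + n := fun m n => Nat.succ_iterate m n
  have : PolySpace (fun z : ℕ × ℕ => (fun y => Nat.succ (z, y).2)^[z.2] z.1) := by
    refine iterate (f := fun z : (ℕ × ℕ) × ℕ => Nat.succ z.2) (by fun_prop) (by fun_prop)
      (by fun_prop) (Polynomial.X + 1) fun z k hk => ?_
    change registerSize (Nat.succ^[k] z.1) ≤ _
    rw [e]
    have := Nat.size_add_le z.1 k
    have := Nat.size_le_size hk
    simp only [registerSize_nat, registerSize_prod, Polynomial.eval_add, Polynomial.eval_X,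
      Polynomial.eval_one]
    omega
  have h2 : PolySpace (fun z : ℕ × ℕ => z.1 + z.2) := by
    convert this using 2 with z
    exact (e _ _).symm
  exact h2.comp (hf.prodMk hg)

@[fun_prop]
theorem sub {f g : α → ℕ} (hf : PolySpace f) (hg : PolySpace g) :
    PolySpace (fun x => f x - g x) := by
  have e : ∀ m n : ℕ, Nat.pred^[n] m = m - n := fun m n => Nat.pred_iterate m n
  have : PolySpace (fun z : ℕ × ℕ => (fun y => Nat.pred (z, y).2)^[z.2] z.1) := by
    refine iterate (f := fun z : (ℕ × ℕ) × ℕ => Nat.pred z.2) (by fun_prop) (by fun_prop)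
      (by fun_prop) Polynomial.X fun z k hk => ?_
    change registerSize (Nat.pred^[k] z.1) ≤ _
    rw [e]
    have := Nat.size_le_size (Nat.sub_le z.1 k)
    simp only [registerSize_nat, registerSize_prod, Polynomial.eval_X]
    omega
  have h2 : PolySpace (fun z : ℕ × ℕ => z.1 - z.2) := by
    convert this using 2 with z
    exact (e _ _).symm
  exact h2.comp (hf.prodMk hg)

@[fun_prop]
theorem mul {f g : α → ℕ} (hf : PolySpace f) (hg : PolySpace g) :
    PolySpace (fun x => f x * g x) := by
  have e : ∀ m n : ℕ, (fun y => y + m)^[n] 0 = m * n := fun m n => by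
    induction n with
    | zero => simp
    | succ n ih => rw [Function.iterate_succ_apply', ih]; ring
  have : PolySpace (fun z : ℕ × ℕ => (fun y => (z, y).2 + (z, y).1.1)^[z.2] 0) := by
    refine iterate (f := fun z : (ℕ × ℕ) × ℕ => z.2 + z.1.1) (by fun_prop) (by fun_prop)
      (by fun_prop) Polynomial.X fun z k hk => ?_
    change registerSize ((fun y => y + z.1)^[k] 0) ≤ _
    rw [e]
    have := Nat.size_mul_le z.1 k
    have := Nat.size_le_size hk
    simp only [registerSize_nat, registerSize_prod, Polynomial.eval_X]
    omega
  have h2 : PolySpace (fun z : ℕ × ℕ => z.1 * z.2) := by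
    convert this using 2 with z
    exact (e _ _).symm
  exact h2.comp (hf.prodMk hg)

@[fun_prop]
theorem cond {b : α → Bool} {f g : α → β} (hb : PolySpace b) (hf : PolySpace f)
    (hg : PolySpace g) : PolySpace (fun x => bif b x then f x else g x) := by
  obtain ⟨p, hp⟩ := hf.exists_registerSize_le
  obtain ⟨q, hq⟩ := hg.exists_registerSize_le
  have hn : PolySpace (fun x => (b x).toNat) := hb.of_registers_eq fun x => rfl
  have : PolySpace (fun x => (fun y => (fun z : α × β => f z.1) (x, y))^[(b x).toNat] (g x)) := by
    refine iterate (f := fun z : α × β => f z.1) hn hg (by fun_prop) (p + q) fun a k hk => ?_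
    have hk2 : k ≤ 1 := hk.trans (Bool.toNat_le _)
    have h1 := hp a
    have h2 := hq a
    interval_cases k
    · simp only [Function.iterate_zero, _root_.id, Polynomial.eval_add]; omega
    · simp only [Function.iterate_one, Polynomial.eval_add]; omega
  convert this using 2 with x
  cases b x <;> rfl

/-- Whether a number is nonzero. -/
theorem nonzero {f : α → ℕ} (hf : PolySpace f) : PolySpace (fun x => !Nat.beq (f x) 0) := by
  have e : ∀ n : ℕ, (fun _ => true)^[n] false = !Nat.beq n 0 := fun n => by
    cases n with
    | zero => rfl
    | succ n => rw [Function.iterate_succ_apply']; rfl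
  have : PolySpace (fun n : ℕ => (fun y => (fun _ : ℕ × Bool => true) (n, y))^[n] false) :=
    iterate (n := fun n : ℕ => n) (x := fun _ => false) (f := fun _ : ℕ × Bool => true)
      (by fun_prop) (by fun_prop) (by fun_prop) 1 fun a k _ => by
      simpa using registerSize_bool _
  have h2 : PolySpace (fun n : ℕ => !Nat.beq n 0) := by
    convert this using 2 with n
    exact (e n).symm
  exact h2.comp hf

@[fun_prop]
theorem not {b : α → Bool} (hb : PolySpace b) : PolySpace (fun x => !b x) := by
  have : PolySpace (fun x => bif b x then false else true) := by fun_prop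
  convert this using 2 with x
  cases b x <;> rfl

@[fun_prop]
theorem and {b c : α → Bool} (hb : PolySpace b) (hc : PolySpace c) :
    PolySpace (fun x => b x && c x) := by
  have : PolySpace (fun x => bif b x then c x else false) := by fun_prop
  convert this using 2 with x
  cases b x <;> rfl

@[fun_prop]
theorem or {b c : α → Bool} (hb : PolySpace b) (hc : PolySpace c) :
    PolySpace (fun x => b x || c x) := by
  have : PolySpace (fun x => bif b x then true else c x) := by fun_prop
  convert this using 2 with x
  cases b x <;> rfl

@[fun_prop]
theorem beq {f g : α → ℕ} (hf : PolySpace f) (hg : PolySpace g) :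
    PolySpace (fun x => Nat.beq (f x) (g x)) := by
  have : PolySpace (fun x => !!Nat.beq ((f x - g x) + (g x - f x)) 0) :=
    .not (.nonzero (by fun_prop))
  convert this using 2 with x
  rw [Bool.not_not, Bool.eq_iff_iff]
  simp only [Nat.beq_eq]
  omega

@[fun_prop]
theorem ble {f g : α → ℕ} (hf : PolySpace f) (hg : PolySpace g) :
    PolySpace (fun x => Nat.ble (f x) (g x)) := by
  have : PolySpace (fun x => Nat.beq (f x - g x) 0) := by fun_prop
  convert this using 2 with x
  rw [Bool.eq_iff_iff]
  simp only [Nat.beq_eq, Nat.ble_eq]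
  omega

@[fun_prop]
theorem divMod {f g : α → ℕ} (hf : PolySpace f) (hg : PolySpace g) :
    PolySpace (fun x => (f x / g x, f x % g x)) := by
  have : PolySpace (fun z : ℕ × ℕ =>
      (fun y => (fun v : (ℕ × ℕ) × ℕ × ℕ => divModStep v.1.2 v.2) (z, y))^[z.1] (0, 0)) := by
    refine iterate (n := fun z : ℕ × ℕ => z.1) (x := fun _ => (0, 0))
      (f := fun v : (ℕ × ℕ) × ℕ × ℕ => divModStep v.1.2 v.2)
      (by fun_prop) (by fun_prop) (by unfold divModStep; fun_prop) (2 * Polynomial.X)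
      fun z k hk => ?_
    change registerSize ((divModStep z.2)^[k] (0, 0)) ≤ _
    rw [iterate_divModStep]
    have h1 := Nat.size_le_size ((Nat.div_le_self k z.2).trans hk)
    have h2 := Nat.size_le_size ((Nat.mod_le k z.2).trans hk)
    simp only [registerSize_nat, registerSize_prod, Polynomial.eval_mul, Polynomial.eval_X,
      Polynomial.eval_ofNat]
    omega
  have h2 : PolySpace (fun z : ℕ × ℕ => (z.1 / z.2, z.1 % z.2)) := by
    convert this using 2 with z
    exact (iterate_divModStep _ _).symm
  exact h2.comp (hf.prodMk hg)

@[fun_prop]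
theorem div {f g : α → ℕ} (hf : PolySpace f) (hg : PolySpace g) :
    PolySpace (fun x => f x / g x) := (divMod hf hg).fst

@[fun_prop]
theorem mod {f g : α → ℕ} (hf : PolySpace f) (hg : PolySpace g) :
    PolySpace (fun x => f x % g x) := (divMod hf hg).snd

theorem pow {f g : α → ℕ} (hf : PolySpace f) (hg : PolySpace g) (q : Polynomial ℕ)
    (hq : ∀ x, (f x ^ g x).size ≤ q.eval (registerSize x)) : PolySpace (fun x => f x ^ g x) := by
  have e : ∀ m n : ℕ, (fun y => y * m)^[n] 1 = m ^ n := fun m n => by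
    induction n with
    | zero => simp
    | succ n ih => rw [Function.iterate_succ_apply', ih]; ring
  have : PolySpace (fun x => (fun y => (fun v : α × ℕ => v.2 * f v.1) (x, y))^[g x] 1) := by
    refine iterate (n := g) (x := fun _ => 1) (f := fun v : α × ℕ => v.2 * f v.1)
      hg (by fun_prop) (by fun_prop) (q + 1) fun a k hk => ?_
    change registerSize ((fun y => y * f a)^[k] 1) ≤ _
    rw [e]
    simp only [registerSize_nat, Polynomial.eval_add, Polynomial.eval_one]
    rcases Nat.eq_zero_or_pos (f a) with h0 | h0
    · rw [h0]
      rcases k with _ | k <;> simp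
    · exact (Nat.size_le_size (Nat.pow_le_pow_right h0 hk)).trans ((hq a).trans (Nat.le_succ _))
  convert this using 2 with x
  exact (e _ _).symm

/-- Distinction of finitely many cases. -/
theorem natCases {n : α → ℕ} {F : ℕ → α → β} (hn : PolySpace n) (hF : ∀ k, PolySpace (F k))
    (K : ℕ) (hK : ∀ a, n a ≤ K) : PolySpace (fun a => F (n a) a) := by
  suffices h : ∀ K, PolySpace (fun a => F (Min.min (n a) K) a) by
    convert h K using 2 with a
    rw [min_eq_left (hK a)]
  clear hK K
  intro K
  induction K with
  | zero => simpa using hF 0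
  | succ K ih =>
    have : PolySpace (fun a =>
        bif Nat.ble (n a) K then F (Min.min (n a) K) a else F (K + 1) a) := by
      exact .cond (by fun_prop) ih (hF _)
    convert this using 2 with a
    by_cases h : n a ≤ K
    · rw [Nat.ble_eq_true_of_le h, min_eq_left h, min_eq_left (by omega)]; rfl
    · have : Nat.ble (n a) K = false := by
        rw [Bool.eq_false_iff]; simpa using h
      rw [this, min_eq_right (by omega)]; rfl

end PolySpace

/-! ### Words in polynomial space -/

/-- The optional symbol as a number: `0` stands for the absence of a symbol. -/
def symbolNumber : Option InstanceSymbol → ℕ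
  | none => 0
  | some s => s.digit + 1

theorem symbolNumber_injective : Function.Injective symbolNumber := by
  intro a b h
  rcases a with _ | a <;> rcases b with _ | b
  · rfl
  · simp [symbolNumber] at h
  · simp [symbolNumber] at h
  · rw [InstanceSymbol.digit_injective (Fin.ext (Nat.succ_injective h))]

instance : RegisterData (Option InstanceSymbol) := ⟨1, fun s => [symbolNumber s], fun _ => rfl⟩

theorem wordNumber_cons (s : InstanceSymbol) (l : List InstanceSymbol) :
    wordNumber (s :: l) = s.digit + 1 + 13 * wordNumber l := rfl

theorem wordNumber_drop_le (l : List InstanceSymbol) (k : ℕ) :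
    wordNumber (l.drop k) ≤ wordNumber l := by
  induction k generalizing l with
  | zero => simp
  | succ k ih =>
    cases l with
    | nil => simp
    | cons s l => exact (ih l).trans (by rw [wordNumber_cons]; omega)

theorem length_le_size_wordNumber (l : List InstanceSymbol) : l.length ≤ (wordNumber l).size := by
  simpa [wordNumber] using length_le_size_ofDigits (l.map InstanceSymbol.digit)

theorem length_le_wordNumber (l : List InstanceSymbol) : l.length ≤ wordNumber l := by
  induction l with
  | nil => simp
  | cons s l ih => rw [wordNumber_cons, List.length_cons]; omega

theorem Nat.size_le_self (n : ℕ) : n.size ≤ n := Nat.size_le.2 n.lt_two_pow_self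

namespace PolySpace

variable {α β γ : Type} [RegisterData α] [RegisterData β] [RegisterData γ]

theorem wordNumber : PolySpace wordNumber := PolySpace.id.of_registers_eq fun _ => rfl

@[fun_prop]
theorem head? : PolySpace (fun l : List InstanceSymbol => l.head?) := by
  have h := PolySpace.wordNumber
  have : PolySpace (fun l : List InstanceSymbol => bif Nat.beq (_root_.wordNumber l) 0 then 0
      else (_root_.wordNumber l - 1) % 13 + 1) := by fun_prop
  refine this.of_registers_eq fun l => ?_
  cases l with
  | nil => rfl
  | cons s l =>
    have : Nat.beq (_root_.wordNumber (s :: l)) 0 = false := by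
      rw [Bool.eq_false_iff]; simp [Nat.beq_eq, wordNumber_cons]
    simp only [registers]
    rw [this, wordNumber_cons]
    simp only [cond_false, List.head?_cons, symbolNumber]
    congr 1
    have := s.digit.2
    omega

@[fun_prop]
theorem tail : PolySpace (fun l : List InstanceSymbol => l.tail) := by
  have h := PolySpace.wordNumber
  have : PolySpace (fun l : List InstanceSymbol => (_root_.wordNumber l - 1) / 13) := by fun_prop
  refine this.of_registers_eq fun l => ?_
  cases l with
  | nil => rfl
  | cons s l =>
    simp only [registers, List.tail_cons, wordNumber_cons]
    congr 1
    have := s.digit.2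
    omega

/-- Distinction of cases according to a symbol. -/
theorem symbolCases {o : α → Option InstanceSymbol} {F : Option InstanceSymbol → α → β}
    (ho : PolySpace o) (hF : ∀ s, PolySpace (F s)) : PolySpace (fun a => F (o a) a) := by
  have hn : PolySpace (fun a => symbolNumber (o a)) := ho.of_registers_eq fun _ => rfl
  have := natCases (F := fun k a => F (Function.invFun symbolNumber k) a) hn (fun k => hF _) 13
    fun a => by
      rcases o a with _ | s
      · simp [symbolNumber]
      · have := s.digit.2; simp only [symbolNumber]; omega
  convert this using 3 with a
  exact (Function.leftInverse_invFun symbolNumber_injective _).symm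

@[fun_prop]
theorem symbolFun (g : Option InstanceSymbol → β) : PolySpace g :=
  symbolCases (F := fun s _ => g s) .id fun _ => .const _

/-- Going through the symbols of a word. The iteration runs longer than the word, and does nothing
once the word is exhausted. -/
theorem foldl {l : α → List InstanceSymbol} {x : α → β} {f : α × β × Option InstanceSymbol → β}
    (hl : PolySpace l) (hx : PolySpace x) (hf : PolySpace f) (q : Polynomial ℕ)
    (hq : ∀ a l', l' <+: l a →
      registerSize (l'.foldl (fun y s => f (a, y, some s)) (x a)) ≤ q.eval (registerSize a)) :
    PolySpace (fun a => (l a).foldl (fun y s => f (a, y, some s)) (x a)) := by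
  obtain ⟨p, hp⟩ := hl.exists_registerSize_le
  have hn : PolySpace (fun a => _root_.wordNumber (l a)) := PolySpace.wordNumber.comp hl
  let step : α × List InstanceSymbol × β → List InstanceSymbol × β := fun z =>
    (z.2.1.tail, bif (z.2.1.head?).isSome then f (z.1, z.2.2, z.2.1.head?) else z.2.2)
  have hstep : ∀ a k, (fun y => step (a, y))^[k] (l a, x a) =
      ((l a).drop k, ((l a).take k).foldl (fun y s => f (a, y, some s)) (x a)) := by
    intro a k
    induction k with
    | zero => simp
    | succ k ih =>
      rw [Function.iterate_succ_apply', ih]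
      by_cases hk : k < (l a).length
      · simp only [step, List.drop_eq_getElem_cons hk, List.tail_cons, List.head?_cons,
          Option.isSome_some, cond_true, ← List.take_append_getElem hk, List.foldl_append,
          List.foldl_cons, List.foldl_nil]
      · simp only [step, List.drop_eq_nil_of_le (by omega : (l a).length ≤ k),
          List.drop_eq_nil_of_le (by omega : (l a).length ≤ k + 1),
          List.take_of_length_le (by omega : (l a).length ≤ k),
          List.take_of_length_le (by omega : (l a).length ≤ k + 1)]
        rfl
  have hsome : PolySpace (fun o : Option InstanceSymbol => o.isSome) := symbolFun _
  have : PolySpace (fun a => (fun y => step (a, y))^[_root_.wordNumber (l a)] (l a, x a)) := by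
    refine iterate hn (by fun_prop) ?_ (p + q) fun a k hk => ?_
    · refine .prodMk (by fun_prop) (.cond ?_ (by fun_prop) (by fun_prop))
      exact hsome.comp (g := fun o : Option InstanceSymbol => o.isSome) (by fun_prop)
    · rw [hstep, registerSize_prod]
      have h1 := hq a _ ((l a).take_prefix k)
      have h2 := hp a
      have h3 := Nat.size_le_size (wordNumber_drop_le (l a) k)
      rw [registerSize_word] at h2 ⊢
      simp only [Polynomial.eval_add]
      omega
  convert this.snd using 2 with a
  rw [hstep, List.take_of_length_le (length_le_wordNumber _)]

@[fun_prop]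
theorem length : PolySpace (fun l : List InstanceSymbol => l.length) := by
  have e : ∀ (l : List InstanceSymbol) (n : ℕ), l.foldl (fun y _ => y + 1) n = n + l.length := by
    intro l
    induction l with
    | nil => simp
    | cons s l ih => intro n; rw [List.foldl_cons, ih, List.length_cons]; ring
  have := foldl (l := fun l : List InstanceSymbol => l) (x := fun _ => (0 : ℕ))
    (f := fun z => z.2.1 + 1) (by fun_prop) (by fun_prop) (by fun_prop) Polynomial.X
    fun l l' h => by
      rw [e, registerSize_nat, registerSize_word, Polynomial.eval_X, zero_add]
      exact (Nat.size_le_self _).trans (h.length_le.trans (length_le_size_wordNumber l))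
  simpa [e] using this

@[fun_prop]
theorem drop {l : α → List InstanceSymbol} {n : α → ℕ} (hl : PolySpace l) (hn : PolySpace n) :
    PolySpace (fun a => (l a).drop (n a)) := by
  have e : ∀ (n : ℕ) (l : List InstanceSymbol), (fun l => l.tail)^[n] l = l.drop n := by
    intro n
    induction n with
    | zero => simp
    | succ n ih => intro l; rw [Function.iterate_succ_apply, ih, List.drop_tail]
  have := iterate (n := fun z : List InstanceSymbol × ℕ => z.2) (x := fun z => z.1)
    (f := fun z => z.2.tail) (by fun_prop) (by fun_prop) (by fun_prop) Polynomial.X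
    fun z k hk => by
      change registerSize ((fun l : List InstanceSymbol => l.tail)^[k] z.1) ≤ _
      rw [e, registerSize_word, registerSize_prod, registerSize_word, Polynomial.eval_X]
      exact (Nat.size_le_size (wordNumber_drop_le _ _)).trans (Nat.le_add_right _ _)
  have h2 : PolySpace (fun z : List InstanceSymbol × ℕ => z.1.drop z.2) := by
    simpa [e] using this
  exact h2.comp (hl.prodMk hn)

@[fun_prop]
theorem getElem? {l : α → List InstanceSymbol} {n : α → ℕ} (hl : PolySpace l) (hn : PolySpace n) :
    PolySpace (fun a => (l a)[n a]?) := by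
  have : PolySpace (fun a => ((l a).drop (n a)).head?) := head?.comp (drop hl hn)
  simpa using this

end PolySpace

/-! ### Reading numbers and terms -/

/-- Reads one more binary digit; the state consists of the weight of the next digit and the value
of the digits so far. Any other symbol ends the number, by setting the weight to zero. -/
def readDigit (y : ℕ × ℕ) : Option InstanceSymbol → ℕ × ℕ
  | some (.bit b) => (2 * y.1, y.2 + b.toNat * y.1)
  | _ => (0, y.2)

/-- The number that is written at the beginning of a word. -/
def readNatural (l : List InstanceSymbol) : ℕ :=
  (l.foldl (fun y s => readDigit y (some s)) (1, 0)).2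

theorem foldl_readDigit_zero (l : List InstanceSymbol) (a : ℕ) :
    l.foldl (fun y s => readDigit y (some s)) (0, a) = (0, a) := by
  induction l with
  | nil => rfl
  | cons s l ih => cases s <;> simpa [readDigit] using ih

theorem foldl_readDigit_bits (n w a : ℕ) :
    (n.bits.map InstanceSymbol.bit).foldl (fun y s => readDigit y (some s)) (w, a) =
      (w * 2 ^ n.bits.length, a + n * w) := by
  induction n using Nat.binaryRec' generalizing w a with
  | zero => simp
  | bit b n hb ih =>
    rw [Nat.bits_append_bit _ _ hb, List.map_cons, List.foldl_cons, readDigit, ih, List.length_cons,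
      Nat.bit_val]
    ext
    · simp only [pow_succ]; ring
    · simp only; ring

theorem readNatural_encodeNatural (n : ℕ) (l : List InstanceSymbol) :
    readNatural (encodeNatural n ++ l) = n := by
  rw [readNatural, encodeNatural, List.append_assoc, List.foldl_append, foldl_readDigit_bits,
    List.singleton_append, List.foldl_cons, readDigit, foldl_readDigit_zero]
  · simp
  · simp

theorem foldl_readDigit_le (l : List InstanceSymbol) (w a : ℕ) :
    (l.foldl (fun y s => readDigit y (some s)) (w, a)).1 ≤ w * 2 ^ l.length ∧
      (l.foldl (fun y s => readDigit y (some s)) (w, a)).2 + w ≤ a + w * 2 ^ l.length := by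
  induction l generalizing w a with
  | nil => simp
  | cons s l ih =>
    have key : ∀ b : Bool, readDigit (w, a) (some (.bit b)) = (2 * w, a + b.toNat * w) :=
      fun _ => rfl
    by_cases hs : ∃ b, s = .bit b
    · obtain ⟨b, rfl⟩ := hs
      rw [List.foldl_cons, key, List.length_cons, pow_succ]
      obtain ⟨h1, h2⟩ := ih (2 * w) (a + b.toNat * w)
      have : b.toNat * w ≤ w := by cases b <;> simp
      constructor
      · linarith
      · linarith
    · have : readDigit (w, a) (some s) = (0, a) := by cases s <;> simp_all [readDigit]
      rw [List.foldl_cons, this, foldl_readDigit_zero]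
      have := Nat.one_le_two_pow (n := (s :: l).length)
      exact ⟨by simp, by simp only; nlinarith⟩

/-- The number of arguments of a symbol in prefix notation; the digits and the sign of a number
count as unary. -/
def arity : Option InstanceSymbol → ℕ
  | some (.bit _) | some .neg | some .char | some .star | some .omega => 1
  | some .plus | some .comp | some .concat | some .union => 2
  | _ => 0

/-- Reads one more symbol of a word in prefix notation; the state consists of the number of terms
that are yet to be read and the number of symbols that have been read. -/
def readTermSymbol (y : ℕ × ℕ) (s : Option InstanceSymbol) : ℕ × ℕ :=
  bif Nat.beq y.1 0 then y else (y.1 - 1 + arity s, y.2 + 1)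

/-- The length of the term in prefix notation at the beginning of a word. -/
def termLength (l : List InstanceSymbol) : ℕ :=
  (l.foldl (fun y s => readTermSymbol y (some s)) (1, 0)).2

/-- The word `t` is a term in prefix notation. -/
def IsTerm (t : List InstanceSymbol) : Prop :=
  ∀ k c, t.foldl (fun y s => readTermSymbol y (some s)) (k + 1, c) = (k, c + t.length)

theorem foldl_readTermSymbol_zero (l : List InstanceSymbol) (c : ℕ) :
    l.foldl (fun y s => readTermSymbol y (some s)) (0, c) = (0, c) := by
  induction l with
  | nil => rfl
  | cons s l ih => exact ih

theorem IsTerm.termLength_append {t : List InstanceSymbol} (ht : IsTerm t) (l) :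
    termLength (t ++ l) = t.length := by
  rw [termLength, List.foldl_append, ht, foldl_readTermSymbol_zero, zero_add]

theorem IsTerm.nullary {s : InstanceSymbol} (hs : arity (some s) = 0) : IsTerm [s] := by
  intro k c
  simp [readTermSymbol, hs, Nat.beq]

theorem IsTerm.unary {s : InstanceSymbol} (hs : arity (some s) = 1) {t} (ht : IsTerm t) :
    IsTerm (s :: t) := by
  intro k c
  have : readTermSymbol (k + 1, c) (some s) = (k + 1, c + 1) := by
    simp [readTermSymbol, hs, Nat.beq]
  rw [List.foldl_cons, this, ht, List.length_cons]
  congr 1; omega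

theorem IsTerm.binary {s : InstanceSymbol} (hs : arity (some s) = 2) {t t'} (ht : IsTerm t)
    (ht' : IsTerm t') : IsTerm (s :: (t ++ t')) := by
  intro k c
  have : readTermSymbol (k + 1, c) (some s) = (k + 1 + 1, c + 1) := by
    simp [readTermSymbol, hs, Nat.beq]
  rw [List.foldl_cons, this, List.foldl_append, ht, ht', List.length_cons, List.length_append]
  congr 1; omega

theorem isTerm_encodeNatural (n : ℕ) : IsTerm (encodeNatural n) := by
  rw [encodeNatural]
  induction n.bits with
  | nil => exact .nullary rfl
  | cons b l ih => exact .unary rfl ih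

theorem isTerm_encodeInteger (c : ℤ) : IsTerm (encodeInteger c) := by
  rw [encodeInteger]
  split_ifs
  · exact .unary rfl (isTerm_encodeNatural _)
  · exact isTerm_encodeNatural _

theorem isTerm_encode (U : RegularExpression ℕ) : IsTerm U.encode := by
  induction U with
  | zero | epsilon => exact .nullary rfl
  | char a => exact .unary rfl (isTerm_encodeNatural a)
  | plus P Q hP hQ | comp P Q hP hQ => exact .binary rfl hP hQ
  | star P hP => exact .unary rfl hP

theorem isTerm_omegaEncode (e : OmegaRegularExpression ℕ) : IsTerm e.encode := by
  induction e with
  | omega U => exact .unary rfl (isTerm_encode U)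
  | concat U e he => exact .binary rfl (isTerm_encode U) he
  | union e e' he he' => exact .binary rfl he he'

theorem foldl_readTermSymbol_le (l : List InstanceSymbol) (k c : ℕ) :
    (l.foldl (fun y s => readTermSymbol y (some s)) (k, c)).1 ≤ k + l.length ∧
      (l.foldl (fun y s => readTermSymbol y (some s)) (k, c)).2 ≤ c + l.length := by
  induction l generalizing k c with
  | nil => simp
  | cons s l ih =>
    have h : (readTermSymbol (k, c) (some s)).1 ≤ k + 1 ∧
        (readTermSymbol (k, c) (some s)).2 ≤ c + 1 := by
      rcases k with _ | k
      · simp [readTermSymbol]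
      · have : arity (some s) ≤ 2 := by cases s <;> simp [arity]
        simp [readTermSymbol, Nat.beq]; omega
    obtain ⟨h1, h2⟩ := ih (readTermSymbol (k, c) (some s)).1 (readTermSymbol (k, c) (some s)).2
    rw [List.foldl_cons, List.length_cons]
    exact ⟨h1.trans (by omega), h2.trans (by omega)⟩

/-- Whether a symbol is one of the symbols with which an ω-regular expression begins. -/
def isOmegaSymbol : Option InstanceSymbol → Bool
  | some .omega | some .concat | some .union => true
  | _ => false

/-- The length of the longest prefix without symbols of ω-regular expressions. -/
def prefixLength (l : List InstanceSymbol) : ℕ :=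
  (l.foldl (fun (y : Bool × ℕ) s =>
    bif y.1 || isOmegaSymbol (some s) then (true, y.2) else (false, y.2 + 1)) (false, 0)).2

theorem foldl_prefixLength_le (l : List InstanceSymbol) (y : Bool × ℕ) :
    (l.foldl (fun (y : Bool × ℕ) s =>
      bif y.1 || isOmegaSymbol (some s) then (true, y.2) else (false, y.2 + 1)) y).2 ≤
        y.2 + l.length := by
  induction l generalizing y with
  | nil => simp
  | cons s l ih =>
    rw [List.foldl_cons, List.length_cons]
    refine (ih _).trans ?_
    cases y.1 || isOmegaSymbol (some s)
    · simp only [cond_false]; omega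
    · simp only [cond_true]; omega

theorem prefixLength_append {l l' : List InstanceSymbol}
    (hl : ∀ s ∈ l, isOmegaSymbol (some s) = false) (hl' : ∀ s ∈ l'.head?, isOmegaSymbol (some s)) :
    prefixLength (l ++ l') = l.length := by
  have h1 : ∀ n, l.foldl (fun (y : Bool × ℕ) s => bif y.1 || isOmegaSymbol (some s) then (true, y.2)
      else (false, y.2 + 1)) (false, n) = (false, n + l.length) := by
    induction l with
    | nil => simp
    | cons s l ih =>
      intro n
      rw [List.foldl_cons, hl s (by simp)]
      simp only [Bool.or_self, cond_false]
      rw [ih fun s hs => hl s (by simp [hs]), List.length_cons]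
      congr 1; omega
  have h2 : ∀ (l : List InstanceSymbol) n, l.foldl (fun (y : Bool × ℕ) s =>
      bif y.1 || isOmegaSymbol (some s) then (true, y.2) else (false, y.2 + 1)) (true, n) =
        (true, n) := by
    intro l n
    induction l with
    | nil => rfl
    | cons s l ih => simpa using ih
  rw [prefixLength, List.foldl_append, h1]
  cases l' with
  | nil => simp
  | cons s l' =>
    rw [List.foldl_cons, hl' s (by simp)]
    simp only [Bool.or_true, cond_true]
    rw [h2]; simp

namespace PolySpace

@[fun_prop]
theorem readNatural : PolySpace readNatural := by
  refine snd (foldl (l := fun l : List InstanceSymbol => l) (x := fun _ => ((1 : ℕ), (0 : ℕ)))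
    (f := fun z => readDigit z.2.1 z.2.2) (by fun_prop) (by fun_prop) ?_ (2 * Polynomial.X + 2)
    fun l l' h => ?_)
  · refine symbolCases (o := fun z : List InstanceSymbol × (ℕ × ℕ) × Option InstanceSymbol => z.2.2)
      (F := fun s z => readDigit z.2.1 s) (by fun_prop) fun s => ?_
    rcases s with _ | s
    · simp only [readDigit]; fun_prop
    · cases s <;> simp only [readDigit] <;> fun_prop
  · obtain ⟨h1, h2⟩ := foldl_readDigit_le l' 1 0
    rw [one_mul] at h1 h2
    rw [zero_add] at h2
    have h3 := h.length_le.trans (length_le_size_wordNumber l)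
    have h4 := Nat.size_le_size h1
    have h5 := Nat.size_le_size (Nat.le_of_succ_le h2)
    rw [Nat.size_pow] at h4 h5
    simp only [registerSize_prod, registerSize_nat, registerSize_word, Polynomial.eval_add,
      Polynomial.eval_mul, Polynomial.eval_X, Polynomial.eval_ofNat]
    omega

@[fun_prop]
theorem termLength : PolySpace termLength := by
  have h := symbolFun arity
  refine snd (foldl (l := fun l : List InstanceSymbol => l) (x := fun _ => ((1 : ℕ), (0 : ℕ)))
    (f := fun z => readTermSymbol z.2.1 z.2.2) (by fun_prop) (by fun_prop)
    (by unfold readTermSymbol; fun_prop) (2 * Polynomial.X + 1) fun l l' h => ?_)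
  obtain ⟨h1, h2⟩ := foldl_readTermSymbol_le l' 1 0
  have h3 := h.length_le.trans (length_le_size_wordNumber l)
  have h4 := (Nat.size_le_self _).trans h1
  have h5 := (Nat.size_le_self _).trans h2
  simp only [registerSize_prod, registerSize_nat, registerSize_word, Polynomial.eval_add,
    Polynomial.eval_mul, Polynomial.eval_X, Polynomial.eval_ofNat, Polynomial.eval_one]
  omega

@[fun_prop]
theorem prefixLength : PolySpace prefixLength := by
  have h := symbolFun isOmegaSymbol
  refine snd (foldl (l := fun l : List InstanceSymbol => l) (x := fun _ => (false, (0 : ℕ)))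
    (f := fun z => bif z.2.1.1 || isOmegaSymbol z.2.2 then (true, z.2.1.2)
      else (false, z.2.1.2 + 1)) (by fun_prop) (by fun_prop)
    (by fun_prop) (Polynomial.X + 1) fun l l' h => ?_)
  have h2 := foldl_prefixLength_le l' (false, 0)
  have h3 := h.length_le.trans (length_le_size_wordNumber l)
  have h5 := (Nat.size_le_self _).trans h2
  have h6 := registerSize_bool (l'.foldl (fun (y : Bool × ℕ) s =>
      bif y.1 || isOmegaSymbol (some s) then (true, y.2) else (false, y.2 + 1)) (false, 0)).1
  simp only [registerSize_prod, registerSize_nat, registerSize_word, Polynomial.eval_add,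
    Polynomial.eval_X, Polynomial.eval_one]
  omega

end PolySpace

/-! ### Alternation in polynomial space -/

/-- The value of the node `J` of a tree of NOR gates in which every inner node `J` has the children
`J * M, …, J * M + (M - 1)`; here `k` is the height of the node above the leaves. -/
def norTree (leaf : ℕ → Bool) (M : ℕ) : ℕ → ℕ → Bool
  | 0, J => leaf J
  | k + 1, J => decide (∀ z < M, norTree leaf M k (J * M + z) = false)

/-- The value, with `k` moves left, of the position `x` of a game in which the two players take
turns, a move is a number `z < M`, and a player wins if some move leads to a position that is lost
for the opponent; here `true` means a loss for the player whose turn it is. -/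
def gameLost {γ : Type} (next : γ × ℕ → γ) (final : γ → Bool) (M : ℕ) : ℕ → γ → Bool
  | 0, x => final x
  | k + 1, x => decide (∀ z < M, gameLost next final M k (next (x, z)) = false)

/-- The position after `n` moves, which are the digits of `J` to base `M`. -/
def gamePath {γ : Type} (next : γ × ℕ → γ) (M J : ℕ) : ℕ → γ → γ
  | 0, x => x
  | n + 1, x => gamePath next M J n (next (x, J / M ^ n % M))

theorem gamePath_succ {γ : Type} (next : γ × ℕ → γ) (M J z h : ℕ) (hz : z < M) (x : γ) :
    gamePath next M (J * M + z) (h + 1) x = next (gamePath next M J h x, z) := by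
  have hM : 0 < M := by omega
  have hdiv : (J * M + z) / M = J := by
    rw [mul_comm, Nat.mul_add_div hM, Nat.div_eq_of_lt hz, add_zero]
  induction h generalizing x with
  | zero => simp [gamePath, mul_comm J, Nat.mod_eq_of_lt hz]
  | succ h ih =>
    rw [gamePath, ih, pow_succ', ← Nat.div_div_eq_div_mul, hdiv]
    rfl

/-- A game is the tree of NOR gates whose nodes are the sequences of moves, read as numbers. -/
theorem norTree_gamePath {γ : Type} (next : γ × ℕ → γ) (final : γ → Bool) (M : ℕ) (x : γ)
    (k h J : ℕ) :
    norTree (fun J => final (gamePath next M J (h + k) x)) M k J =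
      gameLost next final M k (gamePath next M J h x) := by
  induction k generalizing h J with
  | zero => rfl
  | succ k ih =>
    rw [norTree, gameLost, decide_eq_decide]
    refine forall₂_congr fun z hz => ?_
    rw [← gamePath_succ next M J z h hz, ← ih, add_assoc, add_comm 1 k]

/-- One step of the evaluation of a tree of NOR gates of height `K` by depth-first search. The state
consists of a flag that is reset at the end, the parameter, a mode, and the node that is being
visited, given by its height and its number. In the modes `0` and `1` the node has this value, and
in mode `2` it is about to be evaluated. -/
def norStep {α : Type} (leaf : α × ℕ → Bool) (M K : α → ℕ) (y : ℕ × α × ℕ × ℕ × ℕ) :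
    ℕ × α × ℕ × ℕ × ℕ :=
  bif Nat.beq y.2.2.1 2 then
    bif Nat.beq y.2.2.2.1 0 then (1, y.2.1, (leaf (y.2.1, y.2.2.2.2)).toNat, 0, y.2.2.2.2)
    else (1, y.2.1, 2, y.2.2.2.1 - 1, y.2.2.2.2 * M y.2.1)
  else bif Nat.beq y.2.2.2.1 (K y.2.1) then (0, y.2)
  else bif Nat.beq y.2.2.1 1 then (1, y.2.1, 0, y.2.2.2.1 + 1, y.2.2.2.2 / M y.2.1)
  else bif Nat.beq (y.2.2.2.2 % M y.2.1 + 1) (M y.2.1) then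
    (1, y.2.1, 1, y.2.2.2.1 + 1, y.2.2.2.2 / M y.2.1)
  else (1, y.2.1, 2, y.2.2.2.1, y.2.2.2.2 + 1)

/-- A step of the depth-first search that does not leave the tree. -/
def NorStep {α : Type} (leaf : α × ℕ → Bool) (M K : α → ℕ) (a : α) (y z : ℕ × α × ℕ × ℕ × ℕ) :
    Prop :=
  y.1 ≠ 0 ∧ z = norStep leaf M K y ∧
    z.1 ≤ 1 ∧ z.2.1 = a ∧ z.2.2.1 ≤ 2 ∧ z.2.2.2.1 ≤ K a ∧ z.2.2.2.2 < M a ^ K a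

theorem Nat.beq_false_of_ne {a b : ℕ} (h : a ≠ b) : Nat.beq a b = false := by
  rw [Bool.eq_false_iff]; simpa [Nat.beq_eq] using h

theorem Nat.beq_self (a : ℕ) : Nat.beq a a = true := by
  simp

/-- The depth-first search evaluates the tree below a node and returns to that node. -/
theorem reflTransGen_norStep {α : Type} (leaf : α × ℕ → Bool) (M K : α → ℕ) (a : α)
    (hM : 0 < M a) (k h J : ℕ) (hk : h + k = K a) (hJ : J < M a ^ h) :
    Relation.ReflTransGen (NorStep leaf M K a) (1, a, 2, k, J)
      (1, a, (norTree (fun J => leaf (a, J)) (M a) k J).toNat, k, J) := by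
  have hlt : ∀ {h J : ℕ}, h ≤ K a → J < M a ^ h → J < M a ^ K a := fun h1 h2 =>
    h2.trans_le (Nat.pow_le_pow_right hM h1)
  induction k generalizing h J with
  | zero =>
    refine .single ⟨one_ne_zero, rfl, ?_⟩
    have := Bool.toNat_le (leaf (a, J))
    exact ⟨le_rfl, rfl, this.trans one_le_two, Nat.zero_le _, hlt (by omega) hJ⟩
  | succ k ih =>
    have hchild : ∀ {z}, z < M a → J * M a + z < M a ^ (h + 1) := fun {z} hz => by
      rw [pow_succ]
      calc J * M a + z < J * M a + M a := by omega
        _ = (J + 1) * M a := by ring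
        _ ≤ M a ^ h * M a := Nat.mul_le_mul_right _ hJ
    have hKk : k ≠ K a := by omega
    have hdiv : ∀ {z}, z < M a → (J * M a + z) / M a = J := fun {z} hz => by
      rw [mul_comm, Nat.mul_add_div hM, Nat.div_eq_of_lt hz, add_zero]
    have hmod : ∀ {z}, z < M a → (J * M a + z) % M a = z := fun {z} hz => by
      rw [mul_comm, Nat.mul_add_mod, Nat.mod_eq_of_lt hz]
    have hJK : J < M a ^ K a := hlt (by omega) hJ
    -- the evaluation of the children from `z` on
    have key : ∀ n z, z + n + 1 = M a →
        (∀ z' < z, norTree (fun J => leaf (a, J)) (M a) k (J * M a + z') = false) →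
        Relation.ReflTransGen (NorStep leaf M K a) (1, a, 2, k, J * M a + z)
          (1, a, (norTree (fun J => leaf (a, J)) (M a) (k + 1) J).toNat, k + 1, J) := by
      intro n
      induction n with
      | zero =>
        intro z hz hprev
        refine (ih (h + 1) _ (by omega) (hchild (by omega))).tail ?_
        cases hv : norTree (fun J => leaf (a, J)) (M a) k (J * M a + z)
        · have : norTree (fun J => leaf (a, J)) (M a) (k + 1) J = true := by
            rw [norTree, decide_eq_true_iff]
            intro z' hz'
            rcases Nat.lt_or_ge z' z with h | h
            · exact hprev z' h
            · rwa [show z' = z by omega]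
          rw [this]
          refine ⟨one_ne_zero, ?_, le_rfl, rfl, one_le_two, by simp only; omega, hJK⟩
          simp [norStep, hdiv (show z < M a by omega), hmod (show z < M a by omega), Nat.beq,
            Nat.beq_false_of_ne hKk, show z + 1 = M a by omega]
        · have : norTree (fun J => leaf (a, J)) (M a) (k + 1) J = false := by
            rw [norTree, decide_eq_false_iff_not]
            intro h
            rw [h z (by omega)] at hv
            exact Bool.noConfusion hv
          rw [this]
          refine ⟨one_ne_zero, ?_, le_rfl, rfl, Nat.zero_le _, by simp only; omega, hJK⟩
          simp [norStep, hdiv (show z < M a by omega), Nat.beq, Nat.beq_false_of_ne hKk]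
      | succ n ihn =>
        intro z hz hprev
        refine (ih (h + 1) _ (by omega) (hchild (by omega))).trans ?_
        cases hv : norTree (fun J => leaf (a, J)) (M a) k (J * M a + z)
        · refine .head ?_ (ihn (z + 1) (by omega) fun z' hz' => ?_)
          · refine ⟨one_ne_zero, ?_, le_rfl, rfl, le_rfl, by simp only; omega,
              hlt (by omega) (hchild (by omega))⟩
            simp [norStep, hmod (show z < M a by omega), Nat.beq,
              Nat.beq_false_of_ne hKk, Nat.beq_false_of_ne (show z + 1 ≠ M a by omega), add_assoc]
          · rcases Nat.lt_or_ge z' z with h | h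
            · exact hprev z' h
            · rwa [show z' = z by omega]
        · have : norTree (fun J => leaf (a, J)) (M a) (k + 1) J = false := by
            rw [norTree, decide_eq_false_iff_not]
            intro h
            rw [h z (by omega)] at hv
            exact Bool.noConfusion hv
          rw [this]
          refine .single ⟨one_ne_zero, ?_, le_rfl, rfl, Nat.zero_le _, by simp only; omega, hJK⟩
          simp [norStep, hdiv (show z < M a by omega), Nat.beq, Nat.beq_false_of_ne hKk]
    refine .head ?_ (key (M a - 1) 0 (by omega) (by simp))
    refine ⟨one_ne_zero, ?_, le_rfl, rfl, le_rfl, by simp only; omega,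
      hlt (by omega) (hchild (by omega))⟩
    simp [norStep, Nat.beq]

namespace PolySpace

variable {α β γ : Type} [RegisterData α] [RegisterData β] [RegisterData γ]

@[fun_prop]
theorem toNat {b : α → Bool} (hb : PolySpace b) : PolySpace (fun x => (b x).toNat) :=
  hb.of_registers_eq fun _ => rfl

/-- Trees of NOR gates, and hence alternations of polynomially many quantifiers, can be evaluated
in polynomial space. -/
theorem norTree {leaf : α × ℕ → Bool} {M K : α → ℕ} (hleaf : PolySpace leaf) (hM : PolySpace M)
    (hK : PolySpace K) (hpos : ∀ a, 0 < M a) (q : Polynomial ℕ)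
    (hq : ∀ a, (M a ^ K a).size ≤ q.eval (registerSize a)) :
    PolySpace (fun a => norTree (fun J => leaf (a, J)) (M a) (K a) 0) := by
  obtain ⟨p, hp⟩ := hK.exists_registerSize_le
  have : PolySpace (fun a => ((0 : ℕ), a,
      (_root_.norTree (fun J => leaf (a, J)) (M a) (K a) 0).toNat, K a, (0 : ℕ))) := by
    refine loop (f := norStep leaf M K) (init := fun a => (1, a, 2, K a, 0))
      (by unfold norStep; fun_prop) (by fun_prop) (Polynomial.X + p + q + 3) fun a => ⟨?_, rfl⟩
    have h1 := (reflTransGen_norStep leaf M K a (hpos a) (K a) 0 0 (zero_add _) (by simp)).tail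
      (c := (0, a, (_root_.norTree (fun J => leaf (a, J)) (M a) (K a) 0).toNat, K a, 0)) (by
        have hle := Bool.toNat_le (_root_.norTree (fun J => leaf (a, J)) (M a) (K a) 0)
        refine ⟨one_ne_zero, ?_, zero_le_one, rfl, hle.trans one_le_two, le_rfl,
          Nat.pow_pos (hpos a)⟩
        simp only [norStep]
        rw [Nat.beq_false_of_ne (by omega), Nat.beq_self]
        rfl)
    refine Relation.ReflTransGen.mono (fun y z hyz => ?_) _ _ h1
    obtain ⟨hy, hz, z1, z2, z3, z4, z5⟩ := hyz
    refine ⟨hy, hz, ?_⟩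
    have s1 := Nat.size_le_size z1
    have s3 := Nat.size_le_size z3
    have s4 := Nat.size_le_size z4
    have s5 := (Nat.size_le_size z5.le).trans (hq a)
    have s6 := hp a
    rw [registerSize_nat] at s6
    have e2 : Nat.size 2 = 2 := by decide
    have e1 : Nat.size 1 = 1 := by decide
    simp only [registerSize_prod, registerSize_nat, z2, Polynomial.eval_add, Polynomial.eval_X,
      Polynomial.eval_ofNat]
    omega
  have h2 : PolySpace (fun a => (_root_.norTree (fun J => leaf (a, J)) (M a) (K a) 0).toNat) :=
    this.snd.snd.fst
  exact h2.of_registers_eq fun _ => rfl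

/-- Games with polynomially many moves can be decided in polynomial space, if the positions have
polynomial length; `Legal a` holds for the positions that can occur in the game `a`. -/
theorem gameLost {next : α × γ × ℕ → γ} {final : α × γ → Bool} {M K : α → ℕ} {x : α → γ}
    (hnext : PolySpace next) (hfinal : PolySpace final) (hM : PolySpace M) (hK : PolySpace K)
    (hx : PolySpace x) (hpos : ∀ a, 0 < M a) (q : Polynomial ℕ)
    (hq : ∀ a, (M a ^ K a).size ≤ q.eval (registerSize a))
    (Legal : α → γ → Prop) (h0 : ∀ a, Legal a (x a))
    (h1 : ∀ a y z, Legal a y → z < M a → Legal a (next (a, y, z)))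
    (h2 : ∀ a y, Legal a y → registerSize y ≤ q.eval (registerSize a)) :
    PolySpace (fun a =>
      gameLost (fun y => next (a, y)) (fun y => final (a, y)) (M a) (K a) (x a)) := by
  have hpow : PolySpace (fun a => M a ^ K a) := pow hM hK q hq
  let step : (α × ℕ) × ℕ × γ → ℕ × γ := fun v =>
    (v.2.1 / M v.1.1, next (v.1.1, v.2.2, v.1.2 / (v.2.1 / M v.1.1) % M v.1.1))
  have hstep : ∀ a J n y, ((fun y => step ((a, J), y))^[n] (M a ^ n, y)).2 =
      gamePath (fun y => next (a, y)) (M a) J n y := by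
    intro a J n
    induction n with
    | zero => intro y; rfl
    | succ n ih =>
      intro y
      have : step ((a, J), M a ^ (n + 1), y) = (M a ^ n, next (a, y, J / M a ^ n % M a)) := by
        simp only [step, pow_succ, Nat.mul_div_cancel _ (hpos a)]
      rw [Function.iterate_succ_apply, this, ih]
      rfl
  have hlegal : ∀ a J k, ((fun y => step ((a, J), y))^[k] (M a ^ K a, x a)).1 ≤ M a ^ K a ∧
      Legal a ((fun y => step ((a, J), y))^[k] (M a ^ K a, x a)).2 := by
    intro a J k
    induction k with
    | zero => exact ⟨le_rfl, h0 a⟩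
    | succ k ih =>
      rw [Function.iterate_succ_apply']
      exact ⟨(Nat.div_le_self _ _).trans ih.1, h1 a _ _ ih.2 (Nat.mod_lt _ (hpos a))⟩
  have hpath : PolySpace (fun v : α × ℕ =>
      (fun y => step (v, y))^[K v.1] (M v.1 ^ K v.1, x v.1)) := by
    refine iterate (n := fun v : α × ℕ => K v.1) (by fun_prop)
      (.prodMk (hpow.comp (f := fun v : α × ℕ => v.1) (by fun_prop)) (by fun_prop))
      (by fun_prop) (2 * q) fun v k _ => ?_
    obtain ⟨l1, l2⟩ := hlegal v.1 v.2 k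
    have s1 := (Nat.size_le_size l1).trans (hq v.1)
    have s2 := h2 _ _ l2
    have s3 := q.eval_mono_nat (show registerSize v.1 ≤ registerSize v by simp)
    rw [registerSize_prod, registerSize_nat]
    simp only [Polynomial.eval_mul, Polynomial.eval_ofNat]
    change Nat.size ((fun y => step ((v.1, v.2), y))^[k] _).1 + registerSize
      ((fun y => step ((v.1, v.2), y))^[k] _).2 ≤ _
    omega
  have hleaf : PolySpace (fun v : α × ℕ => final (v.1,
      ((fun y => step (v, y))^[K v.1] (M v.1 ^ K v.1, x v.1)).2)) := by
    exact hfinal.comp (f := fun v : α × ℕ => (v.1, _)) (.prodMk (by fun_prop) hpath.snd)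
  have := norTree hleaf hM hK hpos q hq
  convert this using 2 with a
  simp only [hstep]
  have := norTree_gamePath (fun y => next (a, y)) (fun y => final (a, y)) (M a) (x a) (K a) 0 0
  rw [zero_add] at this
  rw [this]
  rfl

end PolySpace

/-! ### Walks in labelled graphs -/

/-- `Walk E x u y`: some walk from `x` to `y` in the graph with labelled edges `E` has the labels
`u`. -/
def Walk {V α : Type*} (E : V → α → V → Prop) : V → List α → V → Prop
  | x, [], y => x = y
  | x, a :: u, y => ∃ z, E x a z ∧ Walk E z u y

namespace Walk

variable {V W α β : Type*} {E : V → α → V → Prop}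

theorem append_iff {x y : V} {u v : List α} :
    Walk E x (u ++ v) y ↔ ∃ z, Walk E x u z ∧ Walk E z v y := by
  induction u generalizing x with
  | nil => simp [Walk]
  | cons a u ih =>
    simp only [List.cons_append, Walk, ih]
    constructor
    · rintro ⟨z, h, z', h1, h2⟩; exact ⟨z', ⟨z, h, h1⟩, h2⟩
    · rintro ⟨z', ⟨z, h, h1⟩, h2⟩; exact ⟨z, h, z', h1, h2⟩

theorem append {x y z : V} {u v : List α} (h : Walk E x u y) (h' : Walk E y v z) :
    Walk E x (u ++ v) z := append_iff.2 ⟨y, h, h'⟩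

theorem map {E' : W → β → W → Prop} (f : V → W) (g : α → β)
    (h : ∀ x a y, E x a y → E' (f x) (g a) (f y)) {x u y} (hw : Walk E x u y) :
    Walk E' (f x) (u.map g) (f y) := by
  induction u generalizing x with
  | nil => exact congrArg f hw
  | cons a u ih =>
    obtain ⟨z, h1, h2⟩ := hw
    exact ⟨f z, h _ _ _ h1, ih h2⟩

theorem of_sequence {ρ : ℕ → V} {w : Stream' α} (h : ∀ i, E (ρ i) (w.get i) (ρ (i + 1))) (i n : ℕ) :
    Walk E (ρ i) ((w.drop i).take n) (ρ (i + n)) := by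
  induction n generalizing i with
  | zero => exact rfl
  | succ n ih =>
    rw [Stream'.take_succ]
    refine ⟨ρ (i + 1), by simpa using h i, ?_⟩
    have := ih (i + 1)
    rw [Stream'.tail_drop', show i + (n + 1) = i + 1 + n by omega]
    exact this

/-- The part of a word between two positions. -/
def segment (u : List α) (i j : ℕ) : List α := (u.drop i).take (j - i)

theorem length_segment {u : List α} {i j : ℕ} (hj : j ≤ u.length) :
    (segment u i j).length = j - i := by
  rw [segment, List.length_take, List.length_drop]; omega

theorem segment_append {u : List α} {i j k : ℕ} (hij : i ≤ j) (hjk : j ≤ k) :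
    segment u i j ++ segment u j k = segment u i k := by
  rw [segment, segment, segment, show k - i = (j - i) + (k - j) by omega, List.take_add,
    List.drop_drop, show i + (j - i) = j by omega]

theorem exists_vertices {x y z : V} {u v : List α} (h : Walk E x u y) (h' : Walk E y v z) :
    ∃ ρ : ℕ → V, ρ 0 = x ∧ ρ u.length = y ∧ ρ (u.length + v.length) = z ∧
      ∀ i j, i ≤ j → j ≤ u.length + v.length → Walk E (ρ i) (segment (u ++ v) i j) (ρ j) := by
  have key : ∀ {x y' : V} {a : α} {n : ℕ} {t : List α}, E x a y' → ∀ ρ : ℕ → V, ρ 0 = y' →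
      (∀ i j, i ≤ j → j ≤ n → Walk E (ρ i) (segment t i j) (ρ j)) →
      ∀ i j, i ≤ j → j ≤ n + 1 → Walk E (Nat.casesOn (motive := fun _ => V) i x ρ)
        (segment (a :: t) i j) (Nat.casesOn (motive := fun _ => V) j x ρ) := by
    intro x y' a n t he ρ h0 hρ i j hij hj
    cases j with
    | zero => obtain rfl := Nat.le_zero.1 hij; exact rfl
    | succ j =>
      cases i with
      | zero =>
        refine ⟨ρ 0, h0 ▸ he, ?_⟩
        simpa [segment] using hρ 0 j (Nat.zero_le _) (by omega)
      | succ i =>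
        simpa [segment] using hρ i j (by omega) (by omega)
  induction u generalizing x with
  | nil =>
    obtain rfl : x = y := h
    suffices ∃ ρ : ℕ → V, ρ 0 = x ∧ ρ v.length = z ∧
        ∀ i j, i ≤ j → j ≤ v.length → Walk E (ρ i) (segment v i j) (ρ j) by
      obtain ⟨ρ, h1, h2, h3⟩ := this
      exact ⟨ρ, h1, h1, by simpa using h2, by simpa using h3⟩
    induction v generalizing x with
    | nil =>
      refine ⟨fun _ => x, rfl, h', fun i j hij hj => ?_⟩
      simp [segment, Walk]
    | cons a v ih =>
      obtain ⟨y', he, h'⟩ := h'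
      obtain ⟨ρ, h1, h2, h3⟩ := ih h'
      exact ⟨fun i => Nat.casesOn i x ρ, rfl, h2, key he ρ h1 h3⟩
  | cons a u ih =>
    obtain ⟨y', he, h⟩ := h
    obtain ⟨ρ, h1, h2, h3, h4⟩ := ih h
    refine ⟨fun i => Nat.casesOn i x ρ, rfl, h2, ?_, ?_⟩
    · rw [List.length_cons, Nat.add_right_comm]; exact h3
    · rw [List.length_cons, Nat.add_right_comm]; exact key he ρ h1 h4

theorem target_mem {F : Finset V} (hF : ∀ x a y, E x a y → y ∈ F) {x y : V} {u : List α}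
    (hu : u ≠ []) (h : Walk E x u y) : y ∈ F := by
  induction u generalizing x with
  | nil => exact absurd rfl hu
  | cons a u ih =>
    obtain ⟨z, he, h⟩ := h
    by_cases hu' : u = []
    · subst hu'; exact h ▸ hF _ _ _ he
    · exact ih hu' h

/-- A walk with more edges than there are targets of edges visits a vertex twice. -/
theorem exists_repetition {F : Finset V} (hF : ∀ x a y, E x a y → y ∈ F) {u : List α} {ρ : ℕ → V}
    (h : ∀ i j, i ≤ j → j ≤ u.length → Walk E (ρ i) (segment u i j) (ρ j)) {m : ℕ}
    (hm : m ≤ u.length) (hc : F.card < m) : ∃ i j, 1 ≤ i ∧ i < j ∧ j ≤ m ∧ ρ i = ρ j := by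
  classical
  obtain ⟨i, hi, j, hj, hij, he⟩ := Finset.exists_ne_map_eq_of_card_lt_of_maps_to
    (s := Finset.Icc 1 m) (t := F) (f := ρ) (by simpa using hc) (by
      intro i hi
      have hi := Finset.mem_Icc.1 (Finset.mem_coe.1 hi)
      refine target_mem hF ?_ (h 0 i (Nat.zero_le _) (by omega))
      intro h0
      have := length_segment (u := u) (i := 0) (j := i) (by omega)
      rw [h0] at this
      simp at this; omega)
  rw [Finset.mem_Icc] at hi hj
  rcases Nat.lt_or_gt_of_ne hij with hlt | hlt
  · exact ⟨i, j, hi.1, hlt, hj.2, he⟩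
  · exact ⟨j, i, hj.1, hlt, hi.2, he.symm⟩

/-- Cutting loops out of a walk leaves at most as many edges as there are targets of edges. -/
theorem exists_short {F : Finset V} (hF : ∀ x a y, E x a y → y ∈ F) {x y : V} {u : List α}
    (h : Walk E x u y) : ∃ u', u'.length ≤ F.card ∧ Walk E x u' y := by
  induction hn : u.length using Nat.strong_induction_on generalizing u with
  | _ n ih =>
    subst hn
    by_cases hc : u.length ≤ F.card
    · exact ⟨u, hc, h⟩
    obtain ⟨ρ, rfl, -, rfl, hρ⟩ := exists_vertices (v := []) h rfl
    simp only [List.append_nil, List.length_nil, Nat.add_zero] at hρ ⊢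
    obtain ⟨i, j, hi, hij, hj, he⟩ := exists_repetition hF hρ le_rfl (not_le.1 hc)
    refine ih _ ?_ ((hρ 0 i (by omega) (by omega)).append (he ▸ hρ j _ hj le_rfl)) rfl
    rw [List.length_append, length_segment (by omega), length_segment (by omega)]
    omega

/-- Among the lassos whose loop has a label in the set `S` there is a short one. A vertex that is
visited twice allows one to cut a loop out of the path, to cut out a part of the loop or to keep
that part alone, or, if one of the two visits is on the path and the other on the loop, to enter the
loop earlier. -/
theorem exists_short_lasso {F : Finset V} (hF : ∀ x a y, E x a y → y ∈ F) (S : Set α) {x y : V}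
    {u v : List α} (h : Walk E x u y) (h' : Walk E y v y) (hv : ∃ a ∈ v, a ∈ S) :
    ∃ y u' v', u'.length + v'.length ≤ F.card + 1 ∧ Walk E x u' y ∧ Walk E y v' y ∧
      ∃ a ∈ v', a ∈ S := by
  induction hn : u.length + v.length using Nat.strong_induction_on generalizing u v y with
  | _ n ih =>
    subst hn
    by_cases hc : u.length + v.length ≤ F.card + 1
    · exact ⟨y, u, v, hc, h, h', hv⟩
    obtain ⟨ρ, rfl, rfl, hT, hρ⟩ := exists_vertices h h'
    have hl : (u ++ v).length = u.length + v.length := List.length_append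
    obtain ⟨i, j, hi, hij, hj, he⟩ := exists_repetition (u := u ++ v) hF (hl ▸ hρ)
      (m := u.length + v.length - 1) (by omega) (by omega)
    have hseg : ∀ {k m}, m ≤ u.length + v.length → (segment (u ++ v) k m).length = m - k :=
      fun hm => length_segment (by omega)
    have hu : segment (u ++ v) 0 u.length = u := by simp [segment]
    have hv' : segment (u ++ v) u.length (u.length + v.length) = v := by simp [segment]
    rcases le_or_gt j u.length with hju | hju
    · refine ih _ ?_ ((hρ 0 i (by omega) (by omega)).append
        (he ▸ hρ j u.length hju (by omega))) h' hv rfl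
      rw [List.length_append, hseg (by omega), hseg (by omega)]
      omega
    rcases le_or_gt u.length i with hui | hui
    · rw [← hv', ← segment_append hui (by omega : i ≤ u.length + v.length),
        ← segment_append hij.le (by omega : j ≤ u.length + v.length)] at hv
      obtain ⟨a, ha, haS⟩ := hv
      rw [List.mem_append, List.mem_append] at ha
      by_cases hmid : a ∈ segment (u ++ v) i j
      · refine ih _ ?_ (hρ 0 i (by omega) (by omega))
          (v := segment (u ++ v) i j) ?_ ⟨a, hmid, haS⟩ rfl
        · rw [hseg (by omega), hseg (by omega)]
          omega
        · have := hρ i j hij.le (by omega)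
          rwa [← he] at this
      · refine ih _ ?_ h (v := segment (u ++ v) u.length i ++
          segment (u ++ v) j (u.length + v.length)) ?_ ⟨a, ?_, haS⟩ rfl
        · rw [List.length_append, hseg (by omega), hseg (by omega)]
          omega
        · have := hρ j _ (by omega) le_rfl
          rw [← he, hT] at this
          exact (hρ u.length i hui (by omega)).append this
        · rw [List.mem_append]; tauto
    · rw [← hv', ← segment_append hju.le (by omega : j ≤ u.length + v.length)] at hv
      obtain ⟨a, ha, haS⟩ := hv
      refine ih _ ?_ (hρ 0 i (by omega) (by omega)) (v := segment (u ++ v) j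
        (u.length + v.length) ++ segment (u ++ v) u.length j) ?_ ⟨a, ?_, haS⟩ rfl
      · rw [List.length_append, hseg (by omega), hseg (by omega), hseg (by omega)]
        omega
      · have h1 := hρ j _ (by omega) le_rfl
        have h2 := hρ u.length j (by omega) (by omega)
        rw [hT] at h1
        rw [he]
        exact h1.append h2
      · rw [List.mem_append] at ha ⊢; tauto

end Walk

/-! ### ω-regular expressions and lassos -/

section OmegaPower

variable {α : Type*} {U : Language α}

/-- A set of infinite words each of which is a nonempty word of `U` followed by a member of the set
is contained in `U^ω`. -/
theorem mem_omegaPower_of_forall (G : Set (Stream' α))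
    (hG : ∀ w ∈ G, ∃ x ∈ U, x ≠ [] ∧ ∃ w' ∈ G, w = x ++ₛ w') {w : Stream' α} (hw : w ∈ G) :
    w ∈ omegaPower U := by
  have : Nonempty (Stream' α) := ⟨w⟩
  choose! x hx hx0 f hf hwf using hG
  set W : ℕ → Stream' α := fun n => f^[n] w
  have hW : ∀ n, W n ∈ G := fun n => by
    induction n with
    | zero => exact hw
    | succ n ih => simpa only [W, Function.iterate_succ_apply'] using hf _ ih
  have hdrop : ∀ n, w.drop (∑ i ∈ Finset.range n, (x (W i)).length) = W n := fun n => by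
    induction n with
    | zero => simp [W]
    | succ n ih =>
      rw [Finset.sum_range_succ, ← Stream'.drop_drop, ih]
      have h := congrArg (Stream'.drop (x (W n)).length) (hwf _ (hW n))
      rw [Stream'.drop_append_stream] at h
      simpa only [W, Function.iterate_succ_apply'] using h
  refine ⟨fun n => ∑ i ∈ Finset.range n, (x (W i)).length, strictMono_nat_of_lt_succ fun n => ?_,
    by simp, fun n => ?_⟩
  · simp only [Finset.sum_range_succ]
    have := List.length_pos_of_ne_nil (hx0 _ (hW n))
    omega
  · rw [hdrop]
    simp only [Finset.sum_range_succ, Nat.add_sub_cancel_left]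
    have : (W n).take (x (W n)).length = x (W n) := by
      have h := congrArg (Stream'.take (x (W n)).length) (hwf _ (hW n))
      rwa [Stream'.take_append_of_le_length _ _ _ le_rfl, List.take_length] at h
    rw [this]
    exact hx _ (hW n)

theorem append_mem_kstar {u v : List α} (hu : u ∈ U) (hv : v ∈ KStar.kstar U) :
    u ++ v ∈ KStar.kstar U := by
  rw [← Language.one_add_self_mul_kstar_eq_kstar]
  exact Or.inr (Language.append_mem_mul hu hv)

theorem exists_append_of_mem_kstar {z : List α} (hz : z ∈ KStar.kstar U) (h0 : z ≠ []) :
    ∃ x ∈ U, x ≠ [] ∧ ∃ z' ∈ KStar.kstar U, z = x ++ z' := by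
  obtain ⟨S, rfl, hS⟩ := Language.mem_kstar_iff_exists_nonempty.1 hz
  cases S with
  | nil => exact absurd rfl h0
  | cons x S =>
    have hx := hS x (by simp)
    exact ⟨x, hx.1, hx.2, S.flatten,
      Language.join_mem_kstar fun y hy => (hS y (by simp [hy])).1, by simp⟩

theorem append_periodic_mem_omegaPower {z t : List α} {c : Stream' α} (hz : z ∈ KStar.kstar U)
    (ht : t ∈ KStar.kstar U) (h0 : t ≠ []) (hc : c = t ++ₛ c) : z ++ₛ c ∈ omegaPower U := by
  refine mem_omegaPower_of_forall {w | ∃ z ∈ KStar.kstar U, w = z ++ₛ c} ?_ ⟨z, hz, rfl⟩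
  rintro _ ⟨z, hz, rfl⟩
  by_cases hz0 : z = []
  · obtain ⟨x, hx, hx0, t', ht', rfl⟩ := exists_append_of_mem_kstar ht h0
    refine ⟨x, hx, hx0, _, ⟨t', ht', rfl⟩, ?_⟩
    rw [← Stream'.append_append_stream, ← hc, hz0, Stream'.nil_append_stream]
  · obtain ⟨x, hx, hx0, z', hz', rfl⟩ := exists_append_of_mem_kstar hz hz0
    exact ⟨x, hx, hx0, _, ⟨z', hz', rfl⟩, Stream'.append_append_stream _ _ _⟩

end OmegaPower

/-- A regular expression `U` has at most `|U|` partial derivatives, that is, there are languages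
`S`, at most `|U|` many, such that whatever remains to be read after a first letter of a word of
`U`, or of a word of a language in `S`, belongs to a language in `S`. -/
theorem RegularExpression.exists_residuals {α : Type*} (U : RegularExpression α) :
    ∃ S : List (Language α), S.length ≤ U.length ∧ ∀ L, (L = U.matches' ∨ L ∈ S) →
      ∀ a w, a :: w ∈ L → ∃ L' ∈ S, w ∈ L' ∧ ∀ w' ∈ L', a :: w' ∈ L := by
  induction U with
  | zero => exact ⟨[], by simp, fun L hL a w h => by
      simp at hL; subst hL; exact absurd h (Language.notMem_zero _)⟩
  | epsilon => exact ⟨[], by simp, fun L hL a w h => by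
      simp at hL; subst hL; simp [Language.mem_one] at h⟩
  | char b =>
    refine ⟨[1], by simp [length], fun L hL a w h => ?_⟩
    rcases hL with rfl | hL
    · refine ⟨1, by simp, ?_⟩
      obtain ⟨rfl, rfl⟩ : a = b ∧ w = [] := by
        simpa using (show a :: w ∈ ({[b]} : Set (List α)) from h)
      refine ⟨rfl, fun w' hw' => ?_⟩
      rw [Language.mem_one] at hw'
      subst hw'
      exact Set.mem_singleton _
    · simp at hL; subst hL; simp [Language.mem_one] at h
  | plus P Q ihP ihQ =>
    obtain ⟨S, hS, hS'⟩ := ihP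
    obtain ⟨T, hT, hT'⟩ := ihQ
    refine ⟨S ++ T, by simp [length]; omega, fun L hL a w h => ?_⟩
    rcases hL with rfl | hL
    · rcases h with h | h
      · obtain ⟨L', h1, h2, h3⟩ := hS' _ (Or.inl rfl) a w h
        exact ⟨L', by simp [h1], h2, fun w' hw' => Or.inl (h3 w' hw')⟩
      · obtain ⟨L', h1, h2, h3⟩ := hT' _ (Or.inl rfl) a w h
        exact ⟨L', by simp [h1], h2, fun w' hw' => Or.inr (h3 w' hw')⟩
    · rcases List.mem_append.1 hL with hL | hL
      · obtain ⟨L', h1, h2, h3⟩ := hS' _ (Or.inr hL) a w h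
        exact ⟨L', by simp [h1], h2, h3⟩
      · obtain ⟨L', h1, h2, h3⟩ := hT' _ (Or.inr hL) a w h
        exact ⟨L', by simp [h1], h2, h3⟩
  | comp P Q ihP ihQ =>
    obtain ⟨S, hS, hS'⟩ := ihP
    obtain ⟨T, hT, hT'⟩ := ihQ
    refine ⟨S.map (· * Q.matches') ++ T, by simp [length]; omega, fun L hL a w h => ?_⟩
    have key : ∀ L0, (L0 = P.matches' ∨ L0 ∈ S) → a :: w ∈ L0 * Q.matches' →
        ∃ L' ∈ S.map (· * Q.matches') ++ T, w ∈ L' ∧ ∀ w' ∈ L', a :: w' ∈ L0 * Q.matches' := by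
      intro L0 hL0 h
      obtain ⟨x, hx, y, hy, hxy⟩ := Language.mem_mul.1 h
      cases x with
      | nil =>
        obtain rfl : y = a :: w := by simpa using hxy
        obtain ⟨L', h1, h2, h3⟩ := hT' _ (Or.inl rfl) a w hy
        exact ⟨L', by simp [h1], h2, fun w' hw' => Language.append_mem_mul hx (h3 w' hw')⟩
      | cons b x =>
        obtain ⟨rfl, rfl⟩ : b = a ∧ x ++ y = w := by simpa using hxy
        obtain ⟨L', h1, h2, h3⟩ := hS' _ hL0 b x hx
        refine ⟨L' * Q.matches', by simp; exact Or.inl ⟨L', h1, rfl⟩,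
          Language.append_mem_mul h2 hy, ?_⟩
        intro w' hw'
        obtain ⟨x', hx', y', hy', rfl⟩ := Language.mem_mul.1 hw'
        exact Language.append_mem_mul (h3 x' hx') hy'
    rcases hL with rfl | hL
    · exact key _ (Or.inl rfl) h
    · rcases List.mem_append.1 hL with hL | hL
      · obtain ⟨L0, hL0, rfl⟩ := List.mem_map.1 hL
        exact key _ (Or.inr hL0) h
      · obtain ⟨L', h1, h2, h3⟩ := hT' _ (Or.inr hL) a w h
        exact ⟨L', by simp [h1], h2, h3⟩
  | star P ih =>
    obtain ⟨S, hS, hS'⟩ := ih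
    refine ⟨S.map (· * KStar.kstar P.matches'), by simp [length]; omega, fun L hL a w h => ?_⟩
    have key : ∀ L0, (L0 = P.matches' ∨ L0 ∈ S) → ∀ x y, a :: x ∈ L0 →
        y ∈ KStar.kstar P.matches' → ∃ L' ∈ S.map (· * KStar.kstar P.matches'), x ++ y ∈ L' ∧
          ∀ w' ∈ L', a :: w' ∈ L0 * KStar.kstar P.matches' := by
      intro L0 hL0 x y hx hy
      obtain ⟨L', h1, h2, h3⟩ := hS' _ hL0 a x hx
      refine ⟨_, List.mem_map.2 ⟨L', h1, rfl⟩, Language.append_mem_mul h2 hy, fun w' hw' => ?_⟩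
      obtain ⟨x', hx', y', hy', rfl⟩ := Language.mem_mul.1 hw'
      exact Language.append_mem_mul (h3 x' hx') hy'
    have key' : ∀ w, a :: w ∈ KStar.kstar P.matches' →
        ∃ L' ∈ S.map (· * KStar.kstar P.matches'), w ∈ L' ∧
          ∀ w' ∈ L', a :: w' ∈ KStar.kstar P.matches' := by
      intro w h
      obtain ⟨x, hx, hx0, y, hy, hxy⟩ := exists_append_of_mem_kstar h (by simp)
      cases x with
      | nil => exact absurd rfl hx0
      | cons b x =>
        obtain ⟨rfl, rfl⟩ : a = b ∧ w = x ++ y := by simpa using hxy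
        obtain ⟨L', h1, h2, h3⟩ := key _ (Or.inl rfl) x y hx hy
        refine ⟨L', h1, h2, fun w' hw' => ?_⟩
        obtain ⟨x', hx', y', hy', he⟩ := Language.mem_mul.1 (h3 w' hw')
        exact he ▸ append_mem_kstar hx' hy'
    rcases hL with rfl | hL
    · exact key' w h
    · obtain ⟨L0, hL0, rfl⟩ := List.mem_map.1 hL
      obtain ⟨x, hx, y, hy, hxy⟩ := Language.mem_mul.1 h
      cases x with
      | nil =>
        obtain rfl : y = a :: w := by simpa using hxy
        obtain ⟨L', h1, h2, h3⟩ := key' w hy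
        exact ⟨L', h1, h2, fun w' hw' => Language.append_mem_mul hx (h3 w' hw')⟩
      | cons b x =>
        obtain ⟨rfl, rfl⟩ : b = a ∧ x ++ y = w := by simpa using hxy
        exact key _ (Or.inr hL0) x y hx hy

section Short

variable {V α : Type*} {E : V → α → V → Prop}

/-- The product of a graph with the partial derivatives of a regular expression. -/
def residualEdge (E : V → α → V → Prop) (S : List (Language α)) (x : Language α × V) (a : α)
    (y : Language α × V) : Prop :=
  y.1 ∈ S ∧ E x.2 a y.2 ∧ ∀ w ∈ y.1, a :: w ∈ x.1

theorem append_mem_of_walk_residualEdge {S : List (Language α)} {x y : Language α × V}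
    {u w : List α}
    (h : Walk (residualEdge E S) x u y) (hw : w ∈ y.1) : u ++ w ∈ x.1 := by
  induction u generalizing x with
  | nil => obtain rfl : x = y := h; exact hw
  | cons a u ih =>
    obtain ⟨z, hz, h⟩ := h
    exact hz.2.2 _ (ih h)

theorem exists_walk_residualEdge {S : List (Language α)} {L : Language α} {x y : V} {u : List α}
    (hS : ∀ L', (L' = L ∨ L' ∈ S) → ∀ a w, a :: w ∈ L' →
      ∃ L'' ∈ S, w ∈ L'' ∧ ∀ w' ∈ L'', a :: w' ∈ L')
    (h : Walk E x u y) (hu : u ∈ L) : ∃ L', [] ∈ L' ∧ Walk (residualEdge E S) (L, x) u (L', y) := by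
  induction u generalizing x L with
  | nil => exact ⟨L, hu, congrArg (Prod.mk L) h⟩
  | cons a u ih =>
    obtain ⟨z, hz, h⟩ := h
    obtain ⟨L1, h1, h2, h3⟩ := hS L (Or.inl rfl) a u hu
    obtain ⟨L', h4, h5⟩ := ih (fun L' hL' => hS L' (Or.inr (hL'.elim (fun e => e ▸ h1) id))) h h2
    exact ⟨L', h4, _, ⟨h1, hz, h3⟩, h5⟩

theorem card_residuals_le [DecidableEq (Language α)] {S : List (Language α)} {n : ℕ}
    (hS : S.length ≤ n) (F : Finset V) : (S.toFinset ×ˢ F).card ≤ F.card * n := by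
  rw [Finset.card_product, mul_comm]
  exact Nat.mul_le_mul_left _ ((List.toFinset_card_le S).trans hS)

theorem RegularExpression.exists_short {F : Finset V} (hF : ∀ x a y, E x a y → y ∈ F)
    (U : RegularExpression α) {x y : V} {u : List α} (hu : u ∈ U.matches') (h : Walk E x u y) :
    ∃ u' ∈ U.matches', u'.length ≤ F.card * U.length ∧ Walk E x u' y := by
  classical
  obtain ⟨S, hS, hS'⟩ := U.exists_residuals
  obtain ⟨L, hL, hw⟩ := exists_walk_residualEdge hS' h hu
  obtain ⟨u', hu', hw'⟩ := Walk.exists_short (F := S.toFinset ×ˢ F)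
    (fun x a y h => Finset.mem_product.2 ⟨List.mem_toFinset.2 h.1, hF _ _ _ h.2.1⟩) hw
  refine ⟨u', ?_, hu'.trans (card_residuals_le hS F), ?_⟩
  · simpa using append_mem_of_walk_residualEdge hw' hL
  · simpa using hw'.map (E' := E) Prod.snd id fun x a y h => h.2.1

/-- The product of a graph with the partial derivatives of `U`, for reading words of `U*`. A letter
that starts a new word of `U` is marked with `true`. -/
def kstarEdge (E : V → α → V → Prop) (U : Language α) (S : List (Language α)) (x : Language α × V)
    (a : α × Bool) (y : Language α × V) : Prop :=
  y.1 ∈ S ∧ E x.2 a.1 y.2 ∧ (a.2 = false → ∀ w ∈ y.1, a.1 :: w ∈ x.1) ∧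
    (a.2 = true → [] ∈ x.1 ∧ ∀ w ∈ y.1, a.1 :: w ∈ U)

theorem append_mem_of_walk_kstarEdge {U : Language α} {S : List (Language α)} {x y : Language α × V}
    {u : List (α × Bool)} {w : List α} (h : Walk (kstarEdge E U S) x u y)
    (hw : w ∈ y.1 * KStar.kstar U) : u.map Prod.fst ++ w ∈ x.1 * KStar.kstar U := by
  induction u generalizing x with
  | nil => obtain rfl : x = y := h; exact hw
  | cons a u ih =>
    obtain ⟨z, ⟨-, -, h1, h2⟩, h⟩ := h
    obtain ⟨l, hl, r, hr, he⟩ := Language.mem_mul.1 (ih h)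
    rw [List.map_cons, List.cons_append, ← he]
    rcases hb : a.2 with _ | _
    · exact Language.append_mem_mul (h1 hb l hl) hr
    · exact Language.append_mem_mul (h2 hb).1 (append_mem_kstar ((h2 hb).2 l hl) hr)

theorem exists_walk_kstarEdge {U : RegularExpression α} {S : List (Language α)}
    (hS : ∀ L', (L' = U.matches' ∨ L' ∈ S) → ∀ a w, a :: w ∈ L' →
      ∃ L'' ∈ S, w ∈ L'' ∧ ∀ w' ∈ L'', a :: w' ∈ L')
    {x y : V} {u : List α} (hu : u ∈ KStar.kstar U.matches') (h0 : u ≠ []) (h : Walk E x u y) :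
    ∃ L, [] ∈ L ∧ ∀ L', [] ∈ L' → ∃ v, (∃ a ∈ v, a ∈ {a : α × Bool | a.2 = true}) ∧
      Walk (kstarEdge E U.matches' S) (L', x) v (L, y) := by
  have block : ∀ {x y : V} {u : List α}, u ∈ U.matches' → u ≠ [] → Walk E x u y →
      ∃ L, [] ∈ L ∧ ∀ L', [] ∈ L' → ∃ v, (∃ a ∈ v, a ∈ {a : α × Bool | a.2 = true}) ∧
        Walk (kstarEdge E U.matches' S) (L', x) v (L, y) := by
    intro x y u hu h0 h
    obtain ⟨a, u, rfl⟩ := List.exists_cons_of_ne_nil h0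
    obtain ⟨z, hz, h⟩ := h
    obtain ⟨L1, h1, h2, h3⟩ := hS _ (Or.inl rfl) a u hu
    obtain ⟨L, h4, h5⟩ := exists_walk_residualEdge
      (fun L' hL' => hS L' (Or.inr (hL'.elim (fun e => e ▸ h1) id))) h h2
    refine ⟨L, h4, fun L' hL' => ⟨(a, true) :: u.map (fun b => (b, false)), by simp, (L1, z),
      ⟨h1, hz, by simp, fun _ => ⟨hL', h3⟩⟩, ?_⟩⟩
    simpa using h5.map (E' := kstarEdge E U.matches' S) id (fun b => (b, false))
      fun x a y h => ⟨h.1, h.2.1, fun _ => h.2.2, by simp⟩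
  obtain ⟨T, rfl, hT⟩ := Language.mem_kstar_iff_exists_nonempty.1 hu
  clear hu
  induction T generalizing x with
  | nil => exact absurd rfl h0
  | cons u T ih =>
    have hu := hT u (by simp)
    rw [List.flatten_cons, Walk.append_iff] at h
    obtain ⟨z, h1, h2⟩ := h
    obtain ⟨L1, hL1, hw1⟩ := block hu.1 hu.2 h1
    by_cases hT0 : T.flatten = []
    · rw [hT0] at h2
      obtain rfl : z = y := h2
      exact ⟨L1, hL1, hw1⟩
    · obtain ⟨L, hL, hw⟩ := ih (fun y hy => hT y (by simp [hy])) hT0 h2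
      refine ⟨L, hL, fun L' hL' => ?_⟩
      obtain ⟨v1, ⟨a, ha, ha'⟩, hv1⟩ := hw1 L' hL'
      obtain ⟨v, -, hv⟩ := hw L1 hL1
      exact ⟨v1 ++ v, ⟨a, by simp [ha], ha'⟩, hv1.append hv⟩

namespace OmegaRegularExpression

/-- The graph `E` has, from the vertex `x` on, a lasso of the form that the ω-regular expression
prescribes: words of the regular expressions that are concatenated, and finally, for `U^ω`, a path
and a loop that both read words of `U*`. -/
def Accepts (E : V → α → V → Prop) : OmegaRegularExpression α → V → Prop
  | omega U, x => ∃ y, (∃ u ∈ KStar.kstar U.matches', Walk E x u y) ∧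
      ∃ v ∈ KStar.kstar U.matches', v ≠ [] ∧ Walk E y v y
  | concat U e, x => ∃ y, (∃ u ∈ U.matches', Walk E x u y) ∧ e.Accepts E y
  | union e e', x => e.Accepts E x ∨ e'.Accepts E x

theorem accepts_of_mem_language (e : OmegaRegularExpression α) {F : Finset V} {ρ : ℕ → V}
    (hF : ∀ i, ρ (i + 1) ∈ F) {w : Stream' α} (hρ : ∀ i, E (ρ i) (w.get i) (ρ (i + 1)))
    (hw : w ∈ e.language) : e.Accepts E (ρ 0) := by
  induction e generalizing w ρ with
  | omega U =>
    obtain ⟨s, hs, h0, hU⟩ := hw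
    have hpos : ∀ i, ∃ j, s (i + 1) = j + 1 := fun i =>
      Nat.exists_eq_succ_of_ne_zero (by have : s i < s (i + 1) := hs (Nat.lt_succ_self i); omega)
    obtain ⟨i, -, j, -, hij, he⟩ := Set.infinite_univ.exists_ne_map_eq_of_mapsTo
      (s := (Set.univ : Set ℕ)) (f := fun i => ρ (s (i + 1))) (t := (F : Set V))
      (fun i _ => by obtain ⟨j, hj⟩ := hpos i; simp only [hj]; exact hF j) F.finite_toSet
    have walk : ∀ i k, ∃ u ∈ KStar.kstar U.matches', u.length = s (i + k) - s i ∧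
        Walk E (ρ (s i)) u (ρ (s (i + k))) := by
      intro i k
      induction k with
      | zero => exact ⟨[], Language.nil_mem_kstar _, by simp, rfl⟩
      | succ k ih =>
        obtain ⟨u, hu, hl, h⟩ := ih
        have hlt : s (i + k) < s (i + k + 1) := hs (by omega)
        have hle : s i ≤ s (i + k) := hs.monotone (by omega)
        have := Walk.of_sequence hρ (s (i + k)) (s (i + k + 1) - s (i + k))
        rw [Nat.add_sub_cancel' hlt.le] at this
        refine ⟨_, ?_, ?_, h.append this⟩
        · rw [← kstar_mul_kstar]
          exact Language.append_mem_mul hu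
            (by simpa using append_mem_kstar (hU (i + k)) (Language.nil_mem_kstar _))
        · rw [List.length_append, hl, Stream'.length_take]
          rw [← Nat.add_assoc]
          omega
    wlog hlt : i < j generalizing i j
    · exact this j i hij.symm he.symm (by omega)
    obtain ⟨u, hu, -, hwu⟩ := walk 0 (i + 1)
    obtain ⟨v, hv, hlv, hwv⟩ := walk (i + 1) (j - i)
    rw [show i + 1 + (j - i) = j + 1 by omega] at hwv hlv
    rw [h0, zero_add] at hwu
    have : s (i + 1) < s (j + 1) := hs (by omega)
    refine ⟨_, ⟨u, hu, hwu⟩, v, hv, ?_, ?_⟩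
    · rintro rfl; simp at hlv; omega
    · have he : ρ (s (i + 1)) = ρ (s (j + 1)) := he
      rwa [← he] at hwv
  | concat U e ih =>
    obtain ⟨u, hu, w', hw', rfl⟩ := hw
    refine ⟨ρ u.length, ⟨u, hu, ?_⟩, ?_⟩
    · simpa [Stream'.take_append_of_le_length] using Walk.of_sequence hρ 0 u.length
    · have := ih (ρ := fun i => ρ (u.length + i)) (fun i => hF (u.length + i)) (w := w')
        (fun i => ?_) hw'
      · simpa using this
      · have := hρ (u.length + i)
        rwa [← Stream'.get_drop, Stream'.drop_append_stream] at this
  | union e e' ih ih' => exact hw.imp (ih hF hρ) (ih' hF hρ)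

/-- The lasso that witnesses `Accepts` can be chosen short. The factor `|e|` comes from the partial
derivatives of the regular expressions in `e`. -/
theorem Accepts.exists_short {e : OmegaRegularExpression α} {F : Finset V}
    (hF : ∀ x a y, E x a y → y ∈ F) {x : V} (h : e.Accepts E x) :
    ∃ (y : V) (u v : List α) (hv : v ≠ []), Walk E x u y ∧ Walk E y v y ∧
      u ++ₛ Stream'.cycle v hv ∈ e.language ∧
      u.length + v.length + F.card ≤ F.card * e.length + 1 := by
  classical
  induction e generalizing x with
  | omega U =>
    obtain ⟨y, ⟨u, hu, hwu⟩, v, hv, hv0, hwv⟩ := h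
    obtain ⟨S, hS, hS'⟩ := U.exists_residuals
    obtain ⟨L, hL, hL'⟩ := exists_walk_kstarEdge hS' hv hv0 hwv
    obtain ⟨z, hz⟩ : ∃ z, Walk (kstarEdge E U.matches' S) (1, x) z (L, y) := by
      by_cases hu0 : u = []
      · subst hu0
        obtain rfl : x = y := hwu
        exact (hL' 1 Language.nil_mem_one).imp fun z hz => hz.2
      · obtain ⟨L1, hL1, h1⟩ := exists_walk_kstarEdge hS' hu hu0 hwu
        obtain ⟨z1, -, hz1⟩ := h1 1 Language.nil_mem_one
        obtain ⟨z2, -, hz2⟩ := hL' L1 hL1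
        exact ⟨_, hz1.append hz2⟩
    obtain ⟨z', hz', hwz'⟩ := hL' L hL
    obtain ⟨⟨L, y⟩, u, v, hl, hwu, hwv, ⟨a, b⟩, hav, rfl⟩ :=
      Walk.exists_short_lasso (F := S.toFinset ×ˢ F)
        (fun x a y h => Finset.mem_product.2 ⟨List.mem_toFinset.2 h.1, hF _ _ _ h.2.1⟩)
        _ hz hwz' hz'
    obtain ⟨v1, v2, rfl⟩ := List.append_of_mem hav
    have hproj : ∀ {x y u}, Walk (kstarEdge E U.matches' S) x u y →
        Walk E x.2 (u.map Prod.fst) y.2 :=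
      fun h => h.map Prod.snd Prod.fst fun x a y h => h.2.1
    refine ⟨y, u.map Prod.fst, (v1 ++ (a, true) :: v2).map Prod.fst, by simp, hproj hwu, hproj hwv,
      ?_, ?_⟩
    · obtain ⟨⟨L3, y3⟩, h1, ⟨L4, y4⟩, hedge, h2⟩ := Walk.append_iff.1 hwv
      obtain ⟨h30, h4⟩ := hedge.2.2.2 rfl
      have h3 : [] ∈ L3 * KStar.kstar U.matches' :=
        Language.append_mem_mul h30 (Language.nil_mem_kstar _)
      -- Cut the word at a letter that starts a new word of `U`.
      obtain ⟨l, hl, r, hr, he⟩ := Language.mem_mul.1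
        (append_mem_of_walk_kstarEdge (h2.append h1) h3)
      have ht : (a :: v2.map Prod.fst) ++ v1.map Prod.fst ∈ KStar.kstar U.matches' := by
        have := append_mem_kstar (h4 l hl) hr
        rw [List.cons_append, he] at this
        simpa using this
      have hz : u.map Prod.fst ++ v1.map Prod.fst ∈ KStar.kstar U.matches' := by
        simpa using append_mem_of_walk_kstarEdge (hwu.append h1) h3
      have hc := Stream'.cycle_eq ((v1 ++ (a, true) :: v2).map Prod.fst) (by simp)
      have := append_periodic_mem_omegaPower (c := (a :: v2.map Prod.fst) ++ₛ
        Stream'.cycle ((v1 ++ (a, true) :: v2).map Prod.fst) (by simp)) hz ht (by simp) (by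
          conv_lhs => rw [hc]
          simp only [← Stream'.append_append_stream, List.map_append, List.map_cons,
            List.append_assoc])
      refine (congrArg (· ∈ omegaPower U.matches') ?_).mp this
      conv_rhs => rw [hc]
      simp only [← Stream'.append_append_stream, List.map_append, List.map_cons,
            List.append_assoc]
    · have := card_residuals_le hS F
      simp only [List.length_map, length, mul_add, mul_one]
      omega
  | concat U e ih =>
    obtain ⟨z, ⟨u0, hu0, hw0⟩, h⟩ := h
    obtain ⟨y, u, v, hv, hwu, hwv, hL, hl⟩ := ih h
    obtain ⟨u', hu', hl', hw'⟩ := U.exists_short hF hu0 hw0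
    refine ⟨y, u' ++ u, v, hv, hw'.append hwu, hwv, ⟨u', hu', _, hL,
      Stream'.append_append_stream _ _ _⟩, ?_⟩
    simp only [List.length_append, length, mul_add]
    omega
  | union e e' ih ih' =>
    rcases h with h | h
    · obtain ⟨y, u, v, hv, hwu, hwv, hL, hl⟩ := ih h
      refine ⟨y, u, v, hv, hwu, hwv, Or.inl hL, hl.trans ?_⟩
      simp only [length, mul_add]; omega
    · obtain ⟨y, u, v, hv, hwu, hwv, hL, hl⟩ := ih' h
      refine ⟨y, u, v, hv, hwu, hwv, Or.inr hL, hl.trans ?_⟩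
      simp only [length, mul_add]; omega

end OmegaRegularExpression

end Short

/-! ### Solutions as runs -/

/-- Going around the loop of a lasso again and again gives an infinite walk. -/
theorem exists_run_of_lasso {V α : Type*} {E : V → α → V → Prop} {x y : V} {u v : List α}
    (h : Walk E x u y) (h' : Walk E y v y) (hv : v ≠ []) :
    ∃ ρ : ℕ → V, ρ 0 = x ∧
      ∀ i, E (ρ i) ((u ++ₛ Stream'.cycle v hv).get i) (ρ (i + 1)) := by
  let G : V × Stream' α → Prop := fun s => ∃ u, Walk E s.1 u y ∧ s.2 = u ++ₛ Stream'.cycle v hv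
  have step : ∀ s : {s // G s}, ∃ s' : {s // G s}, E s.1.1 s.1.2.head s'.1.1 ∧
      s'.1.2 = s.1.2.tail := by
    rintro ⟨⟨x, w⟩, u, hu, hw⟩
    simp only at hu hw
    subst hw
    cases u with
    | nil =>
      obtain rfl : x = y := hu
      obtain ⟨a, t, rfl⟩ := List.exists_cons_of_ne_nil hv
      obtain ⟨z, hz, ht⟩ := h'
      refine ⟨⟨(z, t ++ₛ Stream'.cycle (a :: t) hv), t, ht, rfl⟩, ?_, ?_⟩
      · change E x (Stream'.cycle (a :: t) hv).head z
        rwa [Stream'.cycle_eq]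
      · change t ++ₛ Stream'.cycle (a :: t) hv = (Stream'.cycle (a :: t) hv).tail
        conv_rhs => rw [Stream'.cycle_eq]
        rfl
    | cons a t =>
      obtain ⟨z, hz, ht⟩ := hu
      exact ⟨⟨(z, t ++ₛ Stream'.cycle v hv), t, ht, rfl⟩, hz, rfl⟩
  choose f hf hf' using step
  let s0 : {s // G s} := ⟨(x, u ++ₛ Stream'.cycle v hv), u, h, rfl⟩
  have hdrop : ∀ i, (f^[i] s0).1.2 = (u ++ₛ Stream'.cycle v hv).drop i := fun i => by
    induction i with
    | zero => rfl
    | succ i ih => rw [Function.iterate_succ_apply', hf', ih, Stream'.tail_drop']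
  refine ⟨fun i => (f^[i] s0).1.1, rfl, fun i => ?_⟩
  have := hf (f^[i] s0)
  rw [hdrop, Stream'.head_drop] at this
  simpa only [Function.iterate_succ_apply'] using this

namespace GTDS

/-- The graph of remaining targets. A vertex `x` stands for the target `x / d`; reading the weight
`a` leaves the target `(x / d - a) / lam`, which has to belong to `F` as a multiple of `1 / d`. -/
def Edge (P : GTDS) (F : Finset ℕ) (x a y : ℕ) : Prop :=
  a ∈ P.weights ∧ y ∈ F ∧ P.p * y + P.q * P.d * a = P.q * x

theorem le_maxWeight (P : GTDS) {a : ℕ} (ha : a ∈ P.weights) : a ≤ P.maxWeight := by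
  rw [maxWeight]
  have h := P.weights_sorted.pairwise
  rcases List.eq_nil_or_concat P.weights with h0 | ⟨l, b, hb⟩
  · rw [h0] at ha; simp at ha
  · rw [hb] at ha h ⊢
    simp only [List.concat_eq_append, List.mem_append, List.mem_singleton,
      List.pairwise_append] at ha h
    simp only [List.concat_eq_append, List.getLastD_concat]
    rcases ha with ha | rfl
    · exact (h.2.2 a ha b (by simp)).le
    · rfl

theorem lam_pos (P : GTDS) : (0 : ℝ) < P.lam := by
  have h1 : (0 : ℝ) < P.p := Nat.cast_pos.2 P.p_pos
  have h2 : (0 : ℝ) < P.q := Nat.cast_pos.2 (P.p_pos.trans P.p_lt_q)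
  rw [lam]; push_cast; positivity

theorem lam_lt_one (P : GTDS) : (P.lam : ℝ) < 1 := by
  have h2 : (0 : ℝ) < P.q := Nat.cast_pos.2 (P.p_pos.trans P.p_lt_q)
  have h3 : (P.p : ℝ) < P.q := Nat.cast_lt.2 P.p_lt_q
  rw [lam]; push_cast
  rwa [div_lt_one h2]

/-- An infinite walk from `c` is a solution: the partial sums differ from the target by
`lam ^ n * ρ n / d`, which tends to zero since the vertices `ρ n` belong to a finite set. -/
theorem isSolution_of_run (P : GTDS) {F : Finset ℕ} {ρ : ℕ → ℕ} {w : Stream' ℕ}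
    (h0 : (ρ 0 : ℤ) = P.c) (hρ : ∀ i, P.Edge F (ρ i) (w.get i) (ρ (i + 1))) : P.IsSolution w := by
  have hq : (0 : ℝ) < P.q := Nat.cast_pos.2 (P.p_pos.trans P.p_lt_q)
  have hd : (0 : ℝ) < P.d := Nat.cast_pos.2 P.d_pos
  have hl0 := P.lam_pos
  refine ⟨fun i => (hρ i).1, ?_⟩
  rw [hasSum_iff_tendsto_nat_of_nonneg fun i => by positivity]
  have hstep : ∀ i, (w.get i : ℝ) = ((ρ i : ℝ) - P.lam * ρ (i + 1)) / P.d := fun i => by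
    have := congrArg (Nat.cast (R := ℝ)) (hρ i).2.2
    rw [lam]; push_cast at this ⊢
    field_simp
    linarith
  have hsum : ∀ n, ∑ i ∈ Finset.range n, (w.get i : ℝ) * (P.lam : ℝ) ^ i =
      P.target - (P.lam : ℝ) ^ n * ρ n / P.d := fun n => by
    induction n with
    | zero =>
      have : (ρ 0 : ℝ) = P.c := by exact_mod_cast h0
      simp [target, this]
    | succ n ih => rw [Finset.sum_range_succ, ih, hstep]; ring
  simp only [hsum]
  have : Filter.Tendsto (fun n => (P.lam : ℝ) ^ n * ρ n / P.d) Filter.atTop (nhds 0) := by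
    have hz : Filter.Tendsto (fun n => (P.lam : ℝ) ^ n * ((ρ 0 + F.sup id : ℕ) / P.d))
        Filter.atTop (nhds 0) := by
      simpa using (tendsto_pow_atTop_nhds_zero_of_lt_one hl0.le P.lam_lt_one).mul_const _
    refine squeeze_zero (fun n => by positivity) (fun n => ?_) hz
    rw [mul_div_assoc]
    have : ρ n ≤ ρ 0 + F.sup id := by
      cases n with
      | zero => exact Nat.le_add_right _ _
      | succ n => exact (Finset.le_sup (f := id) (hρ n).2.1).trans (Nat.le_add_left _ _)
    gcongr
  simpa using this.const_sub (P.target : ℝ)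

theorem isSolution_of_walk (P : GTDS) {F : Finset ℕ} {x y : ℕ} {u v : List ℕ} (hv : v ≠ [])
    (h0 : (x : ℤ) = P.c) (h : Walk (P.Edge F) x u y) (h' : Walk (P.Edge F) y v y) :
    P.IsSolution (u ++ₛ Stream'.cycle v hv) := by
  obtain ⟨ρ, rfl, hρ⟩ := exists_run_of_lasso h h' hv
  exact P.isSolution_of_run h0 hρ

/-- The discount factor in lowest terms. -/
theorem exists_coprime (P : GTDS) : ∃ g p q : ℕ, 0 < g ∧ P.p = g * p ∧ P.q = g * q ∧
    p.Coprime q ∧ 0 < p ∧ p < q := by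
  have hp := P.p_pos
  have hpq := P.p_lt_q
  obtain ⟨p, q, h, h1, h2⟩ := Nat.exists_coprime P.p P.q
  rw [mul_comm] at h1 h2
  refine ⟨_, p, q, Nat.gcd_pos_of_pos_left _ hp, h1, h2, h, Nat.pos_of_ne_zero ?_, ?_⟩
  · rintro rfl
    omega
  · refine lt_of_mul_lt_mul_left (a := P.p.gcd P.q) ?_ (Nat.zero_le _)
    rwa [← h1, ← h2]

/-- The targets that remain along an eventually periodic solution are multiples of `1 / d`.
Let `p / q` be the reduced discount factor. Eventually the remaining targets repeat periodically,
hence they all become integers when multiplied by one number `n` that is coprime to `p`. On the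
other hand, if `d` times one of them is an integer, then so is `p * d` times the following one. -/
theorem exists_integer_run (P : GTDS) {p q g : ℕ} (hg : 0 < g) (hp : P.p = g * p)
    (hq : P.q = g * q) (hpq : p.Coprime q) (hp0 : 0 < p) (hlt : p < q) {w : Stream' ℕ}
    (hw : IsEventuallyPeriodic w) (hs : P.IsSolution w) :
    ∃ ρ : ℕ → ℕ, (ρ 0 : ℤ) = P.c ∧ (∀ i, q ∣ ρ (i + 1)) ∧
      (∀ i, P.p * ρ (i + 1) + P.q * P.d * w.get i = P.q * ρ i) ∧
      ∀ i, ρ i * (q - p) ≤ P.d * q * P.maxWeight := by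
  have hg' : (0 : ℝ) < g := Nat.cast_pos.2 hg
  have hq' : (0 : ℝ) < q := Nat.cast_pos.2 (hp0.trans hlt)
  have hd : (0 : ℝ) < P.d := Nat.cast_pos.2 P.d_pos
  have hl : (P.lam : ℝ) = p / q := by
    rw [lam, hp, hq]; push_cast; field_simp
  have hl0 := P.lam_pos
  have hl1 := P.lam_lt_one
  obtain ⟨hmem, hsum⟩ := hs
  -- The remaining targets.
  set t : ℕ → ℝ := fun i => ∑' j, (w.get (i + j) : ℝ) * (P.lam : ℝ) ^ j with ht
  have hle : ∀ i j, (w.get (i + j) : ℝ) * (P.lam : ℝ) ^ j ≤ P.maxWeight * (P.lam : ℝ) ^ j :=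
    fun i j => mul_le_mul_of_nonneg_right (Nat.cast_le.2 (P.le_maxWeight (hmem _))) (by positivity)
  have hgeo : Summable fun j : ℕ => (P.maxWeight : ℝ) * (P.lam : ℝ) ^ j :=
    (summable_geometric_of_lt_one hl0.le hl1).mul_left _
  have hsm : ∀ i, Summable fun j => (w.get (i + j) : ℝ) * (P.lam : ℝ) ^ j := fun i =>
    Summable.of_nonneg_of_le (fun j => by positivity) (hle i) hgeo
  have ht0 : ∀ i, 0 ≤ t i := fun i => tsum_nonneg fun j => by positivity
  have htle : ∀ i, t i ≤ P.maxWeight / (1 - P.lam) := fun i => by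
    refine ((hsm i).tsum_le_tsum (hle i) hgeo).trans_eq ?_
    rw [tsum_mul_left, tsum_geometric_of_lt_one hl0.le hl1, div_eq_mul_inv]
  have hstep : ∀ i, t i = w.get i + P.lam * t (i + 1) := fun i => by
    rw [ht]
    simp only
    rw [(hsm i).tsum_eq_zero_add, ← tsum_mul_left]
    simp only [add_zero, pow_zero, mul_one]
    congr 2
    ext j
    rw [show i + (j + 1) = i + 1 + j by ring]; ring
  have htz : t 0 = P.target := by simpa [ht] using hsum.tsum_eq
  have hqstep : ∀ i, (q : ℝ) * t i = q * w.get i + p * t (i + 1) := fun i => by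
    rw [hstep i, hl]; field_simp
  have hpow : ∀ k i, ∃ m : ℤ, (q : ℝ) ^ k * t i = m + (p : ℝ) ^ k * t (i + k) := by
    intro k
    induction k with
    | zero => exact fun i => ⟨0, by simp⟩
    | succ k ih =>
      intro i
      obtain ⟨m, hm⟩ := ih (i + 1)
      refine ⟨q ^ k * (q * w.get i) + p * m, ?_⟩
      rw [pow_succ, mul_assoc, hqstep, show i + (k + 1) = i + 1 + k by ring]
      push_cast
      linear_combination (p : ℝ) * hm
  obtain ⟨u, v, hv, hwuv⟩ := hw
  have hper : ∀ i, t (u.length + i + v.length) = t (u.length + i) := fun i => by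
    have hc : (Stream'.cycle v hv).drop v.length = Stream'.cycle v hv := by
      conv_lhs => rw [Stream'.cycle_eq]
      exact Stream'.drop_append_stream _ _
    have hu : ∀ j, w.get (u.length + j) = (Stream'.cycle v hv).get j := fun j => by
      rw [← Stream'.get_drop, hwuv, Stream'.drop_append_stream]
    have hv' : ∀ j, (Stream'.cycle v hv).get (v.length + j) = (Stream'.cycle v hv).get j :=
      fun j => by rw [← Stream'.get_drop, hc]
    rw [ht]
    simp only
    congr 1
    ext j
    rw [show u.length + i + v.length + j = u.length + (v.length + (i + j)) by ring, hu, hv',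
      ← hu, add_assoc]
  obtain ⟨n, hn, hnt⟩ : ∃ n : ℕ, n.Coprime p ∧ ∀ i, ∃ m : ℤ, (n : ℝ) * t i = m := by
    have hvl := List.length_pos_of_ne_nil hv
    have hlt' : p ^ v.length < q ^ v.length := Nat.pow_lt_pow_left hlt (by omega)
    refine ⟨(q ^ v.length - p ^ v.length) * q ^ u.length, ?_, fun i => ?_⟩
    · refine Nat.Coprime.mul_left ?_ (Nat.Coprime.pow_left _ hpq.symm)
      rw [← Nat.coprime_add_mul_left_left _ _ (p ^ (v.length - 1)), ← pow_succ',
        Nat.sub_add_cancel hvl, Nat.sub_add_cancel hlt'.le]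
      exact Nat.Coprime.pow_left _ hpq.symm
    · obtain ⟨m, hm⟩ := hpow u.length i
      obtain ⟨m', hm'⟩ := hpow v.length (u.length + i)
      rw [hper] at hm'
      refine ⟨(q ^ v.length - p ^ v.length) * m + p ^ u.length * m', ?_⟩
      push_cast [Nat.cast_sub hlt'.le]
      rw [add_comm i] at hm
      linear_combination ((q : ℝ) ^ v.length - p ^ v.length) * hm + (p : ℝ) ^ u.length * hm'
  have hint : ∀ i, ∃ m : ℤ, (P.d : ℝ) * t i = m := by
    intro i
    induction i with
    | zero => exact ⟨P.c, by rw [htz, target]; push_cast; field_simp⟩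
    | succ i ih =>
      obtain ⟨m, hm⟩ := ih
      obtain ⟨m', hm'⟩ := hnt (i + 1)
      have hb : (n : ℝ) * n.gcdA p + p * n.gcdB p = 1 := by
        have := Nat.gcd_eq_gcd_ab n p
        rw [hn] at this
        exact_mod_cast this.symm
      refine ⟨n.gcdA p * P.d * m' + n.gcdB p * (q * m - q * P.d * w.get i), ?_⟩
      push_cast
      linear_combination (-(P.d : ℝ) * t (i + 1)) * hb + (n.gcdA p : ℝ) * P.d * hm' +
        (n.gcdB p : ℝ) * q * hm - (n.gcdB p : ℝ) * P.d * hqstep i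
  have hnat : ∀ i, ∃ m : ℕ, (P.d : ℝ) * t i = m := fun i => by
    obtain ⟨m, hm⟩ := hint i
    have h0 : (0 : ℝ) ≤ m := by rw [← hm]; have := ht0 i; positivity
    lift m to ℕ using (by exact_mod_cast h0)
    exact ⟨m, by exact_mod_cast hm⟩
  choose ρ hρ using hnat
  have hrec : ∀ i, p * ρ (i + 1) + q * P.d * w.get i = q * ρ i := fun i => by
    have : (p : ℝ) * ρ (i + 1) + q * P.d * w.get i = q * ρ i := by
      rw [← hρ, ← hρ]
      linear_combination -(P.d : ℝ) * hqstep i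
    exact_mod_cast this
  refine ⟨ρ, ?_, fun i => ?_, fun i => ?_, fun i => ?_⟩
  · have : (ρ 0 : ℝ) = P.c := by
      rw [← hρ, htz, target]; push_cast; field_simp
    exact_mod_cast this
  · refine hpq.symm.dvd_of_dvd_mul_left ?_
    refine (Nat.dvd_add_left (Dvd.intro _ rfl : q ∣ q * (P.d * w.get i))).1 ?_
    rw [← mul_assoc, hrec]
    exact Dvd.intro _ rfl
  · rw [hp, hq]
    linear_combination g * hrec i
  · have h1 : (ρ i : ℝ) * (q - p) ≤ P.d * q * P.maxWeight := by
      rw [← hρ]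
      have h2 := htle i
      have h3 : (0 : ℝ) < q - p := sub_pos.2 (Nat.cast_lt.2 hlt)
      rw [hl, show (1 : ℝ) - p / q = (q - p) / q by field_simp, div_div_eq_mul_div,
        le_div_iff₀ h3] at h2
      nlinarith
    rw [← Nat.cast_sub hlt.le] at h1
    exact_mod_cast h1

/-- Remaining targets on the graph: they are multiples of the reduced denominator `q` that are
bounded by a geometric series, which leaves at most `d * a_k / (q - p) + 1` possibilities. -/
theorem exists_targets (P : GTDS) : ∃ F : Finset ℕ,
    ((F.card : ℚ) ≤ 2 * max 1 (P.d * (P.lam * P.maxWeight / (1 - P.lam)))) ∧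
    ∀ w, IsEventuallyPeriodic w → P.IsSolution w →
      ∃ ρ : ℕ → ℕ, (ρ 0 : ℤ) = P.c ∧ (∀ i, ρ (i + 1) ∈ F) ∧
        ∀ i, P.Edge F (ρ i) (w.get i) (ρ (i + 1)) := by
  obtain ⟨g, p, q, hg, hp, hq, hpq, hp0, hlt⟩ := P.exists_coprime
  refine ⟨(Finset.range (P.d * P.maxWeight / (q - p) + 1)).image (q * ·), ?_, fun w hw hs => ?_⟩
  · have hg' : (0 : ℚ) < g := Nat.cast_pos.2 hg
    have hq' : (0 : ℚ) < q := Nat.cast_pos.2 (hp0.trans hlt)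
    have hp1 : (1 : ℚ) ≤ p := Nat.one_le_cast.2 hp0
    have hqp : (0 : ℚ) < q - p := sub_pos.2 (Nat.cast_lt.2 hlt)
    have hl : P.lam = p / q := by
      rw [lam, hp, hq]; push_cast; field_simp
    have h1 : ((P.d * P.maxWeight / (q - p) : ℕ) : ℚ) ≤
        P.d * (P.lam * P.maxWeight / (1 - P.lam)) := by
      refine Nat.cast_div_le.trans ?_
      rw [Nat.cast_sub hlt.le, Nat.cast_mul, hl, show (1 : ℚ) - p / q = (q - p) / q by field_simp,
        show P.d * ((p : ℚ) / q * P.maxWeight / ((q - p) / q)) =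
          p * (P.d * P.maxWeight / (q - p)) by field_simp]
      exact le_mul_of_one_le_left (by positivity) hp1
    have h2 : (((Finset.range (P.d * P.maxWeight / (q - p) + 1)).image (q * ·)).card : ℚ) ≤
        (P.d * P.maxWeight / (q - p) : ℕ) + 1 := by
      exact_mod_cast Finset.card_image_le.trans_eq (Finset.card_range _)
    rw [two_mul, add_comm (max _ _)]
    exact h2.trans (add_le_add (h1.trans (le_max_right _ _)) (le_max_left _ _))
  · obtain ⟨ρ, h0, hdvd, hrec, hbound⟩ := P.exists_integer_run hg hp hq hpq hp0 hlt hw hs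
    have hF : ∀ i, ρ (i + 1) ∈
        (Finset.range (P.d * P.maxWeight / (q - p) + 1)).image (q * ·) := fun i => by
      obtain ⟨m, hm⟩ := hdvd i
      have := hbound (i + 1)
      refine Finset.mem_image.2 ⟨m, Finset.mem_range.2 (Nat.lt_succ_of_le ?_), hm.symm⟩
      rw [Nat.le_div_iff_mul_le (by omega)]
      rw [hm] at this
      refine le_of_mul_le_mul_left (a := q) ?_ (hp0.trans hlt)
      calc _ = q * m * (q - p) := by ring
        _ ≤ P.d * q * P.maxWeight := this
        _ = _ := by ring
    exact ⟨ρ, h0, hF, fun i => ⟨hs.1 i, hF i, hrec i⟩⟩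

end GTDS

theorem const_mem_language_char_omega :
    Stream'.const () ∈ (OmegaRegularExpression.omega (RegularExpression.char ())).language := by
  refine ⟨id, strictMono_id, rfl, fun i => ?_⟩
  simp only [id, Nat.add_sub_cancel_left]
  exact rfl

/-- Labels can be restored on a walk in a graph whose labels have been identified. -/
theorem Walk.exists_labels {V α β : Type*} {E : V → α → V → Prop} {x y : V} {u : List β}
    (h : Walk (fun x _ y => ∃ a, E x a y) x u y) : ∃ v, v.length = u.length ∧ Walk E x v y := by
  induction u generalizing x with
  | nil => exact ⟨[], rfl, h⟩
  | cons b u ih =>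
    obtain ⟨z, ⟨a, ha⟩, h⟩ := h
    obtain ⟨v, hv, h⟩ := ih h
    exact ⟨a :: v, by simp [hv], z, ha, h⟩

theorem CGTDS.exists_short_solution (P : CGTDS) (h : P.HasEventuallyPeriodicSolution) :
    ∃ (u v : List ℕ) (hv : v ≠ []), P.IsSolution (u ++ₛ Stream'.cycle v hv) ∧
      (u.length + v.length : ℚ) ≤
        2 * P.constraint.length * max 1 (P.d * (P.lam * P.maxWeight / (1 - P.lam))) := by
  obtain ⟨w, hw, hs, hL⟩ := h
  obtain ⟨F, hF, hrun⟩ := P.exists_targets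
  obtain ⟨ρ, h0, hρF, hρ⟩ := hrun w hw hs
  have hE : ∀ x a y, P.Edge F x a y → y ∈ F := fun x a y h => h.2.1
  obtain ⟨y, u, v, hv, hu, hv', hmem, hl⟩ :=
    (P.constraint.accepts_of_mem_language hρF hρ hL).exists_short hE
  have hpos := Finset.card_pos.2 ⟨y, Walk.target_mem hE hv hv'⟩
  refine ⟨u, v, hv, ⟨P.isSolution_of_walk hv h0 hu hv', hmem⟩, ?_⟩
  calc (u.length + v.length : ℚ) ≤ F.card * P.constraint.length := by
        have : u.length + v.length ≤ F.card * P.constraint.length := by omega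
        exact_mod_cast this
    _ ≤ 2 * max 1 (P.d * (P.lam * P.maxWeight / (1 - P.lam))) * P.constraint.length := by gcongr
    _ = _ := by ring

/-- Without a constraint the labels do not matter. On the graph with a single label the constraint
`Σ^ω` is an expression of length `2`. -/
theorem GTDS.exists_short_solution (P : GTDS) (h : P.HasEventuallyPeriodicSolution) :
    ∃ (u v : List ℕ) (hv : v ≠ []), P.IsSolution (u ++ₛ Stream'.cycle v hv) ∧
      (u.length + v.length : ℚ) ≤
        2 * 2 * max 1 (P.d * (P.lam * P.maxWeight / (1 - P.lam))) := by
  obtain ⟨w, hw, hs⟩ := h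
  obtain ⟨F, hF, hrun⟩ := P.exists_targets
  obtain ⟨ρ, h0, hρF, hρ⟩ := hrun w hw hs
  have hE : ∀ x (_ : Unit) y, (∃ a, P.Edge F x a y) → y ∈ F := fun x a y ⟨_, h⟩ => h.2.1
  obtain ⟨y, u, v, hv, hu, hv', -, hl⟩ :=
    ((OmegaRegularExpression.omega (RegularExpression.char ())).accepts_of_mem_language
      (E := fun x _ y => ∃ a, P.Edge F x a y) hρF (fun i => ⟨_, hρ i⟩)
      const_mem_language_char_omega).exists_short hE
  have hpos := Finset.card_pos.2 ⟨y, Walk.target_mem hE hv hv'⟩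
  obtain ⟨u', hul, hu⟩ := hu.exists_labels
  obtain ⟨v', hvl, hv'⟩ := hv'.exists_labels
  have hv0 : v' ≠ [] := by
    rintro rfl
    exact hv (List.length_eq_zero_iff.1 hvl.symm)
  refine ⟨u', v', hv0, P.isSolution_of_walk hv0 h0 hu hv', ?_⟩
  rw [hul, hvl]
  simp only [OmegaRegularExpression.length, RegularExpression.length] at hl
  calc (u.length + v.length : ℚ) ≤ F.card * 2 := by
        have : u.length + v.length ≤ F.card * 2 := by omega
        exact_mod_cast this
    _ ≤ 2 * max 1 (P.d * (P.lam * P.maxWeight / (1 - P.lam))) * 2 := by gcongr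
    _ = _ := by ring

/-! ### A game that decides the existence of a lasso -/

namespace DiscountedSum

/-- The position of the denominator of the discount factor in the string `l` of an instance. -/
def posQ (l : List InstanceSymbol) : ℕ := termLength l

/-- The position of the numerator of the target. -/
def posC (l : List InstanceSymbol) : ℕ := posQ l + termLength (l.drop (posQ l))

/-- The position of the denominator of the target. -/
def posD (l : List InstanceSymbol) : ℕ := posC l + termLength (l.drop (posC l))

/-- The position of the first weight. -/
def posWeights (l : List InstanceSymbol) : ℕ := posD l + termLength (l.drop (posD l))

/-- A strict upper bound for the remaining targets, as multiples of `1 / d`. They are at most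
`d * q * a_k`, which has fewer binary digits than the string of the instance has symbols. -/
def vertexBound (l : List InstanceSymbol) : ℕ := 2 ^ l.length

/-- The number of moves in each position of the game: enough to name a vertex with its flag, or a
position in the string. -/
def moveBound (l : List InstanceSymbol) : ℕ := 2 ^ (l.length + 1)

/-- Whether a weight is written at the position `z`: the weights precede the constraint, and each
of them begins at the beginning of their list or after a separator. -/
def isWeight (l : List InstanceSymbol) (z : ℕ) : Bool :=
  Nat.ble (posWeights l) z && (Nat.ble (z + 1) (prefixLength l) &&
    (Nat.beq z (posWeights l) || decide (l[z - 1]? = some InstanceSymbol.sep)))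

/-- Whether the weight `a` leads from `x` to `y`. A vertex is coded as `2 * n + g`, where `n` is a
remaining target and `g` tells whether at least one letter has been read. -/
def isEdge (l : List InstanceSymbol) (x a y : ℕ) : Bool :=
  Nat.beq (y % 2) 1 && (Nat.ble (y / 2 + 1) (vertexBound l) &&
    Nat.beq (readNatural l * (y / 2) +
      readNatural (l.drop (posQ l)) * readNatural (l.drop (posD l)) * a)
      (readNatural (l.drop (posQ l)) * (x / 2)))

/-- The position of the second argument of the binary symbol at the position `i`. -/
def second (l : List InstanceSymbol) (i : ℕ) : ℕ := i + 1 + termLength (l.drop (i + 1))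

/-- A claim `(t, i, x, y)` about the string of an instance, where `i` is a position and `x`, `y`
are vertices. It is true for `t = 1` and false for `t = 0`. For `t = 2` it claims that there is an
accepting lasso from `x` for the ω-regular expression at `i`, for `t = 3` that there is a walk from
`x` to `y` that reads a word of the regular expression at `i`, and for `t = k + 4` that there is a
chain of at most `2 ^ k` such walks from `x` to `y`. -/
abbrev Claim := ℕ × ℕ × ℕ × ℕ

/-- A true or false claim. -/
def leaf (b : Bool) : Claim := (b.toNat, 0, 0, 0)

/-- The claim on chains of arbitrary length. There are `2 ^ (l.length + 1)` vertices, and so many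
walks in a row are always enough. -/
def chain (l : List InstanceSymbol) (i x y : ℕ) : Claim := (l.length + 5, i, x, y)

/-- The two claims, for `b = 0` and `b = 1`, from which a claim about walks follows; `z` is the
choice of a weight, of an alternative, or of an intermediate vertex. If no symbol is left, then
every letter is allowed. -/
def walkPremise (l : List InstanceSymbol) (i x y z b : ℕ) : Option InstanceSymbol → Claim
  | none => leaf (isWeight l z && isEdge l x (readNatural (l.drop z)) y)
  | some .epsilon => leaf (Nat.beq x y)
  | some .char => leaf (isWeight l z && (Nat.beq (readNatural (l.drop z))
      (readNatural (l.drop (i + 1))) && isEdge l x (readNatural (l.drop z)) y))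
  | some .plus => bif Nat.beq (z % 2) 0 then (3, i + 1, x, y) else (3, second l i, x, y)
  | some .comp => bif Nat.beq b 0 then (3, i + 1, x, z) else (3, second l i, z, y)
  | some .star => chain l (i + 1) x y
  | _ => leaf false

/-- The two claims from which a claim about lassos follows. The flag in the vertices ensures that
the loop of a lasso is not empty. If no symbol is left, then there is no constraint. -/
def lassoPremise (l : List InstanceSymbol) (i x z b : ℕ) : Option InstanceSymbol → Claim
  | none => bif Nat.beq b 0 then chain l i x (2 * z + 1) else chain l i (2 * z) (2 * z + 1)
  | some .omega =>
    bif Nat.beq b 0 then chain l (i + 1) x (2 * z + 1) else chain l (i + 1) (2 * z) (2 * z + 1)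
  | some .concat => bif Nat.beq b 0 then (3, i + 1, x, 2 * z + 1) else (2, second l i, 2 * z + 1, 0)
  | some .union => bif Nat.beq (z % 2) 0 then (2, i + 1, x, 0) else (2, second l i, x, 0)
  | _ => leaf false

/-- The two claims from which a claim follows. -/
def premise (l : List InstanceSymbol) (f : Claim) (z b : ℕ) : Claim :=
  bif Nat.ble f.1 1 then f
  else bif Nat.beq f.1 2 then lassoPremise l f.2.1 f.2.2.1 z b l[f.2.1]?
  else bif Nat.beq f.1 3 then walkPremise l f.2.1 f.2.2.1 f.2.2.2 z b l[f.2.1]?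
  else bif Nat.beq f.1 4 then
    bif Nat.beq f.2.2.1 f.2.2.2 then leaf true else (3, f.2.1, f.2.2.1, f.2.2.2)
  else bif Nat.beq b 0 then (f.1 - 1, f.2.1, f.2.2.1, z) else (f.1 - 1, f.2.1, z, f.2.2.2)

/-- A move of the game. In turn, a player who defends a claim chooses `z`, and the opponent chooses
one of the two premises. -/
def move (v : List InstanceSymbol × (ℕ × Claim × ℕ) × ℕ) : ℕ × Claim × ℕ :=
  bif Nat.beq v.2.1.1 0 then (1, v.2.1.2.1, v.2.2)
  else (0, premise v.1 v.2.1.2.1 v.2.1.2.2 (v.2.2 % 2), 0)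

/-- Whether the claim reached is not plainly true, so that its defender has lost. -/
def isRefuted (v : List InstanceSymbol × (ℕ × Claim × ℕ)) : Bool := !Nat.beq v.2.2.1.1 1

/-- The number of moves, two for each rule. Every symbol of the constraint accounts for at most
`l.length + 3` nested rules, most of them for halving chains. -/
def moveCount (l : List InstanceSymbol) : ℕ := 2 * ((l.length + 1) * (l.length + 4))

/-- The initial claim: there is a lasso from the numerator of the target for the constraint, which
starts where the weights end. The remainder only keeps the claim small on strings that have been
ruled out before. -/
def initialClaim (l : List InstanceSymbol) : Claim :=
  (2, prefixLength l, 2 * (readNatural (l.drop (posC l)) % vertexBound l) + 1, 0)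

/-- Decides whether an instance has an eventually periodic solution, by means of a game. -/
def decider (l : List InstanceSymbol) : Bool :=
  !decide (l[posC l]? = some InstanceSymbol.neg) &&
    (Nat.ble (readNatural (l.drop (posC l)) + 1) (vertexBound l) &&
      !gameLost (fun y => move (l, y)) (fun y => isRefuted (l, y)) (moveBound l) (moveCount l)
        (0, initialClaim l, 0))

section PolySpace

variable {α : Type} [RegisterData α]

@[fun_prop]
theorem polySpace_posQ : PolySpace posQ := by unfold posQ; fun_prop

@[fun_prop]
theorem polySpace_posC : PolySpace posC := by unfold posC; fun_prop

@[fun_prop]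
theorem polySpace_posD : PolySpace posD := by unfold posD; fun_prop

@[fun_prop]
theorem polySpace_posWeights : PolySpace posWeights := by unfold posWeights; fun_prop

theorem polySpace_two_pow {f : List InstanceSymbol → ℕ} (hf : PolySpace f) (c : ℕ)
    (h : ∀ l, f l ≤ l.length + c) : PolySpace (fun l => 2 ^ f l) := by
  refine .pow (f := fun _ => 2) (by fun_prop) hf (Polynomial.X + Polynomial.C (c + 1)) fun l => ?_
  have := length_le_size_wordNumber l
  have := h l
  rw [Nat.size_pow, registerSize_word]
  simp
  omega

@[fun_prop]
theorem polySpace_vertexBound : PolySpace vertexBound :=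
  polySpace_two_pow (by fun_prop) 0 fun _ => le_rfl

@[fun_prop]
theorem polySpace_moveBound : PolySpace moveBound :=
  polySpace_two_pow (by fun_prop) 1 fun _ => le_rfl

@[fun_prop]
theorem polySpace_isWeight {l : α → List InstanceSymbol} {z : α → ℕ} (hl : PolySpace l)
    (hz : PolySpace z) : PolySpace (fun a => isWeight (l a) (z a)) := by
  have : PolySpace (fun a => decide ((l a)[z a - 1]? = some InstanceSymbol.sep)) :=
    (PolySpace.symbolFun fun s => decide (s = some InstanceSymbol.sep)).comp
      (f := fun a => (l a)[z a - 1]?) (by fun_prop)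
  unfold isWeight
  fun_prop

@[fun_prop]
theorem polySpace_isEdge {l : α → List InstanceSymbol} {x a y : α → ℕ} (hl : PolySpace l)
    (hx : PolySpace x) (ha : PolySpace a) (hy : PolySpace y) :
    PolySpace (fun v => isEdge (l v) (x v) (a v) (y v)) := by
  unfold isEdge
  fun_prop

@[fun_prop]
theorem polySpace_second {l : α → List InstanceSymbol} {i : α → ℕ} (hl : PolySpace l)
    (hi : PolySpace i) : PolySpace (fun v => second (l v) (i v)) := by
  unfold second
  fun_prop

@[fun_prop]
theorem polySpace_leaf {b : α → Bool} (hb : PolySpace b) : PolySpace (fun v => leaf (b v)) := by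
  unfold leaf
  fun_prop

@[fun_prop]
theorem polySpace_chain {l : α → List InstanceSymbol} {i x y : α → ℕ} (hl : PolySpace l)
    (hi : PolySpace i) (hx : PolySpace x) (hy : PolySpace y) :
    PolySpace (fun v => chain (l v) (i v) (x v) (y v)) := by
  unfold chain
  fun_prop

@[fun_prop]
theorem polySpace_walkPremise {l : α → List InstanceSymbol} {i x y z b : α → ℕ}
    {o : α → Option InstanceSymbol} (hl : PolySpace l) (hi : PolySpace i) (hx : PolySpace x)
    (hy : PolySpace y) (hz : PolySpace z) (hb : PolySpace b) (ho : PolySpace o) :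
    PolySpace (fun v => walkPremise (l v) (i v) (x v) (y v) (z v) (b v) (o v)) := by
  refine .symbolCases (F := fun o v => walkPremise (l v) (i v) (x v) (y v) (z v) (b v) o) ho ?_
  rintro (_ | _ | _ | _ | _ | _ | _ | _ | _ | _ | _ | _ | _) <;>
    simp only [walkPremise] <;> fun_prop

@[fun_prop]
theorem polySpace_lassoPremise {l : α → List InstanceSymbol} {i x z b : α → ℕ}
    {o : α → Option InstanceSymbol} (hl : PolySpace l) (hi : PolySpace i) (hx : PolySpace x)
    (hz : PolySpace z) (hb : PolySpace b) (ho : PolySpace o) :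
    PolySpace (fun v => lassoPremise (l v) (i v) (x v) (z v) (b v) (o v)) := by
  refine .symbolCases (F := fun o v => lassoPremise (l v) (i v) (x v) (z v) (b v) o) ho ?_
  rintro (_ | _ | _ | _ | _ | _ | _ | _ | _ | _ | _ | _ | _) <;>
    simp only [lassoPremise] <;> fun_prop

@[fun_prop]
theorem polySpace_premise {l : α → List InstanceSymbol} {f : α → Claim} {z b : α → ℕ}
    (hl : PolySpace l) (hf : PolySpace f) (hz : PolySpace z) (hb : PolySpace b) :
    PolySpace (fun v => premise (l v) (f v) (z v) (b v)) := by
  unfold premise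
  fun_prop

theorem polySpace_move : PolySpace move := by unfold move; fun_prop

theorem polySpace_isRefuted : PolySpace isRefuted := by unfold isRefuted; fun_prop

end PolySpace

theorem termLength_le (l : List InstanceSymbol) : termLength l ≤ l.length := by
  simpa [termLength] using (foldl_readTermSymbol_le l 1 0).2

theorem prefixLength_le (l : List InstanceSymbol) : prefixLength l ≤ l.length := by
  simpa [prefixLength] using foldl_prefixLength_le l (false, 0)

/-- A claim with small components. -/
def SmallClaim (l : List InstanceSymbol) (f : Claim) : Prop :=
  f.1 ≤ l.length + 5 ∧ f.2.1 ≤ 2 * l.length + 1 ∧ f.2.2.1 ≤ 2 * moveBound l ∧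
    f.2.2.2 ≤ 2 * moveBound l

theorem smallClaim_leaf (l : List InstanceSymbol) (b : Bool) : SmallClaim l (leaf b) := by
  have := Bool.toNat_le b
  refine ⟨?_, Nat.zero_le _, Nat.zero_le _, Nat.zero_le _⟩
  simp only [leaf]; omega

theorem second_le {l : List InstanceSymbol} {i : ℕ} (hi : i < l.length) :
    second l i ≤ 2 * l.length + 1 := by
  have := termLength_le (l.drop (i + 1))
  rw [List.length_drop] at this
  rw [second]; omega

theorem smallClaim_walkPremise {l : List InstanceSymbol} {i x y z : ℕ} (b : ℕ)
    (hx : x ≤ 2 * moveBound l) (hy : y ≤ 2 * moveBound l) (hz : z < moveBound l) :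
    SmallClaim l (walkPremise l i x y z b l[i]?) := by
  rcases hs : l[i]? with _ | s
  · exact smallClaim_leaf _ _
  have hi : i < l.length := by
    by_contra h
    rw [List.getElem?_eq_none (by omega)] at hs
    simp at hs
  have := second_le hi
  cases s <;> simp only [walkPremise] <;> try exact smallClaim_leaf _ _
  · rcases Nat.beq (z % 2) 0 <;> refine ⟨?_, ?_, ?_, ?_⟩ <;> simp only [cond_true, cond_false] <;>
      omega
  · rcases Nat.beq b 0 <;> refine ⟨?_, ?_, ?_, ?_⟩ <;> simp only [cond_true, cond_false] <;> omega
  · refine ⟨?_, ?_, ?_, ?_⟩ <;> simp only [chain] <;> omega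

theorem smallClaim_lassoPremise {l : List InstanceSymbol} {i x z : ℕ} (b : ℕ)
    (hi : i ≤ 2 * l.length + 1) (hx : x ≤ 2 * moveBound l) (hz : z < moveBound l) :
    SmallClaim l (lassoPremise l i x z b l[i]?) := by
  rcases hs : l[i]? with _ | s
  · simp only [lassoPremise]
    rcases Nat.beq b 0 <;> refine ⟨?_, ?_, ?_, ?_⟩ <;> simp only [cond_true, cond_false, chain] <;>
      omega
  have hi : i < l.length := by
    by_contra h
    rw [List.getElem?_eq_none (by omega)] at hs
    simp at hs
  have := second_le hi
  cases s <;> simp only [lassoPremise] <;> try exact smallClaim_leaf _ _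
  · rcases Nat.beq b 0 <;> refine ⟨?_, ?_, ?_, ?_⟩ <;> simp only [cond_true, cond_false, chain] <;>
      omega
  · rcases Nat.beq b 0 <;> refine ⟨?_, ?_, ?_, ?_⟩ <;> simp only [cond_true, cond_false] <;> omega
  · rcases Nat.beq (z % 2) 0 <;> refine ⟨?_, ?_, ?_, ?_⟩ <;> simp only [cond_true, cond_false] <;>
      omega

theorem smallClaim_premise {l : List InstanceSymbol} {f : Claim} {z : ℕ} (b : ℕ)
    (hf : SmallClaim l f) (hz : z < moveBound l) : SmallClaim l (premise l f z b) := by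
  obtain ⟨t, i, x, y⟩ := f
  obtain ⟨h1, h2, h3, h4⟩ := hf
  simp only at h1 h2 h3 h4
  simp only [premise]
  cases Nat.ble t 1
  swap
  · exact ⟨h1, h2, h3, h4⟩
  cases Nat.beq t 2
  swap
  · exact smallClaim_lassoPremise b h2 h3 hz
  cases Nat.beq t 3
  swap
  · exact smallClaim_walkPremise b h3 h4 hz
  cases Nat.beq t 4
  swap
  · cases Nat.beq x y
    · exact ⟨by simp, h2, h3, h4⟩
    · exact smallClaim_leaf _ _
  cases Nat.beq b 0 <;> refine ⟨?_, ?_, ?_, ?_⟩ <;> simp only [cond_true, cond_false] <;> omega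

theorem smallClaim_initialClaim (l : List InstanceSymbol) : SmallClaim l (initialClaim l) := by
  have h1 := prefixLength_le l
  have h2 : readNatural (l.drop (posC l)) % vertexBound l < vertexBound l :=
    Nat.mod_lt _ (Nat.two_pow_pos _)
  have h3 : moveBound l = 2 * vertexBound l := pow_succ' _ _
  refine ⟨?_, ?_, ?_, ?_⟩ <;> simp only [initialClaim] <;> omega

theorem polySpace_decider : PolySpace decider := by
  have hneg : PolySpace (fun l : List InstanceSymbol =>
      decide (l[posC l]? = some InstanceSymbol.neg)) :=
    (PolySpace.symbolFun fun s => decide (s = some InstanceSymbol.neg)).comp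
      (f := fun l : List InstanceSymbol => l[posC l]?) (by fun_prop)
  have hinit : PolySpace (fun l : List InstanceSymbol => ((0 : ℕ), initialClaim l, (0 : ℕ))) := by
    unfold initialClaim; fun_prop
  have hcount : PolySpace moveCount := by unfold moveCount; fun_prop
  have hgame := PolySpace.gameLost (next := move) (final := isRefuted) polySpace_move
    polySpace_isRefuted polySpace_moveBound hcount hinit (fun l => Nat.two_pow_pos _)
    ((Polynomial.X + 1) * (2 * ((Polynomial.X + 1) * (Polynomial.X + 4))) + 7 * Polynomial.X + 20)
    (fun l => by
      have h := length_le_size_wordNumber l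
      rw [registerSize_word, moveBound, moveCount, ← pow_mul, Nat.size_pow]
      simp only [Polynomial.eval_add, Polynomial.eval_mul, Polynomial.eval_X, Polynomial.eval_one,
        Polynomial.eval_ofNat]
      have : (l.length + 1) * (2 * ((l.length + 1) * (l.length + 4))) ≤
        ((wordNumber l).size + 1) *
          (2 * (((wordNumber l).size + 1) * ((wordNumber l).size + 4))) := by
        gcongr
      omega)
    (fun l y => y.1 ≤ 1 ∧ SmallClaim l y.2.1 ∧ y.2.2 < moveBound l)
    (fun l => ⟨Nat.zero_le _, smallClaim_initialClaim l, Nat.two_pow_pos _⟩)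
    (fun l y z hy hz => by
      simp only [move]
      cases Nat.beq y.1 0
      · exact ⟨Nat.zero_le _, smallClaim_premise _ hy.2.1 hy.2.2, Nat.two_pow_pos _⟩
      · exact ⟨le_rfl, hy.2.1, hz⟩)
    (fun l y hy => by
      obtain ⟨a, ⟨t, i, x, x'⟩, z⟩ := y
      obtain ⟨h1, ⟨h2, h3, h4, h5⟩, h6⟩ := hy
      simp only at h1 h2 h3 h4 h5 h6
      have h := length_le_size_wordNumber l
      have e : 2 * moveBound l = 2 ^ (l.length + 2) := (pow_succ' 2 _).symm
      have s1 := (Nat.size_le_self a).trans h1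
      have s2 := (Nat.size_le_self t).trans h2
      have s3 := (Nat.size_le_self i).trans h3
      have s4 := Nat.size_le_size (e ▸ h4)
      have s5 := Nat.size_le_size (e ▸ h5)
      have s6 := Nat.size_le_size (h6.le.trans (e ▸ Nat.le_mul_of_pos_left _ two_pos))
      rw [Nat.size_pow] at s4 s5 s6
      simp only [registerSize_prod, registerSize_nat, registerSize_word, Polynomial.eval_add,
        Polynomial.eval_mul, Polynomial.eval_X, Polynomial.eval_one, Polynomial.eval_ofNat]
      omega)
  unfold decider
  fun_prop

end DiscountedSum

/-! ### Derivations -/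

namespace DiscountedSum

/-- `Derives l k f`: the claim `f` can be derived with at most `k` nested applications of the
rules. -/
def Derives (l : List InstanceSymbol) : ℕ → Claim → Prop
  | 0, f => f.1 = 1
  | k + 1, f => ∃ z < moveBound l, Derives l k (premise l f z 0) ∧ Derives l k (premise l f z 1)

theorem two_le_moveBound (l : List InstanceSymbol) : 2 ≤ moveBound l :=
  Nat.le_self_pow (Nat.succ_ne_zero _) 2

/-- A claim can be derived if and only if its defender wins the game. -/
theorem gameLost_eq_false_iff (l : List InstanceSymbol) (k : ℕ) (f : Claim) (w : ℕ) :
    gameLost (fun y => move (l, y)) (fun y => isRefuted (l, y)) (moveBound l) (2 * k) (0, f, w) =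
      false ↔ Derives l k f := by
  induction k generalizing f w with
  | zero => simp [gameLost, isRefuted, Derives, Nat.beq_eq]
  | succ k ih =>
    have h2 := two_le_moveBound l
    rw [show 2 * (k + 1) = 2 * k + 1 + 1 by ring, gameLost, decide_eq_false_iff_not, Derives]
    push Not
    refine exists_congr fun z => and_congr_right fun _ => ?_
    have h : ∀ z', move (l, (1, f, z), z') = (0, premise l f z (z' % 2), 0) := fun _ => rfl
    change gameLost _ _ _ (2 * k + 1) (1, f, z) ≠ false ↔ _
    rw [Ne, Bool.not_eq_false, gameLost, decide_eq_true_iff]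
    simp only [h, ih]
    constructor
    · exact fun h => ⟨h 0 (by omega), h 1 (by omega)⟩
    · rintro ⟨h0, h1⟩ z' -
      rcases Nat.mod_two_eq_zero_or_one z' with e | e <;> rw [e] <;> assumption

theorem premise_leaf (l : List InstanceSymbol) (f : Claim) (hf : f.1 ≤ 1) (z b : ℕ) :
    premise l f z b = f := by
  rw [premise, Nat.ble_eq_true_of_le hf, cond_true]

theorem derives_leaf {l : List InstanceSymbol} {k : ℕ} {b : Bool} :
    Derives l k (leaf b) ↔ b = true := by
  induction k with
  | zero => cases b <;> simp [Derives, leaf]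
  | succ k ih =>
    have h : (leaf b).1 ≤ 1 := Bool.toNat_le b
    simp only [Derives, premise_leaf _ _ h, ih, and_self]
    exact ⟨fun ⟨_, _, h⟩ => h, fun h => ⟨0, Nat.two_pow_pos _, h⟩⟩

theorem Derives.succ {l : List InstanceSymbol} {k : ℕ} {f : Claim} (h : Derives l k f) :
    Derives l (k + 1) f := by
  induction k generalizing f with
  | zero =>
    have h' : f.1 ≤ 1 := le_of_eq h
    refine ⟨0, Nat.two_pow_pos _, ?_, ?_⟩ <;> rw [premise_leaf _ _ h'] <;> exact h
  | succ k ih =>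
    obtain ⟨z, hz, h0, h1⟩ := h
    exact ⟨z, hz, ih h0, ih h1⟩

theorem Derives.mono {l : List InstanceSymbol} {k k' : ℕ} {f : Claim} (h : Derives l k f)
    (hk : k ≤ k') : Derives l k' f := by
  induction hk with
  | refl => exact h
  | step _ ih => exact ih.succ

theorem premise_chain_zero (l : List InstanceSymbol) (i x y z b : ℕ) :
    premise l (4, i, x, y) z b = bif Nat.beq x y then leaf true else (3, i, x, y) := rfl

theorem derives_lasso {l : List InstanceSymbol} {k i x y : ℕ} :
    Derives l (k + 1) (2, i, x, y) ↔ ∃ z < moveBound l,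
      Derives l k (lassoPremise l i x z 0 l[i]?) ∧ Derives l k (lassoPremise l i x z 1 l[i]?) :=
  Iff.rfl

theorem derives_walk {l : List InstanceSymbol} {k i x y : ℕ} :
    Derives l (k + 1) (3, i, x, y) ↔ ∃ z < moveBound l,
      Derives l k (walkPremise l i x y z 0 l[i]?) ∧ Derives l k (walkPremise l i x y z 1 l[i]?) :=
  Iff.rfl

theorem derives_chain_zero {l : List InstanceSymbol} {k i x y : ℕ} :
    Derives l (k + 1) (4, i, x, y) ↔ x = y ∨ Derives l k (3, i, x, y) := by
  have h : Derives l k (bif Nat.beq x y then leaf true else (3, i, x, y)) ↔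
      x = y ∨ Derives l k (3, i, x, y) := by
    rcases eq_or_ne x y with rfl | h
    · simp [derives_leaf]
    · simp [Nat.beq_false_of_ne h, h]
  simp only [Derives, premise_chain_zero, h, and_self]
  exact ⟨fun ⟨_, _, h⟩ => h, fun h => ⟨0, Nat.two_pow_pos _, h⟩⟩

theorem derives_chain_succ {l : List InstanceSymbol} {k j i x y : ℕ} :
    Derives l (k + 1) (j + 5, i, x, y) ↔ ∃ z < moveBound l,
      Derives l k (j + 4, i, x, z) ∧ Derives l k (j + 4, i, z, y) := Iff.rfl

/-! ### Correctness of the rules -/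

theorem derives_chain_sound {l : List InstanceSymbol} {i : ℕ} {R : ℕ → ℕ → Prop}
    (hR : ∀ k x y, Derives l k (3, i, x, y) → R x y) {k j x y : ℕ}
    (h : Derives l k (j + 4, i, x, y)) : Relation.ReflTransGen R x y := by
  induction j generalizing k x y with
  | zero =>
    cases k with
    | zero => simp [Derives] at h
    | succ k =>
      rcases derives_chain_zero.1 h with rfl | h
      · exact .refl
      · exact .single (hR _ _ _ h)
  | succ j ih =>
    cases k with
    | zero => simp [Derives] at h
    | succ k =>
      obtain ⟨z, -, h1, h2⟩ := derives_chain_succ.1 h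
      exact (ih h1).trans (ih h2)

/-- A chain of length at most `2 ^ j` is derived by repeated halving. -/
theorem derives_chain_of_walk {l : List InstanceSymbol} {i D : ℕ} {R : ℕ → Unit → ℕ → Prop}
    (hR : ∀ x a y, R x a y → y < moveBound l ∧ Derives l D (3, i, x, y)) {j x y : ℕ} {s : List Unit}
    (hx : x < moveBound l) (hs : s.length ≤ 2 ^ j) (h : Walk R x s y) :
    Derives l (D + j + 1) (j + 4, i, x, y) := by
  induction j generalizing x y s with
  | zero =>
    refine derives_chain_zero.2 ?_
    match s, hs, h with
    | [], _, h => exact Or.inl h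
    | [a], _, ⟨z, hz, h⟩ =>
      obtain rfl : z = y := h
      exact Or.inr (hR _ _ _ hz).2
  | succ j ih =>
    rw [← List.take_append_drop (2 ^ j) s] at h
    obtain ⟨z, h1, h2⟩ := Walk.append_iff.1 h
    have hz : z < moveBound l := by
      have := Walk.target_mem (F := Finset.range (moveBound l))
        (fun x a y h => Finset.mem_range.2 (hR x a y h).1) (u := s.take (2 ^ j)) (x := x) (y := z)
      by_cases h0 : s.take (2 ^ j) = []
      · rw [h0] at h1
        exact (show x = z from h1) ▸ hx
      · exact Finset.mem_range.1 (this h0 h1)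
    refine derives_chain_succ.2 ⟨z, hz, ih hx (List.length_take_le _ _) h1, ih hz ?_ h2⟩
    rw [pow_succ] at hs
    rw [List.length_drop]
    omega

theorem derives_chain_complete {l : List InstanceSymbol} {i D : ℕ} {R : ℕ → ℕ → Prop}
    (hR : ∀ x y, R x y → x < moveBound l → y < moveBound l ∧ Derives l D (3, i, x, y)) {x y : ℕ}
    (hx : x < moveBound l) (h : Relation.ReflTransGen R x y) :
    Derives l (D + l.length + 2) (chain l i x y) := by
  let E : ℕ → Unit → ℕ → Prop := fun x _ y => x < moveBound l ∧ R x y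
  have hE : ∀ x a y, E x a y → y < moveBound l ∧ Derives l D (3, i, x, y) :=
    fun x _ y h => hR x y h.2 h.1
  have hw : ∃ s, Walk E x s y ∧ y < moveBound l := by
    induction h with
    | refl => exact ⟨[], rfl, hx⟩
    | tail _ hyz ih =>
      obtain ⟨s, hs, hy⟩ := ih
      exact ⟨s ++ [()], hs.append ⟨_, ⟨hy, hyz⟩, rfl⟩, (hR _ _ hyz hy).1⟩
  obtain ⟨s, hs, -⟩ := hw
  obtain ⟨s', hl, hs'⟩ := Walk.exists_short (F := Finset.range (moveBound l))
    (fun x a y h => Finset.mem_range.2 (hE x a y h).1) hs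
  rw [Finset.card_range] at hl
  exact derives_chain_of_walk (j := l.length + 1) hE hx hl hs'

section Graph

variable {β : Type} {E : ℕ → β → ℕ → Prop}

/-- The graph `E` with flags: the vertex `2 * n + g` is the vertex `n` with the flag `g`, which is
`1` after each edge. -/
def flagged (E : ℕ → β → ℕ → Prop) (x : ℕ) (a : β) (y : ℕ) : Prop := y % 2 = 1 ∧ E (x / 2) a (y / 2)

theorem walk_of_flagged {x y : ℕ} {u : List β} (h : Walk (flagged E) x u y) :
    Walk E (x / 2) u (y / 2) := by
  simpa using h.map (E' := E) (· / 2) id fun _ _ _ h => h.2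

theorem ne_nil_of_flagged {x y : ℕ} {u : List β} (h : Walk (flagged E) (2 * x) u (2 * y + 1)) :
    u ≠ [] := by
  rintro rfl
  have : 2 * x = 2 * y + 1 := h
  omega

theorem flagged_of_walk {x y : ℕ} {u : List β} (h : Walk E x u y) :
    Walk (flagged E) (2 * x + 1) u (2 * y + 1) := by
  have h2 : ∀ n, (2 * n + 1) / 2 = n := by omega
  simpa using h.map (E' := flagged E) (2 * · + 1) id fun x a y h =>
    ⟨by omega, by simpa only [id, h2] using h⟩

theorem flagged_of_walk_of_ne_nil {x y : ℕ} {u : List β} (hu : u ≠ []) (h : Walk E x u y) :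
    Walk (flagged E) (2 * x) u (2 * y + 1) := by
  obtain ⟨a, u, rfl⟩ := List.exists_cons_of_ne_nil hu
  obtain ⟨z, hz, h⟩ := h
  exact ⟨2 * z + 1, ⟨by omega, by
    rwa [show 2 * x / 2 = x by omega, show (2 * z + 1) / 2 = z by omega]⟩,
    flagged_of_walk h⟩

/-- Reachability by words of `U`. -/
def Reads (E : ℕ → β → ℕ → Prop) (U : Language β) (x y : ℕ) : Prop :=
  ∃ u ∈ U, Walk (flagged E) x u y

theorem reads_kstar_of_reflTransGen {U : Language β} {x y : ℕ}
    (h : Relation.ReflTransGen (Reads E U) x y) : Reads E (KStar.kstar U) x y := by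
  induction h using Relation.ReflTransGen.head_induction_on with
  | refl => exact ⟨[], Language.nil_mem_kstar _, rfl⟩
  | head h _ ih =>
    obtain ⟨u, hu, hwu⟩ := h
    obtain ⟨v, hv, hwv⟩ := ih
    exact ⟨u ++ v, append_mem_kstar hu hv, hwu.append hwv⟩

theorem reflTransGen_of_reads_kstar {U : Language β} {x y : ℕ} (h : Reads E (KStar.kstar U) x y) :
    Relation.ReflTransGen (Reads E U) x y := by
  obtain ⟨u, hu, h⟩ := h
  obtain ⟨T, rfl, hT⟩ := Language.mem_kstar.1 hu
  clear hu
  induction T generalizing x with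
  | nil => exact (show x = y from h) ▸ .refl
  | cons u T ih =>
    obtain ⟨z, h1, h2⟩ := Walk.append_iff.1 h
    exact .head ⟨u, hT u (by simp), h1⟩ (ih (fun v hv => hT v (by simp [hv])) h2)

theorem lt_of_reads {l : List InstanceSymbol} (hE : ∀ x a y, E x a y → y < vertexBound l)
    {U : Language β} {x y : ℕ} (h : Reads E U x y) (hx : x < moveBound l) : y < moveBound l := by
  obtain ⟨u, -, h⟩ := h
  have hb : moveBound l = 2 * vertexBound l := pow_succ' _ _
  by_cases hu : u = []
  · subst hu
    exact (show x = y from h) ▸ hx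
  · refine Finset.mem_range.1 (Walk.target_mem (F := Finset.range (moveBound l)) ?_ hu h)
    intro x a y h
    have := hE _ _ _ h.2
    rw [Finset.mem_range]
    omega

/-- The rule for the loops and paths that are repeated infinitely often. -/
theorem accepts_omega_of_derives {l : List InstanceSymbol} {U : RegularExpression β} {i j : ℕ}
    (hU : ∀ k x y, Derives l k (3, j, x, y) → Reads E U.matches' x y)
    (hi : ∀ x z b, lassoPremise l i x z b l[i]? =
      bif Nat.beq b 0 then chain l j x (2 * z + 1) else chain l j (2 * z) (2 * z + 1))
    {k x y : ℕ} (h : Derives l k (2, i, x, y)) :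
    (OmegaRegularExpression.omega U).Accepts E (x / 2) := by
  cases k with
  | zero => simp [Derives] at h
  | succ k =>
    obtain ⟨z, -, h1, h2⟩ := derives_lasso.1 h
    rw [hi] at h1 h2
    obtain ⟨u, hu, hwu⟩ := reads_kstar_of_reflTransGen
      (derives_chain_sound (j := l.length + 1) hU h1)
    obtain ⟨v, hv, hwv⟩ := reads_kstar_of_reflTransGen
      (derives_chain_sound (j := l.length + 1) hU h2)
    have hwu' := walk_of_flagged hwu
    have hwv' := walk_of_flagged hwv
    rw [show (2 * z + 1) / 2 = z by omega] at hwu' hwv'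
    rw [show 2 * z / 2 = z by omega] at hwv'
    exact ⟨z, ⟨u, hu, hwu'⟩, v, hv, ne_nil_of_flagged hwv, hwv'⟩

/-- The converse of `accepts_omega_of_derives`, with a bound for the depth of the derivation. -/
theorem derives_of_accepts_omega {l : List InstanceSymbol}
    (hE : ∀ x a y, E x a y → y < vertexBound l)
    {U : RegularExpression β} {i j D : ℕ}
    (hU : ∀ x y, Reads E U.matches' x y → x < moveBound l → Derives l D (3, j, x, y))
    (hi : ∀ x z b, lassoPremise l i x z b l[i]? =
      bif Nat.beq b 0 then chain l j x (2 * z + 1) else chain l j (2 * z) (2 * z + 1))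
    {x y : ℕ} (hx : x < vertexBound l) (h : (OmegaRegularExpression.omega U).Accepts E x) :
    Derives l (D + l.length + 3) (2, i, 2 * x + 1, y) := by
  have hb : moveBound l = 2 * vertexBound l := pow_succ' _ _
  obtain ⟨z, ⟨u, hu, hwu⟩, v, hv, hv0, hwv⟩ := h
  have hz : z < vertexBound l := Finset.mem_range.1 (Walk.target_mem
    (fun x a y h => Finset.mem_range.2 (hE x a y h)) hv0 hwv)
  have hR : ∀ x y, Reads E U.matches' x y → x < moveBound l →
      y < moveBound l ∧ Derives l D (3, j, x, y) :=
    fun x y h hx => ⟨lt_of_reads hE h hx, hU x y h hx⟩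
  refine derives_lasso.2 ⟨z, by omega, ?_, ?_⟩ <;> rw [hi]
  · exact derives_chain_complete hR (by omega)
      (reflTransGen_of_reads_kstar ⟨u, hu, flagged_of_walk hwu⟩)
  · exact derives_chain_complete hR (by omega)
      (reflTransGen_of_reads_kstar ⟨v, hv, flagged_of_walk_of_ne_nil hv0 hwv⟩)

end Graph

section Expressions

variable {l : List InstanceSymbol} {E : ℕ → ℕ → ℕ → Prop}

/-- The rules for letters agree with the graph `E`. -/
def EdgesAgree (l : List InstanceSymbol) (E : ℕ → ℕ → ℕ → Prop) : Prop :=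
  ∀ x a y, flagged E x a y ↔ ∃ z < moveBound l, isWeight l z = true ∧ readNatural (l.drop z) = a ∧
    isEdge l x a y = true

theorem getElem?_eq_of_prefix {s : InstanceSymbol} {t : List InstanceSymbol} {i : ℕ}
    (h : s :: t <+: l.drop i) : l[i]? = some s := by
  obtain ⟨r, hr⟩ := h
  rw [← Nat.add_zero i, ← List.getElem?_drop, ← hr]
  rfl

theorem prefix_of_cons_prefix {s : InstanceSymbol} {t : List InstanceSymbol} {i : ℕ}
    (h : s :: t <+: l.drop i) : t <+: l.drop (i + 1) := by
  obtain ⟨r, hr⟩ := h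
  exact ⟨r, by rw [← List.drop_drop, ← hr]; rfl⟩

theorem prefix_of_append_prefix {t t' : List InstanceSymbol} {i : ℕ} (ht : IsTerm t)
    (h : t ++ t' <+: l.drop (i + 1)) : t <+: l.drop (i + 1) ∧ t' <+: l.drop (second l i) := by
  refine ⟨(List.prefix_append t t').trans h, ?_⟩
  obtain ⟨r, hr⟩ := h
  refine ⟨r, ?_⟩
  rw [second, ← List.drop_drop, ← hr, List.append_assoc, ht.termLength_append, List.drop_left]

/-- Derivable claims about walks are true. -/
theorem reads_of_derives (hl : EdgesAgree l E) (U : RegularExpression ℕ) {i : ℕ}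
    (hi : U.encode <+: l.drop i) {k x y : ℕ} (h : Derives l k (3, i, x, y)) :
    Reads E U.matches' x y := by
  induction U generalizing i k x y with
  | zero =>
    have hs := getElem?_eq_of_prefix hi
    cases k with
    | zero => simp [Derives] at h
    | succ k =>
      obtain ⟨z, hz, h, -⟩ := derives_walk.1 h
      rw [hs] at h
      simpa using derives_leaf.1 h
  | epsilon =>
    have hs := getElem?_eq_of_prefix hi
    cases k with
    | zero => simp [Derives] at h
    | succ k =>
      obtain ⟨z, hz, h, -⟩ := derives_walk.1 h
      rw [hs] at h
      exact ⟨[], rfl, Nat.eq_of_beq_eq_true (derives_leaf.1 h)⟩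
  | char a =>
    have hs := getElem?_eq_of_prefix hi
    obtain ⟨r, hr⟩ := prefix_of_cons_prefix hi
    cases k with
    | zero => simp [Derives] at h
    | succ k =>
      obtain ⟨z, hz, h, -⟩ := derives_walk.1 h
      rw [hs] at h
      have h := derives_leaf.1 h
      rw [Bool.and_eq_true, Bool.and_eq_true, ← hr, readNatural_encodeNatural] at h
      have ha := Nat.eq_of_beq_eq_true h.2.1
      exact ⟨[a], rfl, y, (hl x a y).2 ⟨z, hz, h.1, ha, ha ▸ h.2.2⟩, rfl⟩
  | plus P Q ihP ihQ =>
    have hs := getElem?_eq_of_prefix hi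
    obtain ⟨h1, h2⟩ := prefix_of_append_prefix (isTerm_encode P) (prefix_of_cons_prefix hi)
    cases k with
    | zero => simp [Derives] at h
    | succ k =>
      obtain ⟨z, hz, h, -⟩ := derives_walk.1 h
      rw [hs] at h
      simp only [walkPremise] at h
      cases hb : Nat.beq (z % 2) 0 <;> rw [hb] at h
      · obtain ⟨u, hu, h⟩ := ihQ h2 h
        exact ⟨u, Or.inr hu, h⟩
      · obtain ⟨u, hu, h⟩ := ihP h1 h
        exact ⟨u, Or.inl hu, h⟩
  | comp P Q ihP ihQ =>
    have hs := getElem?_eq_of_prefix hi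
    obtain ⟨h1, h2⟩ := prefix_of_append_prefix (isTerm_encode P) (prefix_of_cons_prefix hi)
    cases k with
    | zero => simp [Derives] at h
    | succ k =>
      obtain ⟨z, hz, hP, hQ⟩ := derives_walk.1 h
      rw [hs] at hP hQ
      obtain ⟨u, hu, hwu⟩ := ihP h1 hP
      obtain ⟨v, hv, hwv⟩ := ihQ h2 hQ
      exact ⟨u ++ v, Language.append_mem_mul hu hv, hwu.append hwv⟩
  | star P ih =>
    have hs := getElem?_eq_of_prefix hi
    have h1 := prefix_of_cons_prefix hi
    cases k with
    | zero => simp [Derives] at h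
    | succ k =>
      obtain ⟨z, hz, h, -⟩ := derives_walk.1 h
      rw [hs] at h
      exact reads_kstar_of_reflTransGen
        (derives_chain_sound (j := l.length + 1) (fun k x y => ih h1) h)

/-- True claims about walks have derivations of polynomial depth. -/
theorem derives_of_reads (hl : EdgesAgree l E) (hE : ∀ x a y, E x a y → y < vertexBound l)
    (U : RegularExpression ℕ) {i : ℕ} (hi : U.encode <+: l.drop i) {x y : ℕ}
    (h : Reads E U.matches' x y) (hx : x < moveBound l) :
    Derives l (U.encode.length * (l.length + 3)) (3, i, x, y) := by
  have hpos : 0 < moveBound l := Nat.two_pow_pos _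
  have h2 := two_le_moveBound l
  induction U generalizing i x y with
  | zero => obtain ⟨u, hu, -⟩ := h; exact absurd hu (Language.notMem_zero _)
  | epsilon =>
    have hs := getElem?_eq_of_prefix hi
    obtain ⟨u, hu, h⟩ := h
    obtain rfl : u = [] := hu
    obtain rfl : x = y := h
    refine Derives.mono (k := 1) (derives_walk.2 ⟨0, hpos, ?_⟩) (by simp [RegularExpression.encode])
    rw [hs]
    simp [walkPremise, derives_leaf]
  | char a =>
    have hs := getElem?_eq_of_prefix hi
    obtain ⟨r, hr⟩ := prefix_of_cons_prefix hi
    obtain ⟨u, hu, h⟩ := h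
    obtain rfl : u = [a] := hu
    obtain ⟨y', h, rfl⟩ := h
    obtain ⟨z, hz, h1, h2, h3⟩ := (hl x a y').1 h
    refine Derives.mono (k := 1) (derives_walk.2 ⟨z, hz, ?_⟩) ?_
    · rw [hs]
      simp only [walkPremise, derives_leaf]
      rw [← hr, readNatural_encodeNatural, h1, h2, h3, Nat.beq_self]
      simp
    · simp only [RegularExpression.encode, List.length_cons]
      nlinarith
  | plus P Q ihP ihQ =>
    have hs := getElem?_eq_of_prefix hi
    obtain ⟨h3, h4⟩ := prefix_of_append_prefix (isTerm_encode P) (prefix_of_cons_prefix hi)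
    have hle : P.encode.length * (l.length + 3) + Q.encode.length * (l.length + 3) + 1 ≤
        (RegularExpression.encode (P.plus Q)).length * (l.length + 3) := by
      simp only [RegularExpression.encode, List.length_cons, List.length_append]
      linarith
    obtain ⟨u, hu | hu, h⟩ := h
    · have := ihP h3 ⟨u, hu, h⟩ hx
      refine Derives.mono (derives_walk.2 ⟨0, hpos, ?_⟩)
        ((Nat.add_le_add_right (Nat.le_add_right _ _) 1).trans hle)
      rw [hs]
      exact ⟨this, this⟩
    · have := ihQ h4 ⟨u, hu, h⟩ hx
      refine Derives.mono (derives_walk.2 ⟨1, h2, ?_⟩)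
        ((Nat.add_le_add_right (Nat.le_add_left _ _) 1).trans hle)
      rw [hs]
      exact ⟨this, this⟩
  | comp P Q ihP ihQ =>
    have hs := getElem?_eq_of_prefix hi
    obtain ⟨h3, h4⟩ := prefix_of_append_prefix (isTerm_encode P) (prefix_of_cons_prefix hi)
    have hle : P.encode.length * (l.length + 3) + Q.encode.length * (l.length + 3) + 1 ≤
        (RegularExpression.encode (P.comp Q)).length * (l.length + 3) := by
      simp only [RegularExpression.encode, List.length_cons, List.length_append]
      linarith
    obtain ⟨_, hu, h⟩ := h
    obtain ⟨u, hu', v, hv, rfl⟩ := Language.mem_mul.1 hu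
    obtain ⟨z, hwu, hwv⟩ := Walk.append_iff.1 h
    have hz := lt_of_reads hE ⟨u, hu', hwu⟩ hx
    refine Derives.mono (derives_walk.2 ⟨z, hz, ?_⟩) hle
    rw [hs]
    exact ⟨(ihP h3 ⟨u, hu', hwu⟩ hx).mono (Nat.le_add_right _ _),
      (ihQ h4 ⟨v, hv, hwv⟩ hz).mono (Nat.le_add_left _ _)⟩
  | star P ih =>
    have hs := getElem?_eq_of_prefix hi
    have h3 := prefix_of_cons_prefix hi
    have := derives_chain_complete (R := Reads E P.matches')
      (fun x y h hx => ⟨lt_of_reads hE h hx, ih h3 h hx⟩) hx (reflTransGen_of_reads_kstar h)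
    have h' : Derives l (P.encode.length * (l.length + 3) + l.length + 2 + 1) (3, i, x, y) :=
      derives_walk.2 ⟨0, hpos, by rw [hs]; exact ⟨this, this⟩⟩
    refine h'.mono ?_
    simp only [RegularExpression.encode, List.length_cons]
    linarith

/-- Derivable claims about lassos are true. -/
theorem accepts_of_derives (hl : EdgesAgree l E) (e : OmegaRegularExpression ℕ) {i : ℕ}
    (hi : e.encode <+: l.drop i) {k x y : ℕ} (h : Derives l k (2, i, x, y)) :
    e.Accepts E (x / 2) := by
  induction e generalizing i k x y with
  | omega U =>
    have hs := getElem?_eq_of_prefix hi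
    have h1 := prefix_of_cons_prefix hi
    exact accepts_omega_of_derives (fun k x y => reads_of_derives hl U h1)
      (fun x z b => by rw [hs]; rfl) h
  | concat U e ih =>
    have hs := getElem?_eq_of_prefix hi
    obtain ⟨h3, h4⟩ := prefix_of_append_prefix (isTerm_encode U) (prefix_of_cons_prefix hi)
    cases k with
    | zero => simp [Derives] at h
    | succ k =>
      obtain ⟨z, hz, hU, he⟩ := derives_lasso.1 h
      rw [hs] at hU he
      obtain ⟨u, hu, hwu⟩ := reads_of_derives hl U h3 hU
      exact ⟨_, ⟨u, hu, walk_of_flagged hwu⟩, ih h4 he⟩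
  | union e e' ih ih' =>
    have hs := getElem?_eq_of_prefix hi
    obtain ⟨h3, h4⟩ := prefix_of_append_prefix (isTerm_omegaEncode e) (prefix_of_cons_prefix hi)
    cases k with
    | zero => simp [Derives] at h
    | succ k =>
      obtain ⟨z, hz, h, -⟩ := derives_lasso.1 h
      rw [hs] at h
      simp only [lassoPremise] at h
      cases hb : Nat.beq (z % 2) 0 <;> rw [hb] at h
      · exact Or.inr (ih' h4 h)
      · exact Or.inl (ih h3 h)

/-- True claims about lassos have derivations of polynomial depth. -/
theorem derives_of_accepts (hl : EdgesAgree l E) (hE : ∀ x a y, E x a y → y < vertexBound l)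
    (e : OmegaRegularExpression ℕ) {i : ℕ} (hi : e.encode <+: l.drop i) {x : ℕ}
    (hx : x < vertexBound l) (h : e.Accepts E x) :
    Derives l (e.encode.length * (l.length + 3)) (2, i, 2 * x + 1, 0) := by
  have hb : moveBound l = 2 * vertexBound l := pow_succ' _ _
  have hpos : 0 < moveBound l := Nat.two_pow_pos _
  have h2 := two_le_moveBound l
  induction e generalizing i x with
  | omega U =>
    have hs := getElem?_eq_of_prefix hi
    have h1 := prefix_of_cons_prefix hi
    refine (derives_of_accepts_omega hE (fun x y h hx => derives_of_reads hl hE U h1 h hx)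
      (fun x z b => by rw [hs]; rfl) hx h).mono ?_
    simp only [OmegaRegularExpression.encode, List.length_cons]
    linarith
  | concat U e ih =>
    have hs := getElem?_eq_of_prefix hi
    obtain ⟨h3, h4⟩ := prefix_of_append_prefix (isTerm_encode U) (prefix_of_cons_prefix hi)
    obtain ⟨z, ⟨u, hu, hwu⟩, he⟩ := h
    have hr : Reads E U.matches' (2 * x + 1) (2 * z + 1) := ⟨u, hu, flagged_of_walk hwu⟩
    have hz := lt_of_reads hE hr (by omega)
    have hle : U.encode.length * (l.length + 3) + e.encode.length * (l.length + 3) + 1 ≤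
        (OmegaRegularExpression.encode (.concat U e)).length * (l.length + 3) := by
      simp only [OmegaRegularExpression.encode, List.length_cons, List.length_append]
      linarith
    refine Derives.mono (derives_lasso.2 ⟨z, by omega, ?_⟩) hle
    rw [hs]
    exact ⟨(derives_of_reads hl hE U h3 hr (by omega)).mono (Nat.le_add_right _ _),
      (ih h4 (by omega) he).mono (Nat.le_add_left _ _)⟩
  | union e e' ih ih' =>
    have hs := getElem?_eq_of_prefix hi
    obtain ⟨h3, h4⟩ := prefix_of_append_prefix (isTerm_omegaEncode e) (prefix_of_cons_prefix hi)
    have hle : e.encode.length * (l.length + 3) + e'.encode.length * (l.length + 3) + 1 ≤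
        (OmegaRegularExpression.encode (.union e e')).length * (l.length + 3) := by
      simp only [OmegaRegularExpression.encode, List.length_cons, List.length_append]
      linarith
    rcases h with h | h
    · have := ih h3 hx h
      refine Derives.mono (derives_lasso.2 ⟨0, hpos, ?_⟩)
        ((Nat.add_le_add_right (Nat.le_add_right _ _) 1).trans hle)
      rw [hs]
      exact ⟨this, this⟩
    · have := ih' h4 hx h
      refine Derives.mono (derives_lasso.2 ⟨1, h2, ?_⟩)
        ((Nat.add_le_add_right (Nat.le_add_left _ _) 1).trans hle)
      rw [hs]
      exact ⟨this, this⟩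

/-- At the end of the string every letter is allowed, that is, the constraint is `Σ^ω`. -/
theorem derives_end_iff (hl : EdgesAgree l E) (hE : ∀ x a y, E x a y → y < vertexBound l) {x : ℕ}
    (hx : x < vertexBound l) :
    Derives l ((l.length + 1) * (l.length + 4)) (2, l.length, 2 * x + 1, 0) ↔
      (OmegaRegularExpression.omega (RegularExpression.char ())).Accepts
        (fun x _ y => ∃ a, E x a y) x := by
  have hs : l[l.length]? = none := List.getElem?_eq_none le_rfl
  have hE' : ∀ x (_ : Unit) y, (∃ a, E x a y) → y < vertexBound l := fun x _ y ⟨a, h⟩ => hE x a y h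
  have hflag : ∀ x a y, flagged (fun x (_ : Unit) y => ∃ a, E x a y) x a y ↔ ∃ a, flagged E x a y :=
    fun x a y => ⟨fun ⟨h, a, h'⟩ => ⟨a, h, h'⟩, fun ⟨a, h, h'⟩ => ⟨h, a, h'⟩⟩
  constructor
  · intro h
    have := accepts_omega_of_derives (E := fun x (_ : Unit) y => ∃ a, E x a y)
      (U := RegularExpression.char ()) (j := l.length) ?_
      (fun x z b => by rw [hs]; rfl) h
    · rwa [show (2 * x + 1) / 2 = x by omega] at this
    · intro k x y h
      cases k with
      | zero => simp [Derives] at h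
      | succ k =>
        obtain ⟨z, hz, h, -⟩ := derives_walk.1 h
        rw [hs] at h
        have h := derives_leaf.1 h
        rw [Bool.and_eq_true] at h
        exact ⟨[()], rfl, y, (hflag _ _ _).2 ⟨_, (hl _ _ _).2 ⟨z, hz, h.1, rfl, h.2⟩⟩, rfl⟩
  · intro h
    refine (derives_of_accepts_omega hE' (D := 1) (j := l.length) ?_
      (fun x z b => by rw [hs]; rfl) hx h).mono (by nlinarith)
    rintro x y ⟨u, hu, h⟩ -
    obtain rfl : u = [()] := hu
    obtain ⟨y', h, rfl⟩ := h
    obtain ⟨a, h⟩ := (hflag _ _ _).1 h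
    obtain ⟨z, hz, h1, rfl, h3⟩ := (hl _ _ _).1 h
    refine derives_walk.2 ⟨z, hz, ?_⟩
    rw [hs]
    simp only [walkPremise, derives_leaf, h1, h3]
    simp

end Expressions

end DiscountedSum

/-! ### The decision procedure on encoded instances -/

namespace DiscountedSum

/-- A problem is in PSPACE if a function that is computable in polynomial space decides it. -/
theorem decidableInPSPACE_of_polySpace {α : Type} {encode : α → List InstanceSymbol} {Q : α → Prop}
    {f : List InstanceSymbol → Bool} (hf : PolySpace f) (h : ∀ x, f (encode x) = true ↔ Q x) :
    DecidableInPSPACE encode Q := by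
  obtain ⟨P, p, hP⟩ := hf 0
  have hframe : ∀ n : ℕ, CounterProgram.frame 0 0 [n] = fun r => if r = 0 then n else 0 :=
    fun n => by
    funext r
    cases r <;> simp [CounterProgram.frame]
  refine decidableInPSPACE_of_runs P (p.comp (4 * Polynomial.X)) fun x =>
    ⟨CounterProgram.frame 0 0 [(f (encode x)).toNat], ?_, fun hx => ?_, fun hx => ?_⟩
  · have hs := size_wordNumber_le (encode x)
    have := hP 0 (encode x) (4 * (encode x).length)
      (CounterProgram.bounded_frame_iff.2 ⟨by simp, by simpa [RegisterData.registers] using hs⟩)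
    rw [← hframe]
    simpa [RegisterData.registers] using this
  · rw [(h x).2 hx]; rfl
  · rw [Bool.eq_false_iff.2 (fun h' => hx ((h x).1 h'))]; rfl

/-- The places in a list of numbers where a number begins. -/
theorem exists_encodeNatural_prefix (ws : List ℕ) {z : ℕ}
    (hz : z < (ws.flatMap encodeNatural).length)
    (h : z = 0 ∨ (ws.flatMap encodeNatural)[z - 1]? = some InstanceSymbol.sep) :
    ∃ a ∈ ws, encodeNatural a <+: (ws.flatMap encodeNatural).drop z := by
  induction ws generalizing z with
  | nil => simp at hz
  | cons a ws ih =>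
    rcases Nat.eq_zero_or_pos z with rfl | hpos
    · exact ⟨a, by simp, by simp⟩
    have h := h.resolve_left hpos.ne'
    rw [List.flatMap_cons] at h hz ⊢
    rcases lt_or_ge z (encodeNatural a).length with hlt | hge
    · rw [List.getElem?_append_left (by omega), encodeNatural] at h
      rw [encodeNatural, List.length_append, List.length_singleton] at hlt
      rw [List.getElem?_append_left (by omega), List.getElem?_map] at h
      cases hb : a.bits[z - 1]? <;> rw [hb] at h <;> simp at h
    · obtain ⟨z, rfl⟩ := Nat.exists_eq_add_of_le hge
      rw [List.length_append] at hz
      obtain ⟨b, hb, hp⟩ := ih (z := z) (by omega) (by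
        rcases Nat.eq_zero_or_pos z with rfl | hz0
        · exact Or.inl rfl
        · right
          rwa [List.getElem?_append_right (by omega),
            show (encodeNatural a).length + z - 1 - (encodeNatural a).length = z - 1 by omega] at h)
      refine ⟨b, by simp [hb], ?_⟩
      rwa [List.drop_append, List.drop_of_length_le (by omega), List.nil_append,
        Nat.add_sub_cancel_left]

/-- Every number of a list is found at such a place. -/
theorem exists_position (ws : List ℕ) {a : ℕ} (ha : a ∈ ws) :
    ∃ z < (ws.flatMap encodeNatural).length,
      (z = 0 ∨ (ws.flatMap encodeNatural)[z - 1]? = some InstanceSymbol.sep) ∧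
        encodeNatural a <+: (ws.flatMap encodeNatural).drop z := by
  induction ws with
  | nil => simp at ha
  | cons b ws ih =>
    have hb : (encodeNatural b).length = b.bits.length + 1 := by simp [encodeNatural]
    rw [List.flatMap_cons]
    by_cases hab : a = b
    · subst hab
      exact ⟨0, by rw [List.length_append]; omega, Or.inl rfl, by simp⟩
    · obtain ⟨z, hz, h, hp⟩ := ih ((List.mem_cons.1 ha).resolve_left hab)
      refine ⟨(encodeNatural b).length + z, by rw [List.length_append]; omega, Or.inr ?_, ?_⟩
      · rcases Nat.eq_zero_or_pos z with rfl | hz0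
        · rw [Nat.add_zero, List.getElem?_append_left (by omega), hb, Nat.add_sub_cancel,
            encodeNatural, List.getElem?_append_right (by simp)]
          simp
        · rw [List.getElem?_append_right (by omega),
            show (encodeNatural b).length + z - 1 - (encodeNatural b).length = z - 1 by omega]
          exact h.resolve_left hz0.ne'
      · rwa [List.drop_append, List.drop_of_length_le (by omega), List.nil_append,
          Nat.add_sub_cancel_left]

theorem readNatural_of_prefix {l : List InstanceSymbol} {a : ℕ} (h : encodeNatural a <+: l) :
    readNatural l = a := by
  obtain ⟨r, rfl⟩ := h
  exact readNatural_encodeNatural a r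

section Instance

variable (P : GTDS) (C : List InstanceSymbol)

theorem encode_append_eq : P.encode ++ C = encodeNatural P.p ++ (encodeNatural P.q ++
    (encodeInteger P.c ++ (encodeNatural P.d ++ (P.weights.flatMap encodeNatural ++ C)))) := by
  simp only [GTDS.encode, List.append_assoc]

theorem drop_posQ : (P.encode ++ C).drop (posQ (P.encode ++ C)) = encodeNatural P.q ++
    (encodeInteger P.c ++ (encodeNatural P.d ++ (P.weights.flatMap encodeNatural ++ C))) := by
  rw [encode_append_eq, posQ, (isTerm_encodeNatural _).termLength_append, List.drop_left]

theorem drop_posC : (P.encode ++ C).drop (posC (P.encode ++ C)) =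
    encodeInteger P.c ++ (encodeNatural P.d ++ (P.weights.flatMap encodeNatural ++ C)) := by
  rw [posC, ← List.drop_drop, drop_posQ, (isTerm_encodeNatural _).termLength_append, List.drop_left]

theorem drop_posD : (P.encode ++ C).drop (posD (P.encode ++ C)) =
    encodeNatural P.d ++ (P.weights.flatMap encodeNatural ++ C) := by
  rw [posD, ← List.drop_drop, drop_posC, (isTerm_encodeInteger _).termLength_append, List.drop_left]

theorem drop_posWeights : (P.encode ++ C).drop (posWeights (P.encode ++ C)) =
    P.weights.flatMap encodeNatural ++ C := by
  rw [posWeights, ← List.drop_drop, drop_posD, (isTerm_encodeNatural _).termLength_append,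
    List.drop_left]

theorem posWeights_add : posWeights (P.encode ++ C) + (P.weights.flatMap encodeNatural).length =
    P.encode.length := by
  rw [posWeights, drop_posD, (isTerm_encodeNatural _).termLength_append, posD, drop_posC,
    (isTerm_encodeInteger _).termLength_append, posC, drop_posQ,
    (isTerm_encodeNatural _).termLength_append, posQ, encode_append_eq,
    (isTerm_encodeNatural _).termLength_append, GTDS.encode]
  simp only [List.length_append]

theorem not_isOmegaSymbol_of_mem_encode {s : InstanceSymbol} (hs : s ∈ P.encode) :
    isOmegaSymbol (some s) = false := by
  have h1 : ∀ n, s ∈ encodeNatural n → isOmegaSymbol (some s) = false := by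
    intro n hn
    simp only [encodeNatural, List.mem_append, List.mem_map, List.mem_singleton] at hn
    rcases hn with ⟨b, -, rfl⟩ | rfl <;> rfl
  have h2 : s ∈ encodeInteger P.c → isOmegaSymbol (some s) = false := by
    intro h
    rcases List.mem_append.1 h with h | h
    · split at h
      · obtain rfl := List.mem_singleton.1 h
        rfl
      · simp at h
    · exact h1 _ h
  simp only [GTDS.encode, List.mem_append, List.mem_flatMap] at hs
  rcases hs with (((h | h) | h) | h) | ⟨a, -, h⟩
  · exact h1 _ h
  · exact h1 _ h
  · exact h2 h
  · exact h1 _ h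
  · exact h1 _ h

variable {C}

theorem prefixLength_encode (hC : ∀ s ∈ C.head?, isOmegaSymbol (some s)) :
    prefixLength (P.encode ++ C) = P.encode.length :=
  prefixLength_append (fun _ => not_isOmegaSymbol_of_mem_encode P) hC

theorem exists_isWeight_iff (hC : ∀ s ∈ C.head?, isOmegaSymbol (some s)) (a : ℕ) :
    (∃ z < moveBound (P.encode ++ C), isWeight (P.encode ++ C) z = true ∧
      readNatural ((P.encode ++ C).drop z) = a) ↔ a ∈ P.weights := by
  set l := P.encode ++ C with hl
  have hpre : prefixLength l = P.encode.length := prefixLength_encode P hC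
  have hadd : posWeights l + (P.weights.flatMap encodeNatural).length = P.encode.length :=
    posWeights_add P C
  have hdrop : l.drop (posWeights l) = P.weights.flatMap encodeNatural ++ C := drop_posWeights P C
  have hget : ∀ z, 0 < z → z < (P.weights.flatMap encodeNatural).length →
      l[posWeights l + z - 1]? = (P.weights.flatMap encodeNatural)[z - 1]? := fun z h0 h => by
    rw [Nat.add_sub_assoc h0, ← List.getElem?_drop, hdrop, List.getElem?_append_left (by omega)]
  have hdrop' : ∀ z, z < (P.weights.flatMap encodeNatural).length →
      l.drop (posWeights l + z) = (P.weights.flatMap encodeNatural).drop z ++ C := fun z h => by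
    rw [← List.drop_drop, hdrop, List.drop_append_of_le_length h.le]
  constructor
  · rintro ⟨z, -, hz, rfl⟩
    rw [isWeight, Bool.and_eq_true, Bool.and_eq_true, Bool.or_eq_true, hpre,
      decide_eq_true_iff] at hz
    obtain ⟨h1, h2, h3⟩ := hz
    have h1 := Nat.le_of_ble_eq_true h1
    have h2 := Nat.le_of_ble_eq_true h2
    obtain ⟨z, rfl⟩ := Nat.exists_eq_add_of_le h1
    have hlt : z < (P.weights.flatMap encodeNatural).length := by omega
    obtain ⟨a, ha, hp⟩ := exists_encodeNatural_prefix P.weights hlt (by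
      rcases Nat.eq_zero_or_pos z with h0 | h0
      · exact Or.inl h0
      · rcases h3 with h3 | h3
        · have := Nat.eq_of_beq_eq_true h3
          omega
        · exact Or.inr (hget z h0 hlt ▸ h3))
    rw [hdrop' z hlt, readNatural_of_prefix (hp.trans (List.prefix_append _ _))]
    exact ha
  · intro ha
    obtain ⟨z, hz, h, hp⟩ := exists_position P.weights ha
    refine ⟨posWeights l + z, ?_, ?_, ?_⟩
    · have : l.length < moveBound l := (Nat.lt_succ_self _).trans Nat.lt_two_pow_self
      rw [hl, List.length_append] at this
      rw [← hl] at this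
      omega
    · rw [isWeight, Bool.and_eq_true, Bool.and_eq_true, Bool.or_eq_true, hpre, decide_eq_true_iff]
      refine ⟨Nat.ble_eq_true_of_le (Nat.le_add_right _ _), Nat.ble_eq_true_of_le (by omega), ?_⟩
      rcases Nat.eq_zero_or_pos z with rfl | h0
      · exact Or.inl (by rw [Nat.add_zero]; exact Nat.beq_self _)
      · exact Or.inr ((hget z h0 hz).trans (h.resolve_left h0.ne'))
    · rw [hdrop' z hz, readNatural_of_prefix (hp.trans (List.prefix_append _ _))]

theorem edgesAgree_encode (hC : ∀ s ∈ C.head?, isOmegaSymbol (some s)) :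
    EdgesAgree (P.encode ++ C) (P.Edge (Finset.range (vertexBound (P.encode ++ C)))) := by
  intro x a y
  have hp : readNatural (P.encode ++ C) = P.p := by
    rw [encode_append_eq, readNatural_encodeNatural]
  have hq : readNatural ((P.encode ++ C).drop (posQ (P.encode ++ C))) = P.q := by
    rw [drop_posQ, readNatural_encodeNatural]
  have hd : readNatural ((P.encode ++ C).drop (posD (P.encode ++ C))) = P.d := by
    rw [drop_posD, readNatural_encodeNatural]
  have hedge : isEdge (P.encode ++ C) x a y = true ↔ y % 2 = 1 ∧
      y / 2 < vertexBound (P.encode ++ C) ∧ P.p * (y / 2) + P.q * P.d * a = P.q * (x / 2) := by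
    rw [isEdge, Bool.and_eq_true, Bool.and_eq_true, hp, hq, hd, Nat.beq_eq, Nat.ble_eq, Nat.beq_eq,
      Nat.succ_le_iff]
  rw [flagged, GTDS.Edge, ← exists_isWeight_iff P hC, Finset.mem_range]
  simp only [hedge]
  constructor
  · rintro ⟨h1, ⟨z, hz, hw, ha⟩, h3, h4⟩
    exact ⟨z, hz, hw, ha, h1, h3, h4⟩
  · rintro ⟨z, hz, hw, ha, h1, h3, h4⟩
    exact ⟨h1, ⟨z, hz, hw, ha⟩, h3, h4⟩

/-- The decision procedure starts the game at the numerator of the target. -/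
theorem decider_eq_true_iff (hC : ∀ s ∈ C.head?, isOmegaSymbol (some s)) :
    decider (P.encode ++ C) = true ↔
    ∃ x < vertexBound (P.encode ++ C), (x : ℤ) = P.c ∧ Derives (P.encode ++ C)
      (((P.encode ++ C).length + 1) * ((P.encode ++ C).length + 4))
      (2, P.encode.length, 2 * x + 1, 0) := by
  set l := P.encode ++ C with hl
  have hpre : prefixLength l = P.encode.length := prefixLength_encode P hC
  have hc : l.drop (posC l) = encodeInteger P.c ++
      (encodeNatural P.d ++ (P.weights.flatMap encodeNatural ++ C)) := drop_posC P C
  have hget : l[posC l]? = (encodeInteger P.c ++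
      (encodeNatural P.d ++ (P.weights.flatMap encodeNatural ++ C)))[0]? := by
    rw [← hc, List.getElem?_drop, Nat.add_zero]
  rw [decider, Bool.and_eq_true, Bool.and_eq_true, Bool.not_eq_true', decide_eq_false_iff_not,
    Bool.not_eq_true', moveCount, gameLost_eq_false_iff, initialClaim, hpre, Nat.ble_eq,
    Nat.succ_le_iff]
  rcases lt_or_ge P.c 0 with hneg | hpos
  · have : l[posC l]? = some InstanceSymbol.neg := by rw [hget]; simp [encodeInteger, hneg]
    refine iff_of_false (fun h => h.1 this) ?_
    rintro ⟨x, -, hx, -⟩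
    omega
  · have h0 : l[posC l]? ≠ some InstanceSymbol.neg := by
      rw [hget, encodeInteger, if_neg (not_lt.2 hpos), List.nil_append, encodeNatural]
      cases P.c.natAbs.bits <;> simp
    have hr : readNatural (l.drop (posC l)) = P.c.natAbs := by
      rw [hc, encodeInteger, if_neg (not_lt.2 hpos), List.nil_append, readNatural_encodeNatural]
    rw [hr]
    constructor
    · rintro ⟨-, h1, h2⟩
      rw [Nat.mod_eq_of_lt h1] at h2
      exact ⟨_, h1, Int.natAbs_of_nonneg hpos, h2⟩
    · rintro ⟨x, hx, hxc, h⟩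
      obtain rfl : x = P.c.natAbs := by omega
      refine ⟨h0, hx, ?_⟩
      rwa [Nat.mod_eq_of_lt hx]

theorem mul_maxWeight_lt : P.d * P.q * P.maxWeight < vertexBound (P.encode ++ C) := by
  have hlen : ∀ n, n < 2 ^ (encodeNatural n).length := fun n => by
    rw [encodeNatural, List.length_append, List.length_map, Nat.size_eq_bits_len]
    exact (Nat.lt_size_self n).trans_le (Nat.pow_le_pow_right two_pos (Nat.le_add_right _ _))
  have hmax : P.maxWeight < 2 ^ (P.weights.flatMap encodeNatural).length := by
    rcases List.eq_nil_or_concat P.weights with h0 | ⟨ws, b, hb⟩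
    · simp [GTDS.maxWeight, h0]
    · rw [GTDS.maxWeight, hb, List.concat_eq_append, List.getLastD_concat]
      refine (hlen b).trans_le (Nat.pow_le_pow_right two_pos ?_)
      simp
  have h : (P.encode ++ C).length = (encodeNatural P.p).length + (encodeNatural P.q).length +
      (encodeInteger P.c).length + (encodeNatural P.d).length +
        (P.weights.flatMap encodeNatural).length + C.length := by
    simp only [GTDS.encode, List.length_append]
  calc P.d * P.q * P.maxWeight < 2 ^ (encodeNatural P.d).length * 2 ^ (encodeNatural P.q).length *
        2 ^ (P.weights.flatMap encodeNatural).length :=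
        Nat.mul_lt_mul'' (Nat.mul_lt_mul'' (hlen _) (hlen _)) hmax
    _ = 2 ^ ((encodeNatural P.d).length + (encodeNatural P.q).length +
        (P.weights.flatMap encodeNatural).length) := by rw [pow_add, pow_add]
    _ ≤ _ := Nat.pow_le_pow_right two_pos (by omega)

/-- All remaining targets along an eventually periodic solution are vertices of the game. -/
theorem exists_run_vertexBound {w : Stream' ℕ} (hw : IsEventuallyPeriodic w) (hs : P.IsSolution w) :
    ∃ ρ : ℕ → ℕ, (ρ 0 : ℤ) = P.c ∧ (∀ i, ρ i < vertexBound (P.encode ++ C)) ∧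
      ∀ i, P.Edge (Finset.range (vertexBound (P.encode ++ C))) (ρ i) (w.get i) (ρ (i + 1)) := by
  obtain ⟨g, p, q, hg, hp, hq, hpq, hp0, hlt⟩ := P.exists_coprime
  obtain ⟨ρ, h0, -, hrec, hbound⟩ := P.exists_integer_run hg hp hq hpq hp0 hlt hw hs
  have hle : ∀ i, ρ i < vertexBound (P.encode ++ C) := fun i => by
    refine lt_of_le_of_lt ?_ (mul_maxWeight_lt P)
    calc ρ i ≤ ρ i * (q - p) := Nat.le_mul_of_pos_right _ (by omega)
      _ ≤ P.d * q * P.maxWeight := hbound i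
      _ ≤ P.d * P.q * P.maxWeight := by
        have : q ≤ P.q := hq ▸ Nat.le_mul_of_pos_left _ hg
        gcongr
  exact ⟨ρ, h0, hle, fun i => ⟨hs.1 i, Finset.mem_range.2 (hle _), hrec i⟩⟩

end Instance

/-- The same procedure decides both problems: without a constraint the string ends after the
weights. -/
theorem cgtds_decidableInPSPACE :
    DecidableInPSPACE CGTDS.encode CGTDS.HasEventuallyPeriodicSolution := by
  refine decidableInPSPACE_of_polySpace polySpace_decider fun P => ?_
  have hC : ∀ s ∈ P.constraint.encode.head?, isOmegaSymbol (some s) := by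
    cases P.constraint <;> simp [OmegaRegularExpression.encode, isOmegaSymbol]
  have hl := edgesAgree_encode P.toGTDS hC
  have hE : ∀ x a y, P.Edge (Finset.range (vertexBound P.encode)) x a y →
      y < vertexBound P.encode :=
    fun x a y h => Finset.mem_range.1 h.2.1
  have hi : P.constraint.encode <+: P.encode.drop P.toGTDS.encode.length := by
    rw [CGTDS.encode, List.drop_left]
  refine (decider_eq_true_iff P.toGTDS hC).trans ⟨?_, ?_⟩
  · rintro ⟨x, hx, hxc, h⟩
    have := accepts_of_derives hl P.constraint hi h
    rw [show (2 * x + 1) / 2 = x by omega] at this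
    obtain ⟨y, u, v, hv, hu, hv', hmem, -⟩ := this.exists_short
      (F := Finset.range (vertexBound P.encode)) fun x a y h => h.2.1
    exact ⟨_, ⟨u, v, hv, rfl⟩, P.isSolution_of_walk hv hxc hu hv', hmem⟩
  · rintro ⟨w, hw, hs, hL⟩
    obtain ⟨ρ, h0, hlt, hρ⟩ := exists_run_vertexBound P.toGTDS (C := P.constraint.encode) hw hs
    have h := P.constraint.accepts_of_mem_language (F := Finset.range (vertexBound P.encode))
      (fun i => Finset.mem_range.2 (hlt _)) hρ hL
    refine ⟨ρ 0, hlt 0, h0, (derives_of_accepts hl hE P.constraint hi (hlt 0) h).mono ?_⟩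
    refine Nat.mul_le_mul ?_ (Nat.le_succ _)
    rw [List.length_append]
    omega

theorem gtds_decidableInPSPACE :
    DecidableInPSPACE GTDS.encode GTDS.HasEventuallyPeriodicSolution := by
  refine decidableInPSPACE_of_polySpace polySpace_decider fun P => ?_
  have hC : ∀ s ∈ ([] : List InstanceSymbol).head?, isOmegaSymbol (some s) := by simp
  have hl := edgesAgree_encode P hC
  have hiff := decider_eq_true_iff P hC
  have hrun := fun w => exists_run_vertexBound P (C := []) (w := w)
  rw [List.append_nil] at hl hiff hrun
  have hE : ∀ x a y, P.Edge (Finset.range (vertexBound P.encode)) x a y →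
      y < vertexBound P.encode :=
    fun x a y h => Finset.mem_range.1 h.2.1
  refine hiff.trans ⟨?_, ?_⟩
  · rintro ⟨x, hx, hxc, h⟩
    obtain ⟨y, u, v, hv, hu, hv', -, -⟩ := ((derives_end_iff hl hE hx).1 h).exists_short
      (F := Finset.range (vertexBound P.encode)) fun x _ y ⟨_, h⟩ => h.2.1
    obtain ⟨u', -, hu⟩ := hu.exists_labels
    obtain ⟨v', hvl, hv'⟩ := hv'.exists_labels
    have hv0 : v' ≠ [] := by
      rintro rfl
      exact hv (List.length_eq_zero_iff.1 hvl.symm)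
    exact ⟨_, ⟨u', v', hv0, rfl⟩, P.isSolution_of_walk hv0 hxc hu hv'⟩
  · rintro ⟨w, hw, hs⟩
    obtain ⟨ρ, h0, hlt, hρ⟩ := hrun w hw hs
    have h := (OmegaRegularExpression.omega (RegularExpression.char ())).accepts_of_mem_language
      (E := fun x _ y => ∃ a, P.Edge (Finset.range (vertexBound P.encode)) x a y)
      (F := Finset.range (vertexBound P.encode))
      (fun i => Finset.mem_range.2 (hlt _)) (fun i => ⟨_, hρ i⟩) const_mem_language_char_omega
    exact ⟨ρ 0, hlt 0, h0, (derives_end_iff hl hE (hlt 0)).2 h⟩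

end DiscountedSum

theorem mainTheorem2 :
    DecidableInPSPACE CGTDS.encode CGTDS.HasEventuallyPeriodicSolution ∧
    DecidableInPSPACE GTDS.encode GTDS.HasEventuallyPeriodicSolution ∧
    (∀ P : CGTDS, P.HasEventuallyPeriodicSolution →
      ∃ (u v : List ℕ) (hv : v ≠ []), P.IsSolution (u ++ₛ Stream'.cycle v hv) ∧
        (u.length + v.length : ℚ) ≤
          2 * P.constraint.length * max 1 (P.d * (P.lam * P.maxWeight / (1 - P.lam)))) ∧
    (∀ P : GTDS, P.HasEventuallyPeriodicSolution →
      ∃ (u v : List ℕ) (hv : v ≠ []), P.IsSolution (u ++ₛ Stream'.cycle v hv) ∧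
        (u.length + v.length : ℚ) ≤
          2 * 2 * max 1 (P.d * (P.lam * P.maxWeight / (1 - P.lam)))) :=
  ⟨DiscountedSum.cgtds_decidableInPSPACE, DiscountedSum.gtds_decidableInPSPACE,
    CGTDS.exists_short_solution, GTDS.exists_short_solution⟩
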